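/- Let $a,b\in\mathbb R$ with $-1\le a<b\le 1$. Then there exist constants $C_3,C_4>0$ (depending only on $a,b$) such that for every $T>0$, $p\in\mathbb R$ and $n\in\mathbb Z$ there is a constant $\epsilon_{n,p}(T)\in\mathbb R$ satisfying $$|\epsilon_{n,p}(T)|\le \frac{C_3}{|p|+1}+e^{C_3\left(1+\frac1T+|p|-C_4\min\{|p|,p^2\}T\right)}$$ and, if $|n|>2|p|$, also $$|\epsilon_{n,p}(T)|\le \frac{C_3}{n^2}+e^{C_3\left(1+\frac1T-C_4n^2T\right)},$$ such that for every $g^0\in L^2(-1,1;\mathbb C)$ and $\widetilde h\in L^2([0,T]\times[-1,1];\mathbb C)$ the solution $g$ of $$\begin{cases}\big(\partial_t-\partial_x^2+(px+n)^2\big)g(t,x)=\widetilde h(t,x),&(t,x)\in(0,T)\times(-1,1),\\ g(t,\pm1)=0,&t\in(0,T),\\ g(0,x)=g^0(x),&x\in(-1,1),\end{cases}$$ satisfies $$\int_{-1}^1|g(T,x)|^2dx\le e^{C_3\left(1+\frac1T+|p|-C_4\min\{|p|,p^2\}T\right)}\int_0^T\!\!\int_a^b|g(t,x)|^2dx\,dt+\epsilon_{n,p}(T)\int_0^T\!\!\int_{-1}^1|\widetilde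 h(t,x)|^2dx\,dt .$$ Here the solution is understood in the weak sense: $g\in C([0,T];L^2(-1,1;\mathbb C))$, $g(0)=g^0$, and for every $\varphi\in H^2\cap H^1_0(-1,1;\mathbb C)$ the function $t\mapsto\int_{-1}^1g(t,x)\varphi(x)\,dx$ is absolutely continuous on $[0,T]$ with $$\frac{d}{dt}\int_{-1}^1g(t,x)\varphi(x)\,dx+\int_{-1}^1g(t,x)\big(-\varphi''(x)+(px+n)^2\varphi(x)\big)dx=\int_{-1}^1\widetilde h(t,x)\varphi(x)\,dx\quad\text{for a.e. }t\in[0,T].$$ -/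

import Mathlib

open MeasureTheory Set
open scoped ContDiff

namespace HeisenbergMode

/-- The space `L²(-1,1;ℂ)`. -/
abbrev L2 : Type := Lp ℂ 2 (volume.restrict (Ioo (-1 : ℝ) 1))

/-- `u` belongs to `L²(-1,1;ℂ)`, for a function `u` given pointwise. -/
def InL2 (u : ℝ → ℂ) : Prop := MemLp u 2 (volume.restrict (Ioo (-1 : ℝ) 1))

/-- `v` is the weak (distributional) derivative of `u` on `(-1,1)`. -/
def IsWeakDeriv (u v : ℝ → ℂ) : Prop :=
  ∀ η : ℝ → ℝ, ContDiff ℝ ∞ η → HasCompactSupport η → tsupport η ⊆ Ioo (-1 : ℝ) 1 →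
    ∫ x in (-1 : ℝ)..1, deriv η x • u x = - ∫ x in (-1 : ℝ)..1, η x • v x

/-- `φ` is (the continuous representative of) an element of `H² ∩ H¹₀(-1,1;ℂ)`, with weak
derivatives `φ₁ = φ'` and `φ₂ = φ''` in `L²(-1,1;ℂ)`.  In one dimension every element of `H¹(-1,1)`
is continuous on `[-1,1]`, and it is in `H¹₀(-1,1)` exactly when it vanishes at `±1`. -/
structure InDomain (φ φ₁ φ₂ : ℝ → ℂ) : Prop where
  continuousOn : ContinuousOn φ (Icc (-1 : ℝ) 1)
  left : φ (-1) = 0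
  right : φ 1 = 0
  inL2_deriv : InL2 φ₁
  inL2_deriv_two : InL2 φ₂
  weakDeriv : IsWeakDeriv φ φ₁
  weakDeriv_two : IsWeakDeriv φ₁ φ₂

/-- The space `L²([0,T] × [-1,1];ℂ)` of source terms. -/
def IsSource (T : ℝ) (h : ℝ → ℝ → ℂ) : Prop :=
  MemLp (Function.uncurry h) 2
    ((volume.restrict (Icc (0 : ℝ) T)).prod (volume.restrict (Icc (-1 : ℝ) 1)))

/-- `g` is the solution on `[0,T]` of the Cauchy problem
`∂ₜ g - ∂ₓ² g + (p x + n)² g = h` in `(0,T) × (-1,1)`, `g(t,±1) = 0`, `g(0) = g₀`: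
it is continuous in time with values in `L²(-1,1;ℂ)` and, tested with any element `φ` of the domain
`H² ∩ H¹₀(-1,1;ℂ)` of `A φ = -φ'' + (p x + n)² φ`, the function `t ↦ ∫ g(t) φ` is absolutely
continuous on `[0,T]` and satisfies `d/dt ∫ g(t) φ + ∫ g(t) A φ = ∫ h(t) φ` for a.e. `t`. The
boundary condition is contained in the choice of the test functions, which vanish at `±1` but whose
derivatives need not. -/
structure IsSolution (T p : ℝ) (n : ℤ) (g₀ : L2) (h : ℝ → ℝ → ℂ) (g : ℝ → L2) : Prop where
  continuousOn : ContinuousOn g (Icc 0 T)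
  initial : g 0 = g₀
  absolutelyContinuous : ∀ φ φ₁ φ₂ : ℝ → ℂ, InDomain φ φ₁ φ₂ →
    AbsolutelyContinuousOnInterval (fun t => ∫ x in (-1 : ℝ)..1, g t x * φ x) 0 T
  equation : ∀ φ φ₁ φ₂ : ℝ → ℂ, InDomain φ φ₁ φ₂ →
    ∀ᵐ t ∂(volume.restrict (Ioo (0 : ℝ) T)),
      HasDerivAt (fun s => ∫ x in (-1 : ℝ)..1, g s x * φ x)
        ((∫ x in (-1 : ℝ)..1, h t x * φ x)
          - ∫ x in (-1 : ℝ)..1, g t x * (-φ₂ x + ((p * x + n : ℝ) : ℂ) ^ 2 * φ x)) t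

end HeisenbergMode

namespace HeisenbergMode

/-! ### Calculus lemmas -/

/-! The operator `-∂ₓ² + V` with `V = (p x + n)²` has a Hilbert basis of Dirichlet eigenfunctions.
Its eigenvalues lie above some `Λ ≥ max (1/4) |p|`, and `Λ ≥ n²/4` when `2|p| < |n|`. The estimate
weighs the cost of observing the free evolution from `(a,b)` for a short time `τ` against the decay
at rate `Λ` up to time `T`.

That cost may only be exponential in `1/τ` and in `sup √V`; working with waves achieves this. In one
space dimension a solution of `W_ss = W_xx - V W` can be evolved in `x` instead of `s`, and if `|V|
≤ M²` its energy on shrinking time intervals grows at a rate linear in `M`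
(`IsWave.sideways_energy`). Averaging the starting point over `(a,b)` and removing `W_x` with
Caccioppoli's inequality (`IsWave.caccioppoli`) gives `IsWave.observability`, with cost `exp (6 M)`.
Heat is reduced to waves by a kernel that sends `exp (-ω² t)` to `cos (ω s) m(ω)`. It turns heat
modes into wave modes, and apart from the heat decay itself `m` loses only a factor `exp (-O(1/τ))`
and a power of `τ` (`exists_transmutation`). The result is `heat_observability_finite`.

For the problem with source, each coefficient differs from its free decay by a Duhamel integral.
Cauchy–Schwarz in time and Bessel's inequality in space bound the sum of the squared differences by
`‖h‖² / (2Λ)` (`IsSolution.sum_sq_sub_exp_le`). Dini's theorem passes from finite sums of modes to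
the trajectory (`norm_sq_le_of_observability`).

With `τ = min T 1 / 2` the product of cost and decay is at most `exp (A (1 + 1/T + |p| + |n|) - Λ
T)`. If `2|p| < |n|`, Young's inequality absorbs `A |n|` into part of `n² T / 4` at the price of a
multiple of `A² / T`. Otherwise `|n| ≤ 2|p|` and the decay rate is `|p|`. Since `p² ≤ n²` in the
first case, the rate `min |p| p²` (up to a constant) is available in both. -/

theorem hasDerivAt_max_sq (z : ℝ) : HasDerivAt (fun z : ℝ => max z 0 ^ 2) (2 * max z 0) z := by
  rcases lt_trichotomy z 0 with h | h | h
  · have h0 : HasDerivAt (fun _ : ℝ => (0 : ℝ)) 0 z := hasDerivAt_const z 0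
    rw [max_eq_right h.le, mul_zero]
    refine h0.congr_of_eventuallyEq ?_
    filter_upwards [Iio_mem_nhds h] with y hy
    rw [max_eq_right (le_of_lt hy)]; norm_num
  · subst h
    rw [max_self, mul_zero, hasDerivAt_iff_isLittleO]
    simp only [max_self, sub_zero, smul_zero]
    have h1 : (fun y : ℝ => max y 0 ^ 2 - 0 ^ 2) =O[nhds 0] fun y => y ^ 2 := by
      refine Asymptotics.IsBigO.of_bound 1 (Filter.Eventually.of_forall fun y => ?_)
      rcases le_total y 0 with hy | hy
      · simpa [hy] using sq_nonneg y
      · simp [hy]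
    refine h1.trans_isLittleO ?_
    simpa using Asymptotics.isLittleO_pow_pow (𝕜 := ℝ) (m := 1) (n := 2) (by norm_num)
  · have h0 : HasDerivAt (fun y : ℝ => y ^ 2) (2 * z) z := by
      simpa using hasDerivAt_pow 2 z
    rw [max_eq_left h.le]
    refine h0.congr_of_eventuallyEq ?_
    filter_upwards [Ioi_mem_nhds h] with y hy
    rw [max_eq_left (le_of_lt hy)]

theorem hasDerivAt_intervalIntegral_of_continuous {F F' : ℝ → ℝ → ℝ} {a b : ℝ}
    (hF : Continuous fun z : ℝ × ℝ => F z.1 z.2) (hF' : Continuous fun z : ℝ × ℝ => F' z.1 z.2)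
    (h : ∀ s y, HasDerivAt (F s) (F' s y) y) (y : ℝ) :
    HasDerivAt (fun y => ∫ s in a..b, F s y) (∫ s in a..b, F' s y) y := by
  obtain ⟨C, hC⟩ := (isCompact_uIcc.prod (isCompact_Icc (a := y - 1) (b := y + 1))).exists_bound_of_continuousOn
    (s := uIcc a b ×ˢ Icc (y - 1) (y + 1)) hF'.continuousOn
  refine (intervalIntegral.hasDerivAt_integral_of_dominated_loc_of_deriv_le
    (F := fun y s => F s y) (F' := fun y s => F' s y) (bound := fun _ => C)
    (Icc_mem_nhds (a := y - 1) (b := y + 1) (by linarith) (by linarith)) ?_ ?_ ?_ ?_ ?_ ?_).2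
  · exact Filter.Eventually.of_forall fun z =>
      (hF.comp (by fun_prop : Continuous fun s : ℝ => (s, z))).aestronglyMeasurable
  · exact (hF.comp (by fun_prop : Continuous fun s : ℝ => (s, y))).intervalIntegrable _ _
  · exact (hF'.comp (by fun_prop : Continuous fun s : ℝ => (s, y))).aestronglyMeasurable
  · exact Filter.Eventually.of_forall fun s hs z hz => hC (s, z) ⟨uIoc_subset_uIcc hs, hz⟩
  · exact intervalIntegrable_const
  · exact Filter.Eventually.of_forall fun s _ z _ => h s z

/-- Fubini's theorem for a continuous function on a rectangle. -/
theorem intervalIntegral_swap_of_continuous {F : ℝ → ℝ → ℝ} {a b c d : ℝ}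
    (hF : Continuous fun z : ℝ × ℝ => F z.1 z.2) :
    ∫ x in a..b, ∫ y in c..d, F x y = ∫ y in c..d, ∫ x in a..b, F x y := by
  refine intervalIntegral_intervalIntegral_swap ?_
  have h : IntegrableOn (fun z : ℝ × ℝ => F z.1 z.2) (uIcc a b ×ˢ uIcc c d) :=
    hF.continuousOn.integrableOn_compact (isCompact_uIcc.prod isCompact_uIcc)
  exact h.mono_set (prod_mono uIoc_subset_uIcc uIoc_subset_uIcc)

/-! ### Sideways estimate for the wave equation -/

/-- A classical solution `W` of `∂ₛ² W = ∂ₓ² W - V W` for `x ∈ S`, together with its partial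
derivatives. -/
structure IsWave (S : Set ℝ) (V : ℝ → ℝ) (W Ws Wx Wss Wxs Wxx : ℝ → ℝ → ℝ) : Prop where
  cont : Continuous fun z : ℝ × ℝ => W z.1 z.2
  cont_s : Continuous fun z : ℝ × ℝ => Ws z.1 z.2
  cont_x : Continuous fun z : ℝ × ℝ => Wx z.1 z.2
  cont_ss : Continuous fun z : ℝ × ℝ => Wss z.1 z.2
  cont_xs : Continuous fun z : ℝ × ℝ => Wxs z.1 z.2
  cont_xx : Continuous fun z : ℝ × ℝ => Wxx z.1 z.2
  deriv_s : ∀ s x, HasDerivAt (fun s => W s x) (Ws s x) s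
  deriv_ss : ∀ s x, HasDerivAt (fun s => Ws s x) (Wss s x) s
  deriv_x_s : ∀ s x, HasDerivAt (fun s => Wx s x) (Wxs s x) s
  deriv_x : ∀ s x, HasDerivAt (W s) (Wx s x) x
  deriv_s_x : ∀ s x, HasDerivAt (Ws s) (Wxs s x) x
  deriv_xx : ∀ s x, HasDerivAt (Wx s) (Wxx s x) x
  eqn : ∀ s, ∀ x ∈ S, Wxx s x = V x * W s x + Wss s x

/-- The equation is of second order in `x`, so it survives reflections. With `σ = ±1` both
directions of sideways propagation reduce to moving right from `0`. -/
theorem IsWave.comp_add_mul {S : Set ℝ} {V : ℝ → ℝ} {W Ws Wx Wss Wxs Wxx : ℝ → ℝ → ℝ}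
    (h : IsWave S V W Ws Wx Wss Wxs Wxx) (x₀ σ : ℝ) (hσ : σ ^ 2 = 1) :
    IsWave {y | x₀ + σ * y ∈ S} (fun y => V (x₀ + σ * y)) (fun s y => W s (x₀ + σ * y))
      (fun s y => Ws s (x₀ + σ * y)) (fun s y => σ * Wx s (x₀ + σ * y))
      (fun s y => Wss s (x₀ + σ * y)) (fun s y => σ * Wxs s (x₀ + σ * y))
      (fun s y => Wxx s (x₀ + σ * y)) := by
  have hc : Continuous fun z : ℝ × ℝ => (z.1, x₀ + σ * z.2) := by fun_prop
  have hd : ∀ y, HasDerivAt (fun y : ℝ => x₀ + σ * y) σ y := fun y => by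
    simpa using ((hasDerivAt_id y).const_mul σ).const_add x₀
  refine ⟨h.cont.comp hc, h.cont_s.comp hc, continuous_const.mul (h.cont_x.comp hc),
    h.cont_ss.comp hc, continuous_const.mul (h.cont_xs.comp hc), h.cont_xx.comp hc,
    fun s x => h.deriv_s s _, fun s x => h.deriv_ss s _, fun s x => (h.deriv_x_s s _).const_mul σ,
    fun s x => ?_, fun s x => ?_, fun s x => ?_, fun s x hx => h.eqn s _ hx⟩
  · rw [mul_comm]; exact (h.deriv_x s _).comp x (hd x)
  · rw [mul_comm]; exact (h.deriv_s_x s _).comp x (hd x)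
  · have := ((h.deriv_xx s (x₀ + σ * x)).comp x (hd x)).const_mul σ
    refine this.congr_deriv ?_
    rw [mul_comm, mul_assoc, ← sq, hσ, mul_one]

section Sideways

variable {S : Set ℝ} {V : ℝ → ℝ} {W Ws Wx Wss Wxs Wxx : ℝ → ℝ → ℝ}

/-- Decay of the sideways energy over shrinking time intervals. -/
theorem IsWave.sideways_energy (h : IsWave S V W Ws Wx Wss Wxs Wxx) {L M : ℝ} (hL0 : 0 ≤ L)
    (hL : L ≤ 2) (hM : 1 ≤ M) (hS : Icc 0 L ⊆ S) (hV : ∀ y ∈ Icc 0 L, |V y| ≤ M ^ 2) :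
    (∫ s in (-3 : ℝ)..3, max ((3 - L) ^ 2 - s ^ 2) 0 ^ 2 *
        (Wx s L ^ 2 + Ws s L ^ 2 + M ^ 2 * W s L ^ 2)) ≤
      Real.exp (2 * M * L) * ∫ s in (-3 : ℝ)..3, max ((3 - 0) ^ 2 - s ^ 2) 0 ^ 2 *
        (Wx s 0 ^ 2 + Ws s 0 ^ 2 + M ^ 2 * W s 0 ^ 2) := by
  -- The interval `|s| < 3 - y` shrinks at the propagation speed `1`, and squaring the positive part
  -- makes the weight `C¹`. Below, `D` is the `y`-derivative of the weighted energy density and `B`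
  -- the `s`-derivative of the weighted flux `2 Wx Ws`.
  set z : ℝ → ℝ → ℝ := fun s y => (3 - y) ^ 2 - s ^ 2 with hz
  set E : ℝ → ℝ → ℝ := fun s y => Wx s y ^ 2 + Ws s y ^ 2 + M ^ 2 * W s y ^ 2 with hE
  set D : ℝ → ℝ → ℝ := fun s y => 2 * max (z s y) 0 * (-(2 * (3 - y))) * E s y +
    max (z s y) 0 ^ 2 * (2 * Wx s y * Wxx s y + 2 * Ws s y * Wxs s y
      + M ^ 2 * (2 * W s y * Wx s y)) with hD
  set B : ℝ → ℝ → ℝ := fun s y => 2 * max (z s y) 0 * (-(2 * s)) * (2 * Wx s y * Ws s y) +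
    max (z s y) 0 ^ 2 * (2 * Wxs s y * Ws s y + 2 * Wx s y * Wss s y) with hB
  obtain ⟨c, cs, cx, css, cxs, cxx, ds, dss, dxs, dx, dsx, dxx, eqn⟩ := h
  have cz : Continuous fun p : ℝ × ℝ => max (z p.1 p.2) 0 := by
    simp only [hz]; fun_prop
  have cE : Continuous fun p : ℝ × ℝ => E p.1 p.2 := by simp only [hE]; fun_prop
  have cD : Continuous fun p : ℝ × ℝ => D p.1 p.2 := by simp only [hD]; fun_prop
  have cB : Continuous fun p : ℝ × ℝ => B p.1 p.2 := by simp only [hB]; fun_prop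
  have sec : ∀ {f : ℝ → ℝ → ℝ}, (Continuous fun p : ℝ × ℝ => f p.1 p.2) → ∀ y,
      Continuous fun s => f s y := fun hf y =>
    hf.comp (by fun_prop : Continuous fun s : ℝ => (s, y))
  set G : ℝ → ℝ := fun y => ∫ s in (-3 : ℝ)..3, max (z s y) 0 ^ 2 * E s y with hG
  have hGd : ∀ y, HasDerivAt G (∫ s in (-3 : ℝ)..3, D s y) y := by
    refine hasDerivAt_intervalIntegral_of_continuous ((cz.pow 2).mul cE) cD fun s y => ?_
    have h1 : HasDerivAt (fun y => z s y) (-(2 * (3 - y))) y := by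
      have := (((hasDerivAt_id y).const_sub 3).pow 2).sub_const (s ^ 2)
      refine this.congr_deriv ?_
      simp
    have h2 := (hasDerivAt_max_sq (z s y)).comp y h1
    have h3 : HasDerivAt (fun y => E s y) (2 * Wx s y * Wxx s y + 2 * Ws s y * Wxs s y
      + M ^ 2 * (2 * W s y * Wx s y)) y := by
      have := (((dxx s y).pow 2).add ((dsx s y).pow 2)).add (((dx s y).pow 2).const_mul (M ^ 2))
      refine this.congr_deriv ?_
      simp
    exact h2.mul h3
  have hB0 : ∀ y ∈ Icc 0 L, ∫ s in (-3 : ℝ)..3, B s y = 0 := by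
    intro y hy
    have hd : ∀ s, HasDerivAt (fun s => max (z s y) 0 ^ 2 * (2 * Wx s y * Ws s y)) (B s y) s := by
      intro s
      have h1 : HasDerivAt (fun s => z s y) (-(2 * s)) s := by
        have := ((hasDerivAt_id s).pow 2).const_sub ((3 - y) ^ 2)
        refine this.congr_deriv ?_
        simp
      have h2 := (hasDerivAt_max_sq (z s y)).comp s h1
      have h3 : HasDerivAt (fun s => 2 * Wx s y * Ws s y)
          (2 * Wxs s y * Ws s y + 2 * Wx s y * Wss s y) s :=
        ((dxs s y).const_mul 2).mul (dss s y)
      exact h2.mul h3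
    rw [intervalIntegral.integral_eq_sub_of_hasDerivAt (fun s _ => hd s)
      ((sec cB y).intervalIntegrable _ _)]
    have h3 : max (z 3 y) 0 = 0 := max_eq_right (by simp only [hz]; nlinarith [hy.1, hy.2])
    have h4 : max (z (-3) y) 0 = 0 := max_eq_right (by simp only [hz]; nlinarith [hy.1, hy.2])
    simp [h3, h4]
  have hGle : ∀ y ∈ Icc 0 L, ∫ s in (-3 : ℝ)..3, D s y ≤ 2 * M * G y := by
    intro y hy
    have e1 : ∫ s in (-3 : ℝ)..3, D s y = ∫ s in (-3 : ℝ)..3, (D s y - B s y) := by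
      rw [intervalIntegral.integral_sub ((sec cD y).intervalIntegrable _ _)
        ((sec cB y).intervalIntegrable _ _), hB0 y hy, sub_zero]
    rw [e1, hG, ← intervalIntegral.integral_const_mul]
    refine intervalIntegral.integral_mono_on (by norm_num)
      (((sec cD y).sub (sec cB y)).intervalIntegrable _ _)
      (Continuous.intervalIntegrable
        (by have h1 := sec (f := fun s y => max (z s y) 0) cz y; have h2 := sec cE y; fun_prop) _ _) ?_
    intro s hs
    have hq : 0 ≤ max (z s y) 0 := le_max_right _ _
    have hv := abs_le.1 (hV y hy)
    -- Where the weight is nonzero, `|s| ≤ 3 - y`, so the loss from its `y`-derivative dominates the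
    -- flux term from its `s`-derivative.
    have k1 : max (z s y) 0 * (-(2 * (3 - y)) * E s y + 4 * s * (Wx s y * Ws s y)) ≤ 0 := by
      rcases le_or_gt (z s y) 0 with h0 | h0
      · rw [max_eq_right h0, zero_mul]
      · refine mul_nonpos_of_nonneg_of_nonpos hq ?_
        have hsy : |s| ≤ 3 - y := by
          refine abs_le_of_sq_le_sq ?_ (by linarith [hy.2])
          simp only [hz] at h0; linarith
        have h5 := abs_le.1 hsy
        have hy3 : 0 ≤ 3 - y := by linarith [hy.2]
        have h7 : 0 ≤ (3 - y) * (M ^ 2 * W s y ^ 2) := by positivity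
        have h8 : 0 ≤ (3 - y - s) * (Wx s y + Ws s y) ^ 2 := mul_nonneg (by linarith) (sq_nonneg _)
        have h9 : 0 ≤ (3 - y + s) * (Wx s y - Ws s y) ^ 2 := mul_nonneg (by linarith) (sq_nonneg _)
        simp only [hE]
        nlinarith
    -- The equation makes `Wss` cancel against the flux, leaving only this zeroth-order term.
    -- Including `M² W²` in the energy makes the growth rate linear in `M`, although `V` is of size
    -- `M²`.
    have k2 : 2 * (V y + M ^ 2) * (W s y * Wx s y) ≤ 2 * M * E s y := by
      have h6 : |V y + M ^ 2| ≤ 2 * M ^ 2 := abs_le.2 ⟨by nlinarith, by linarith⟩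
      have h7 : 2 * (V y + M ^ 2) * (W s y * Wx s y) ≤ 2 * (2 * M ^ 2) * |W s y * Wx s y| := by
        calc 2 * (V y + M ^ 2) * (W s y * Wx s y)
            ≤ |2 * (V y + M ^ 2) * (W s y * Wx s y)| := le_abs_self _
          _ = 2 * |V y + M ^ 2| * |W s y * Wx s y| := by
            rw [abs_mul, abs_mul, abs_of_pos (by norm_num : (0 : ℝ) < 2)]
          _ ≤ _ := by gcongr
      rw [abs_mul] at h7
      have h8 : 0 ≤ M * ((M * |W s y| - |Wx s y|) ^ 2) := by positivity
      have h9 := sq_abs (W s y)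
      have h10 := sq_abs (Wx s y)
      have h11 : 0 ≤ M * Ws s y ^ 2 := by positivity
      simp only [hE]
      calc _ ≤ _ := h7
        _ ≤ 2 * M * (|Wx s y| ^ 2 + Ws s y ^ 2 + M ^ 2 * |W s y| ^ 2) := by nlinarith
        _ = _ := by rw [h9, h10]
    have k3 := mul_le_mul_of_nonneg_left k2 (sq_nonneg (max (z s y) 0))
    simp only [hD, hB, eqn s y (hS hy)]
    nlinarith
  have hanti : AntitoneOn (fun y => Real.exp (-(2 * M) * y) * G y) (Icc 0 L) := by
    have hd : ∀ y, HasDerivAt (fun y => Real.exp (-(2 * M) * y) * G y)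
        (Real.exp (-(2 * M) * y) * (-(2 * M)) * G y
          + Real.exp (-(2 * M) * y) * ∫ s in (-3 : ℝ)..3, D s y) y := by
      intro y
      have h1 : HasDerivAt (fun y => -(2 * M) * y) (-(2 * M)) y := by
        simpa using (hasDerivAt_id y).const_mul (-(2 * M))
      exact h1.exp.mul (hGd y)
    refine antitoneOn_of_deriv_nonpos (convex_Icc _ _)
      (fun y _ => (hd y).continuousAt.continuousWithinAt)
      (fun y _ => (hd y).differentiableAt.differentiableWithinAt) fun y hy => ?_
    rw [interior_Icc] at hy
    rw [(hd y).deriv]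
    have := hGle y (Ioo_subset_Icc_self hy)
    have hp := Real.exp_pos (-(2 * M) * y)
    nlinarith
  have hfin := hanti (left_mem_Icc.2 hL0) (right_mem_Icc.2 hL0) hL0
  simp only [mul_zero, Real.exp_zero, one_mul] at hfin
  have hp := Real.exp_pos (2 * M * L)
  have hmul := mul_le_mul_of_nonneg_left hfin hp.le
  rw [← mul_assoc, ← Real.exp_add, show 2 * M * L + -(2 * M) * L = 0 by ring, Real.exp_zero,
    one_mul] at hmul
  exact hmul

/-- Since `L ≤ 2`, the final weight is at least `(1 - 1/4)² = 9/16` for `|s| ≤ 1/2`, while the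
initial weight is at most `9² = 81`; the quotient is `144`. -/
theorem IsWave.sideways_le_of_right (h : IsWave S V W Ws Wx Wss Wxs Wxx) {L M : ℝ} (hL0 : 0 ≤ L)
    (hL : L ≤ 2) (hM : 1 ≤ M) (hS : Icc 0 L ⊆ S) (hV : ∀ y ∈ Icc 0 L, |V y| ≤ M ^ 2) :
    (∫ s in (-(1 / 2) : ℝ)..(1 / 2), Ws s L ^ 2) ≤ 144 * Real.exp (4 * M) *
      ∫ s in (-3 : ℝ)..3, (Wx s 0 ^ 2 + Ws s 0 ^ 2 + M ^ 2 * W s 0 ^ 2) := by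
  have key := h.sideways_energy hL0 hL hM hS hV
  obtain ⟨c, cs, cx, css, cxs, cxx, ds, dss, dxs, dx, dsx, dxx, eqn⟩ := h
  have sec : ∀ {f : ℝ → ℝ → ℝ}, (Continuous fun p : ℝ × ℝ => f p.1 p.2) → ∀ y,
      Continuous fun s => f s y := fun hf y =>
    hf.comp (by fun_prop : Continuous fun s : ℝ => (s, y))
  have c1 := sec c; have c2 := sec cs; have c3 := sec cx
  have i1 : (9 / 16 : ℝ) * (∫ s in (-(1 / 2) : ℝ)..(1 / 2), Ws s L ^ 2) ≤
      ∫ s in (-3 : ℝ)..3, max ((3 - L) ^ 2 - s ^ 2) 0 ^ 2 *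
        (Wx s L ^ 2 + Ws s L ^ 2 + M ^ 2 * W s L ^ 2) := by
    rw [← intervalIntegral.integral_const_mul]
    calc _ ≤ ∫ s in (-(1 / 2) : ℝ)..(1 / 2), max ((3 - L) ^ 2 - s ^ 2) 0 ^ 2 *
        (Wx s L ^ 2 + Ws s L ^ 2 + M ^ 2 * W s L ^ 2) := by
          refine intervalIntegral.integral_mono_on (by norm_num)
            (Continuous.intervalIntegrable (by fun_prop) _ _)
            (Continuous.intervalIntegrable (by fun_prop) _ _) fun s hs => ?_
          have hz : (3 / 4 : ℝ) ≤ max ((3 - L) ^ 2 - s ^ 2) 0 := by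
            refine le_trans ?_ (le_max_left _ _)
            nlinarith [hs.1, hs.2]
          have hz2 : (9 / 16 : ℝ) ≤ max ((3 - L) ^ 2 - s ^ 2) 0 ^ 2 := by nlinarith
          refine mul_le_mul hz2 ?_ (sq_nonneg _) (sq_nonneg _)
          have : 0 ≤ M ^ 2 * W s L ^ 2 := by positivity
          nlinarith [sq_nonneg (Wx s L)]
      _ ≤ _ := by
          refine intervalIntegral.integral_mono_interval (by norm_num) (by norm_num) (by norm_num)
            (Filter.Eventually.of_forall fun s => by positivity)
            (Continuous.intervalIntegrable (by fun_prop) _ _)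
  have i2 : (∫ s in (-3 : ℝ)..3, max ((3 - 0) ^ 2 - s ^ 2) 0 ^ 2 *
        (Wx s 0 ^ 2 + Ws s 0 ^ 2 + M ^ 2 * W s 0 ^ 2)) ≤
      81 * ∫ s in (-3 : ℝ)..3, (Wx s 0 ^ 2 + Ws s 0 ^ 2 + M ^ 2 * W s 0 ^ 2) := by
    rw [← intervalIntegral.integral_const_mul]
    refine intervalIntegral.integral_mono_on (by norm_num)
      (Continuous.intervalIntegrable (by fun_prop) _ _)
      (Continuous.intervalIntegrable (by fun_prop) _ _) fun s hs => ?_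
    refine mul_le_mul_of_nonneg_right ?_ (by positivity)
    have h1 : max ((3 - 0 : ℝ) ^ 2 - s ^ 2) 0 ≤ 9 := max_le (by nlinarith) (by norm_num)
    have h2 : 0 ≤ max ((3 - 0 : ℝ) ^ 2 - s ^ 2) 0 := le_max_right _ _
    nlinarith
  have i3 : Real.exp (2 * M * L) ≤ Real.exp (4 * M) := Real.exp_le_exp.2 (by nlinarith)
  have i4 : 0 ≤ ∫ s in (-3 : ℝ)..3, (Wx s 0 ^ 2 + Ws s 0 ^ 2 + M ^ 2 * W s 0 ^ 2) :=
    intervalIntegral.integral_nonneg (by norm_num) fun s _ => by positivity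
  set I := ∫ s in (-3 : ℝ)..3, (Wx s 0 ^ 2 + Ws s 0 ^ 2 + M ^ 2 * W s 0 ^ 2)
  have i5 : Real.exp (2 * M * L) * (∫ s in (-3 : ℝ)..3, max ((3 - 0) ^ 2 - s ^ 2) 0 ^ 2 *
        (Wx s 0 ^ 2 + Ws s 0 ^ 2 + M ^ 2 * W s 0 ^ 2)) ≤ Real.exp (4 * M) * (81 * I) :=
    (mul_le_mul_of_nonneg_left i2 (Real.exp_pos _).le).trans
      (mul_le_mul_of_nonneg_right i3 (by positivity))
  linarith

/-- The energy of a wave at `x` is controlled by the sideways energy at `x₀`. -/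
theorem IsWave.sideways_le (h : IsWave (Icc (-1) 1) V W Ws Wx Wss Wxs Wxx) {M : ℝ} (hM : 1 ≤ M)
    (hV : ∀ y ∈ Icc (-1 : ℝ) 1, |V y| ≤ M ^ 2) {x x₀ : ℝ} (hx : x ∈ Icc (-1 : ℝ) 1)
    (hx₀ : x₀ ∈ Icc (-1 : ℝ) 1) :
    (∫ s in (-(1 / 2) : ℝ)..(1 / 2), Ws s x ^ 2) ≤ 144 * Real.exp (4 * M) *
      ∫ s in (-3 : ℝ)..3, (Wx s x₀ ^ 2 + Ws s x₀ ^ 2 + M ^ 2 * W s x₀ ^ 2) := by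
  rcases le_total x₀ x with hle | hle
  · have h1 := h.comp_add_mul x₀ 1 (by norm_num)
    have hmem : ∀ y ∈ Icc 0 (x - x₀), x₀ + 1 * y ∈ Icc (-1 : ℝ) 1 := fun y hy =>
      ⟨by linarith [hx₀.1, hy.1], by linarith [hx.2, hy.2]⟩
    have h2 := h1.sideways_le_of_right (L := x - x₀) (by linarith)
      (by linarith [hx.2, hx₀.1]) hM (fun y hy => hmem y hy) (fun y hy => hV _ (hmem y hy))
    simpa using h2
  · have h1 := h.comp_add_mul x₀ (-1) (by norm_num)
    have hmem : ∀ y ∈ Icc 0 (x₀ - x), x₀ + (-1) * y ∈ Icc (-1 : ℝ) 1 := fun y hy =>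
      ⟨by linarith [hx.1, hy.2], by linarith [hx₀.2, hy.1]⟩
    have h2 := h1.sideways_le_of_right (L := x₀ - x) (by linarith)
      (by linarith [hx₀.2, hx.1]) hM (fun y hy => hmem y hy) (fun y hy => hV _ (hmem y hy))
    simpa using h2

end Sideways

/-! ### Caccioppoli's inequality and observability of waves -/

section Caccioppoli

variable {V : ℝ → ℝ} {W Ws Wx Wss Wxs Wxx : ℝ → ℝ → ℝ}

theorem sq_intervalIntegral_le {f : ℝ → ℝ} (hf : Continuous f) {a b : ℝ} (hab : a ≤ b) :
    (∫ s in a..b, f s) ^ 2 ≤ (b - a) * ∫ s in a..b, f s ^ 2 := by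
  rcases hab.eq_or_lt with rfl | hlt
  · simp
  set m := (∫ s in a..b, f s) / (b - a) with hm
  have hb : 0 < b - a := sub_pos.2 hlt
  have h0 : 0 ≤ ∫ s in a..b, (f s - m) ^ 2 :=
    intervalIntegral.integral_nonneg hab fun s _ => sq_nonneg _
  have h1 : ∫ s in a..b, (f s - m) ^ 2 =
      (∫ s in a..b, f s ^ 2) - 2 * m * (∫ s in a..b, f s) + (b - a) * m ^ 2 := by
    have : ∀ s, (f s - m) ^ 2 = f s ^ 2 - 2 * m * f s + m ^ 2 := fun s => by ring
    simp only [this]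
    rw [intervalIntegral.integral_add, intervalIntegral.integral_sub,
      intervalIntegral.integral_const_mul, intervalIntegral.integral_const, smul_eq_mul]
    all_goals exact Continuous.intervalIntegrable (by fun_prop) _ _
  have h2 : (∫ s in a..b, f s) = m * (b - a) := by rw [hm]; field_simp
  rw [h1, h2] at h0
  rw [h2]
  nlinarith

/-- A Poincaré inequality in `s`: as `W` vanishes at `s = 0`, Cauchy–Schwarz gives `W² ≤ 4 ∫ Ws²`
pointwise, and the interval has length `8`. The constant `64` is not sharp. -/
theorem IsWave.integral_sq_le {S : Set ℝ} (h : IsWave S V W Ws Wx Wss Wxs Wxx)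
    (h0 : ∀ x, W 0 x = 0) (x : ℝ) :
    ∫ s in (-4 : ℝ)..4, W s x ^ 2 ≤ 64 * ∫ s in (-4 : ℝ)..4, Ws s x ^ 2 := by
  have c2 : Continuous fun s => Ws s x :=
    h.cont_s.comp (by fun_prop : Continuous fun s : ℝ => (s, x))
  have c1 : Continuous fun s => W s x :=
    h.cont.comp (by fun_prop : Continuous fun s : ℝ => (s, x))
  set I := ∫ s in (-4 : ℝ)..4, Ws s x ^ 2
  have hftc : ∀ s, ∫ r in (0 : ℝ)..s, Ws r x = W s x := fun s => by
    rw [intervalIntegral.integral_eq_sub_of_hasDerivAt (fun r _ => h.deriv_s r x)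
      (c2.intervalIntegrable _ _), h0, sub_zero]
  have hmono : ∀ c d : ℝ, -4 ≤ c → c ≤ d → d ≤ 4 → ∫ r in c..d, Ws r x ^ 2 ≤ I :=
    fun c d h1 h2 h3 => intervalIntegral.integral_mono_interval h1 h2 h3
      (Filter.Eventually.of_forall fun s => by positivity)
      (Continuous.intervalIntegrable (by fun_prop) _ _)
  have hI : 0 ≤ I := intervalIntegral.integral_nonneg (by norm_num) fun s _ => sq_nonneg _
  have hpt : ∀ s ∈ Icc (-4 : ℝ) 4, W s x ^ 2 ≤ 4 * I := by
    intro s hs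
    rw [← hftc s]
    rcases le_total 0 s with hs0 | hs0
    · refine (sq_intervalIntegral_le c2 hs0).trans ?_
      have := hmono 0 s (by norm_num) hs0 hs.2
      have h5 : 0 ≤ ∫ r in (0 : ℝ)..s, Ws r x ^ 2 :=
        intervalIntegral.integral_nonneg hs0 fun s _ => sq_nonneg _
      nlinarith [hs.2]
    · rw [intervalIntegral.integral_symm, neg_sq]
      refine (sq_intervalIntegral_le c2 hs0).trans ?_
      have := hmono s 0 hs.1 hs0 (by norm_num)
      have h5 : 0 ≤ ∫ r in s..(0 : ℝ), Ws r x ^ 2 :=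
        intervalIntegral.integral_nonneg hs0 fun s _ => sq_nonneg _
      nlinarith [hs.1]
  calc ∫ s in (-4 : ℝ)..4, W s x ^ 2 ≤ ∫ s in (-4 : ℝ)..4, 4 * I :=
        intervalIntegral.integral_mono_on (by norm_num)
          (Continuous.intervalIntegrable (by fun_prop) _ _) intervalIntegrable_const hpt
    _ ≤ 64 * I := by rw [intervalIntegral.integral_const, smul_eq_mul]; linarith

/-- Here `t` stands for the cutoff in `x` and `r` for its derivative. The two differences on the
right are exact derivatives, of `t² w wx` in `x` and of `(16 - s²) w ws` in `s`, so they will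
integrate to zero. Completing the square in `t wx + 2 r w` and dropping the nonnegative potential
term leaves `256 w² + 32 ws²`; the cross term from differentiating `16 - s²` adds `8 (w² + ws²)`. -/
theorem caccioppoli_pointwise {t r s v w wx ws wss : ℝ} (t0 : 0 ≤ t) (t1 : t ≤ 1)
    (t2 : r ^ 2 ≤ 4) (hs : |s| ≤ 4) (hv : 0 ≤ v) :
    t ^ 2 * (16 - s ^ 2) * wx ^ 2 ≤
      2 * ((16 - s ^ 2) * (2 * t * r * (w * wx) + t ^ 2 * (wx ^ 2 + w * (v * w + wss))))
        - 2 * (t ^ 2 * (-(2 * s) * (w * ws) + (16 - s ^ 2) * (ws ^ 2 + w * wss)))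
        + (264 * w ^ 2 + 40 * ws ^ 2) := by
  have hs2 : s ^ 2 ≤ 16 := by
    have := sq_abs s
    nlinarith [abs_nonneg s]
  obtain ⟨e, he⟩ : ∃ e, e = 16 - s ^ 2 := ⟨_, rfl⟩
  rw [← he]
  have s0 : 0 ≤ e := by linarith
  have s1 : e ≤ 16 := by linarith [sq_nonneg s]
  have q1 : 0 ≤ e * (t * wx + 2 * r * w) ^ 2 := by positivity
  have q2 : e * (r ^ 2 * w ^ 2) ≤ 16 * (4 * w ^ 2) := by gcongr
  have t3 : t ^ 2 ≤ 1 := by nlinarith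
  have q3 : 0 ≤ t ^ 2 * e * (v * w ^ 2) := by positivity
  have q4 : t ^ 2 * e * ws ^ 2 ≤ 1 * 16 * ws ^ 2 := by gcongr
  have q5 : -(t ^ 2 * (s * (w * ws))) ≤ 2 * (w ^ 2 + ws ^ 2) := by
    have h1 : -(t ^ 2 * (s * (w * ws))) ≤ 1 * (4 * |w * ws|) := by
      calc _ ≤ |-(t ^ 2 * (s * (w * ws)))| := le_abs_self _
        _ = t ^ 2 * (|s| * |w * ws|) := by
          rw [abs_neg, abs_mul, abs_mul, abs_of_nonneg (sq_nonneg t)]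
        _ ≤ _ := by gcongr
    rw [abs_mul] at h1
    nlinarith [sq_nonneg (|w| - |ws|), sq_abs w, sq_abs ws]
  have key : 2 * (e * (2 * t * r * (w * wx) + t ^ 2 * (wx ^ 2 + w * (v * w + wss))))
        - 2 * (t ^ 2 * (-(2 * s) * (w * ws) + e * (ws ^ 2 + w * wss))) - t ^ 2 * e * wx ^ 2 =
      e * (t * wx + 2 * r * w) ^ 2 - 4 * (e * (r ^ 2 * w ^ 2)) + 2 * (t ^ 2 * e * (v * w ^ 2))
        + 4 * (t ^ 2 * (s * (w * ws))) - 2 * (t ^ 2 * e * ws ^ 2) := by ring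
  linarith

/-- Caccioppoli's inequality on `(a,b)` with the cutoffs `((x-a)(b-x))²` and `16-s²`. -/
theorem IsWave.caccioppoli (h : IsWave (Icc (-1) 1) V W Ws Wx Wss Wxs Wxx)
    (hV : ∀ y ∈ Icc (-1 : ℝ) 1, 0 ≤ V y) (h0 : ∀ x, W 0 x = 0) {a b : ℝ} (ha : -1 ≤ a)
    (hab : a ≤ b) (hb : b ≤ 1) :
    ∫ x in a..b, ∫ s in (-4 : ℝ)..4, ((x - a) * (b - x)) ^ 2 * (16 - s ^ 2) * Wx s x ^ 2 ≤
      20000 * ∫ x in a..b, ∫ s in (-4 : ℝ)..4, Ws s x ^ 2 := by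
  have hW2 := h.integral_sq_le h0
  obtain ⟨c, cs, cx, css, cxs, cxx, ds, dss, dxs, dx, dsx, dxx, eqn⟩ := h
  have sec1 : ∀ {f : ℝ → ℝ → ℝ}, (Continuous fun p : ℝ × ℝ => f p.1 p.2) → ∀ y,
      Continuous fun s => f s y := fun hf y =>
    hf.comp (by fun_prop : Continuous fun s : ℝ => (s, y))
  have sec2 : ∀ {f : ℝ → ℝ → ℝ}, (Continuous fun p : ℝ × ℝ => f p.1 p.2) → ∀ s,
      Continuous fun y => f s y := fun hf s =>
    hf.comp (by fun_prop : Continuous fun y : ℝ => (s, y))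
  have swp : ∀ {f : ℝ → ℝ → ℝ}, (Continuous fun p : ℝ × ℝ => f p.1 p.2) →
      Continuous fun p : ℝ × ℝ => f p.2 p.1 := fun hf =>
    hf.comp (by fun_prop : Continuous fun p : ℝ × ℝ => (p.2, p.1))
  set θ : ℝ → ℝ := fun x => (x - a) * (b - x) with hθ
  have cθ : Continuous θ := by simp only [hθ]; fun_prop
  have dθ : ∀ x, HasDerivAt θ (a + b - 2 * x) x := fun x => by
    have := ((hasDerivAt_id x).sub_const a).mul ((hasDerivAt_id x).const_sub b)
    refine this.congr_deriv ?_
    simp; ring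
  -- integration by parts in `x`
  set A : ℝ → ℝ → ℝ := fun s x => 2 * θ x * (a + b - 2 * x) * (W s x * Wx s x) +
    θ x ^ 2 * (Wx s x ^ 2 + W s x * Wxx s x) with hA
  have cA : Continuous fun p : ℝ × ℝ => A p.1 p.2 := by simp only [hA]; fun_prop
  have iA : ∀ s, ∫ x in a..b, A s x = 0 := by
    intro s
    have hd : ∀ x, HasDerivAt (fun x => θ x ^ 2 * (W s x * Wx s x)) (A s x) x := by
      intro x
      have := ((dθ x).pow 2).mul ((dx s x).mul (dxx s x))
      refine this.congr_deriv ?_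
      simp only [hA, Pi.mul_apply, Pi.pow_apply]
      push_cast
      ring
    rw [intervalIntegral.integral_eq_sub_of_hasDerivAt (fun x _ => hd x)
      ((sec2 cA s).intervalIntegrable _ _)]
    simp [hθ]
  -- integration by parts in `s`
  set B : ℝ → ℝ → ℝ := fun s x => -(2 * s) * (W s x * Ws s x) +
    (16 - s ^ 2) * (Ws s x ^ 2 + W s x * Wss s x) with hB
  have cB : Continuous fun p : ℝ × ℝ => B p.1 p.2 := by simp only [hB]; fun_prop
  have iB : ∀ x, ∫ s in (-4 : ℝ)..4, B s x = 0 := by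
    intro x
    have hd : ∀ s, HasDerivAt (fun s => (16 - s ^ 2) * (W s x * Ws s x)) (B s x) s := by
      intro s
      have := (((hasDerivAt_id s).pow 2).const_sub 16).mul ((ds s x).mul (dss s x))
      refine this.congr_deriv ?_
      simp only [hB, Pi.mul_apply, Pi.pow_apply, id]
      push_cast
      ring
    rw [intervalIntegral.integral_eq_sub_of_hasDerivAt (fun x _ => hd x)
      ((sec1 cB x).intervalIntegrable _ _)]
    norm_num
  have JA : ∫ x in a..b, ∫ s in (-4 : ℝ)..4, (16 - s ^ 2) * A s x = 0 := by
    have cc : Continuous fun p : ℝ × ℝ => (16 - p.1 ^ 2) * A p.1 p.2 := by fun_prop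
    rw [intervalIntegral_swap_of_continuous (F := fun x s => (16 - s ^ 2) * A s x)
      (swp (f := fun s x => (16 - s ^ 2) * A s x) cc)]
    simp [intervalIntegral.integral_const_mul, iA]
  have JB : ∫ x in a..b, ∫ s in (-4 : ℝ)..4, θ x ^ 2 * B s x = 0 := by
    simp [intervalIntegral.integral_const_mul, iB]
  -- pointwise comparison
  have hcont : ∀ {f : ℝ → ℝ → ℝ}, (Continuous fun p : ℝ × ℝ => f p.1 p.2) →
      Continuous fun x => ∫ s in (-4 : ℝ)..4, f s x := fun hf =>
    intervalIntegral.continuous_parametric_intervalIntegral_of_continuous' (swp hf) _ _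
  have hpt : ∀ x ∈ Icc a b, ∀ s ∈ Icc (-4 : ℝ) 4,
      θ x ^ 2 * (16 - s ^ 2) * Wx s x ^ 2 ≤ 2 * ((16 - s ^ 2) * A s x) - 2 * (θ x ^ 2 * B s x)
        + (264 * W s x ^ 2 + 40 * Ws s x ^ 2) := by
    intro x hx s hs
    have hx1 : x ∈ Icc (-1 : ℝ) 1 := ⟨ha.trans hx.1, hx.2.trans hb⟩
    have e1 := eqn s x hx1
    have hv := hV x hx1
    have t0 : 0 ≤ θ x := mul_nonneg (sub_nonneg.2 hx.1) (sub_nonneg.2 hx.2)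
    have t1 : θ x ≤ 1 := by
      simp only [hθ]; nlinarith [sq_nonneg (2 * x - a - b), hx.1, hx.2]
    have t2 : (a + b - 2 * x) ^ 2 ≤ 4 := by nlinarith [hx.1, hx.2]
    simp only [hA, hB, e1]
    exact caccioppoli_pointwise t0 t1 t2 (abs_le.2 hs) hv
  have hpt2 : ∀ x ∈ Icc a b,
      ∫ s in (-4 : ℝ)..4, θ x ^ 2 * (16 - s ^ 2) * Wx s x ^ 2 ≤
        2 * (∫ s in (-4 : ℝ)..4, (16 - s ^ 2) * A s x) - 2 * (∫ s in (-4 : ℝ)..4, θ x ^ 2 * B s x)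
        + 20000 * ∫ s in (-4 : ℝ)..4, Ws s x ^ 2 := by
    intro x hx
    have c1 := sec1 c x
    have c2 := sec1 cs x
    have c3 := sec1 cx x
    have c4 := sec1 cA x
    have c5 := sec1 cB x
    have i1 := intervalIntegral.integral_mono_on (μ := volume) (by norm_num : (-4 : ℝ) ≤ 4)
      (Continuous.intervalIntegrable (by fun_prop) _ _)
      (Continuous.intervalIntegrable (by fun_prop) _ _) (hpt x hx)
    refine i1.trans ?_
    rw [intervalIntegral.integral_add, intervalIntegral.integral_sub, intervalIntegral.integral_add]
    · simp only [intervalIntegral.integral_const_mul]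
      -- The Poincaré inequality in `s` gives `264 · 64 + 40 ≤ 20000`.
      have := hW2 x
      have h5 : 0 ≤ ∫ s in (-4 : ℝ)..4, Ws s x ^ 2 :=
        intervalIntegral.integral_nonneg (by norm_num) fun s _ => sq_nonneg _
      linarith
    all_goals exact Continuous.intervalIntegrable (by fun_prop) _ _
  have k1 := hcont (f := fun s x => θ x ^ 2 * (16 - s ^ 2) * Wx s x ^ 2) (by fun_prop)
  have k2 := hcont (f := fun s x => (16 - s ^ 2) * A s x) (by fun_prop)
  have k3 := hcont (f := fun s x => θ x ^ 2 * B s x) (by fun_prop)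
  have k4 := hcont (f := fun s x => Ws s x ^ 2) (by fun_prop)
  refine (intervalIntegral.integral_mono_on hab (k1.intervalIntegrable _ _)
    (Continuous.intervalIntegrable (by fun_prop) _ _) hpt2).trans ?_
  rw [intervalIntegral.integral_add, intervalIntegral.integral_sub]
  · simp only [intervalIntegral.integral_const_mul] at JA JB ⊢
    rw [JA, JB]; simp
  all_goals exact Continuous.intervalIntegrable (by fun_prop) _ _

/-- Observability of waves from `(a,b)`. -/
theorem IsWave.observability {a b : ℝ} (ha : -1 ≤ a) (hab : a < b) (hb : b ≤ 1) :
    ∃ C : ℝ, 0 < C ∧ ∀ {V : ℝ → ℝ} {W Ws Wx Wss Wxs Wxx : ℝ → ℝ → ℝ} {M : ℝ},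
      IsWave (Icc (-1) 1) V W Ws Wx Wss Wxs Wxx → (∀ y ∈ Icc (-1 : ℝ) 1, 0 ≤ V y) →
      (∀ y ∈ Icc (-1 : ℝ) 1, V y ≤ M ^ 2) → 1 ≤ M → (∀ x, W 0 x = 0) →
      ∫ x in (-1 : ℝ)..1, ∫ s in (-(1 / 2) : ℝ)..(1 / 2), Ws s x ^ 2 ≤
        C * Real.exp (6 * M) * ∫ x in a..b, ∫ s in (-4 : ℝ)..4, Ws s x ^ 2 := by
  -- Caccioppoli controls `Wx` only after integration over `(a,b)` against this weight. The sideways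
  -- estimate is therefore averaged over its base point with the same weight, whose mass is `κ`.
  set κ := ∫ x in a..b, ((x - a) * (b - x)) ^ 2 with hκ
  have hκ0 : 0 < κ := by
    refine intervalIntegral.intervalIntegral_pos_of_pos_on
      (Continuous.intervalIntegrable (by fun_prop) _ _) (fun x hx => ?_) hab
    have := sub_pos.2 hx.1
    have := sub_pos.2 hx.2
    positivity
  refine ⟨2 * (144 * 3100) / κ, by positivity, ?_⟩
  intro V W Ws Wx Wss Wxs Wxx M h hV hVM hM h0
  have hcac := h.caccioppoli hV h0 ha hab.le hb
  have hW2 := h.integral_sq_le h0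
  have hside : ∀ x ∈ Icc (-1 : ℝ) 1, ∀ x₀ ∈ Icc (-1 : ℝ) 1, _ := fun x hx x₀ hx₀ =>
    h.sideways_le hM (fun y hy => by rw [abs_of_nonneg (hV y hy)]; exact hVM y hy) hx hx₀
  obtain ⟨c, cs, cx, -, -, -, -, -, -, -, -, -, -⟩ := h
  have swp : ∀ {f : ℝ → ℝ → ℝ}, (Continuous fun p : ℝ × ℝ => f p.1 p.2) →
      Continuous fun p : ℝ × ℝ => f p.2 p.1 := fun hf =>
    hf.comp (by fun_prop : Continuous fun p : ℝ × ℝ => (p.2, p.1))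
  have sec1 : ∀ {f : ℝ → ℝ → ℝ}, (Continuous fun p : ℝ × ℝ => f p.1 p.2) → ∀ y,
      Continuous fun s => f s y := fun hf y =>
    hf.comp (by fun_prop : Continuous fun s : ℝ => (s, y))
  have hcont : ∀ {f : ℝ → ℝ → ℝ} (u v : ℝ), (Continuous fun p : ℝ × ℝ => f p.1 p.2) →
      Continuous fun x => ∫ s in u..v, f s x := fun u v hf =>
    intervalIntegral.continuous_parametric_intervalIntegral_of_continuous' (swp hf) _ _
  set I := ∫ x in a..b, ∫ s in (-4 : ℝ)..4, Ws s x ^ 2 with hI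
  have hI0 : 0 ≤ I := intervalIntegral.integral_nonneg hab.le fun x _ =>
    intervalIntegral.integral_nonneg (by norm_num) fun s _ => sq_nonneg _
  have kWs := hcont (f := fun s x => Ws s x ^ 2) (-4) 4 (by fun_prop)
  have kWx := hcont (f := fun s x => ((x - a) * (b - x)) ^ 2 * (16 - s ^ 2) * Wx s x ^ 2)
    (-4) 4 (by fun_prop)
  -- the weighted sideways energy
  have hloc : ∀ x₀ ∈ Icc a b, ((x₀ - a) * (b - x₀)) ^ 2 *
      (∫ s in (-3 : ℝ)..3, (Wx s x₀ ^ 2 + Ws s x₀ ^ 2 + M ^ 2 * W s x₀ ^ 2)) ≤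
      (1 / 7) * (∫ s in (-4 : ℝ)..4, ((x₀ - a) * (b - x₀)) ^ 2 * (16 - s ^ 2) * Wx s x₀ ^ 2) +
        (1 + 64 * M ^ 2) * ∫ s in (-4 : ℝ)..4, Ws s x₀ ^ 2 := by
    intro x hx
    have c1 := sec1 c x
    have c2 := sec1 cs x
    have c3 := sec1 cx x
    have t0 : 0 ≤ (x - a) * (b - x) := mul_nonneg (sub_nonneg.2 hx.1) (sub_nonneg.2 hx.2)
    have t1 : (x - a) * (b - x) ≤ 1 := by
      nlinarith [sq_nonneg (2 * x - a - b), hx.1, hx.2]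
    set t := (x - a) * (b - x)
    have t3 : t ^ 2 ≤ 1 := by nlinarith
    rw [← intervalIntegral.integral_const_mul]
    have s1 : ∫ s in (-3 : ℝ)..3, t ^ 2 * (Wx s x ^ 2 + Ws s x ^ 2 + M ^ 2 * W s x ^ 2) ≤
        ∫ s in (-3 : ℝ)..3, (1 / 7 * (t ^ 2 * (16 - s ^ 2) * Wx s x ^ 2) + Ws s x ^ 2
          + M ^ 2 * W s x ^ 2) := by
      refine intervalIntegral.integral_mono_on (by norm_num)
        (Continuous.intervalIntegrable (by fun_prop) _ _)
        (Continuous.intervalIntegrable (by fun_prop) _ _) fun s hs => ?_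
      have s0 : 7 ≤ 16 - s ^ 2 := by nlinarith [hs.1, hs.2]
      have : 7 * (t ^ 2 * Wx s x ^ 2) ≤ (16 - s ^ 2) * (t ^ 2 * Wx s x ^ 2) := by gcongr
      have : t ^ 2 * (Ws s x ^ 2 + M ^ 2 * W s x ^ 2) ≤ 1 * (Ws s x ^ 2 + M ^ 2 * W s x ^ 2) := by
        gcongr
      nlinarith
    have s2 : ∫ s in (-3 : ℝ)..3, (1 / 7 * (t ^ 2 * (16 - s ^ 2) * Wx s x ^ 2) + Ws s x ^ 2
          + M ^ 2 * W s x ^ 2) ≤ ∫ s in (-4 : ℝ)..4, (1 / 7 * (t ^ 2 * (16 - s ^ 2) * Wx s x ^ 2)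
          + Ws s x ^ 2 + M ^ 2 * W s x ^ 2) := by
      refine intervalIntegral.integral_mono_interval (by norm_num) (by norm_num) (by norm_num)
        ?_ (Continuous.intervalIntegrable (by fun_prop) _ _)
      refine (ae_restrict_mem measurableSet_Ioc).mono fun s hs => ?_
      have s0 : 0 ≤ 16 - s ^ 2 := by nlinarith [hs.1, hs.2]
      simp only [Pi.zero_apply]
      positivity
    refine s1.trans (s2.trans ?_)
    rw [intervalIntegral.integral_add, intervalIntegral.integral_add,
      intervalIntegral.integral_const_mul, intervalIntegral.integral_const_mul]
    · have := mul_le_mul_of_nonneg_left (hW2 x) (sq_nonneg M)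
      linarith
    all_goals exact Continuous.intervalIntegrable (by fun_prop) _ _
  -- On `|s| ≤ 3` one has `16 - s² ≥ 7`, so Caccioppoli contributes `20000 / 7`; together with the
  -- `1` from `Ws²` this is below `3000`.
  have hx : ∀ x ∈ Icc (-1 : ℝ) 1,
      κ * (∫ s in (-(1 / 2) : ℝ)..(1 / 2), Ws s x ^ 2) ≤
        144 * Real.exp (4 * M) * ((3000 + 64 * M ^ 2) * I) := by
    intro x hx
    rw [hκ, ← intervalIntegral.integral_mul_const]
    have e1 : ∫ x₀ in a..b, ((x₀ - a) * (b - x₀)) ^ 2 *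
          (∫ s in (-(1 / 2) : ℝ)..(1 / 2), Ws s x ^ 2) ≤
        ∫ x₀ in a..b, 144 * Real.exp (4 * M) *
      ((1 / 7) * (∫ s in (-4 : ℝ)..4, ((x₀ - a) * (b - x₀)) ^ 2 * (16 - s ^ 2) * Wx s x₀ ^ 2) +
        (1 + 64 * M ^ 2) * ∫ s in (-4 : ℝ)..4, Ws s x₀ ^ 2) := by
      refine intervalIntegral.integral_mono_on hab.le
        (Continuous.intervalIntegrable (by fun_prop) _ _)
        (Continuous.intervalIntegrable (by fun_prop) _ _) fun x₀ hx₀ => ?_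
      have h1 := hside x hx x₀ ⟨ha.trans hx₀.1, hx₀.2.trans hb⟩
      have h2 := mul_le_mul_of_nonneg_left h1 (sq_nonneg ((x₀ - a) * (b - x₀)))
      refine h2.trans ?_
      rw [mul_left_comm]
      exact mul_le_mul_of_nonneg_left (hloc x₀ hx₀) (by positivity)
    refine e1.trans ?_
    rw [intervalIntegral.integral_const_mul, intervalIntegral.integral_add,
      intervalIntegral.integral_const_mul, intervalIntegral.integral_const_mul]
    · refine mul_le_mul_of_nonneg_left ?_ (by positivity)
      rw [← hI]
      nlinarith
    all_goals exact Continuous.intervalIntegrable (by fun_prop) _ _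
  have kx := hcont (f := fun s x => Ws s x ^ 2) (-(1 / 2)) (1 / 2) (by fun_prop)
  have hint : ∫ x in (-1 : ℝ)..1, κ * (∫ s in (-(1 / 2) : ℝ)..(1 / 2), Ws s x ^ 2) ≤
      ∫ _x in (-1 : ℝ)..1, 144 * Real.exp (4 * M) * ((3000 + 64 * M ^ 2) * I) :=
    intervalIntegral.integral_mono_on (by norm_num : (-1 : ℝ) ≤ 1)
    (Continuous.intervalIntegrable (continuous_const.mul kx) _ _)
    (_root_.intervalIntegrable_const (μ := volume)) hx
  rw [intervalIntegral.integral_const_mul, intervalIntegral.integral_const, smul_eq_mul] at hint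
  have hexp : 3000 + 64 * M ^ 2 ≤ 3100 * Real.exp (2 * M) := by
    have := Real.quadratic_le_exp_of_nonneg (x := 2 * M) (by linarith)
    nlinarith
  have h6 : Real.exp (6 * M) = Real.exp (4 * M) * Real.exp (2 * M) := by
    rw [← Real.exp_add]; ring_nf
  rw [div_mul_eq_mul_div, div_mul_eq_mul_div, le_div_iff₀ hκ0, mul_comm, h6]
  have h7 : Real.exp (4 * M) * ((3000 + 64 * M ^ 2) * I) ≤
      Real.exp (4 * M) * ((3100 * Real.exp (2 * M)) * I) := by gcongr
  linarith

end Caccioppoli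

/-! ### A kernel transmuting heat into waves -/

/-- `exp (-288/z - 288/(τ-z))`, which is flat at both ends of `(0,τ)`. -/
noncomputable def flat (τ : ℝ) (z : ℂ) : ℂ := Complex.exp (-288 / z - 288 / (τ - z))

theorem flat_analyticAt {τ : ℝ} {z : ℂ} (h0 : z ≠ 0) (h1 : z ≠ τ) : AnalyticAt ℂ (flat τ) z := by
  have h2 : (τ : ℂ) - z ≠ 0 := sub_ne_zero.2 h1.symm
  unfold flat
  fun_prop (disch := assumption)

theorem hasDerivAt_iteratedDeriv_flat {τ : ℝ} {z : ℂ} (h0 : z ≠ 0) (h1 : z ≠ τ) (j : ℕ) :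
    HasDerivAt (iteratedDeriv j (flat τ)) (iteratedDeriv (j + 1) (flat τ) z) z := by
  have h := (flat_analyticAt h0 h1).iterated_deriv j
  rw [iteratedDeriv_succ, iteratedDeriv_eq_iterate]
  exact h.differentiableAt.hasDerivAt

/-- When `t = r`, the disc gives `Re z ≥ r/2` and `‖z‖ ≤ 3r/2`, hence `Re (1/z) = Re z / ‖z‖² ≥ 2 /
(9 r)`. -/
theorem re_inv_lower_bound {z : ℂ} {t r : ℝ} (hr : 0 < r) (hrt : r ≤ t) (hz : ‖z - t‖ ≤ r / 2) :
    0 ≤ (1 / z).re ∧ (t = r → 2 / (9 * r) ≤ (1 / z).re) := by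
  have h1 : |z.re - t| ≤ r / 2 := by simpa using (Complex.abs_re_le_norm (z - t)).trans hz
  have h1' := abs_le.1 h1
  have h2 : ‖z‖ ≤ t + r / 2 := by
    calc ‖z‖ = ‖(t : ℂ) + (z - t)‖ := by ring_nf
      _ ≤ ‖(t : ℂ)‖ + ‖z - t‖ := norm_add_le _ _
      _ ≤ t + r / 2 := by
        rw [Complex.norm_real, Real.norm_of_nonneg (by linarith)]; linarith
  have h3 : 0 < z.re := by linarith
  have hz0 : z ≠ 0 := fun h => by simp [h] at h3
  have h4 : (1 / z).re = z.re / ‖z‖ ^ 2 := by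
    rw [one_div, Complex.inv_re, Complex.normSq_eq_norm_sq]
  rw [h4]
  refine ⟨by positivity, fun htr => ?_⟩
  have hp : 0 < ‖z‖ := norm_pos_iff.2 hz0
  rw [div_le_div_iff₀ (by positivity) (by positivity)]
  subst htr
  nlinarith

/-- The nearer endpoint of `(0,τ)` gives the decay, with `64 = 288 · 2/9`; the other endpoint
contributes a factor of modulus at most `1`. -/
theorem norm_flat_le {τ t r : ℝ} (hr : 0 < r) (ht : r ≤ t) (ht' : r ≤ τ - t)
    (h : t = r ∨ τ - t = r) {z : ℂ} (hz : ‖z - t‖ ≤ r / 2) :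
    ‖flat τ z‖ ≤ Real.exp (-64 / r) := by
  have h1 := re_inv_lower_bound hr ht hz
  have hz' : ‖((τ : ℂ) - z) - ((τ - t : ℝ) : ℂ)‖ ≤ r / 2 := by
    have : ((τ : ℂ) - z) - ((τ - t : ℝ) : ℂ) = -(z - t) := by push_cast; ring
    rwa [this, norm_neg]
  have h2 := re_inv_lower_bound hr ht' hz'
  rw [flat, Complex.norm_exp, Real.exp_le_exp]
  have e1 : (-288 / z - 288 / ((τ : ℂ) - z)).re =
      -288 * (1 / z).re - 288 * (1 / ((τ : ℂ) - z)).re := by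
    have : (-288 / z - 288 / ((τ : ℂ) - z)) =
      ((-288 : ℝ) : ℂ) * (1 / z) - ((288 : ℝ) : ℂ) * (1 / ((τ : ℂ) - z)) := by push_cast; ring
    rw [this, Complex.sub_re, Complex.re_ofReal_mul, Complex.re_ofReal_mul]
  rw [e1]
  have e2 : -64 / r = -288 * (2 / (9 * r)) := by field_simp; norm_num
  rw [e2]
  rcases h with h | h
  · have := h1.2 h
    linarith [h2.1]
  · have := h2.2 h
    linarith [h1.1]

/-- Cauchy's estimate on the disc of radius half the distance to the singularities `0` and `τ`. -/
theorem norm_iteratedDeriv_flat_le {τ t : ℝ} (ht : t ∈ Ioo 0 τ) (j : ℕ) :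
    ‖iteratedDeriv j (flat τ) t‖ ≤
      j.factorial * Real.exp (-64 / min t (τ - t)) / (min t (τ - t) / 2) ^ j := by
  have ht2 : 0 < τ - t := sub_pos.2 ht.2
  set r := min t (τ - t) with hr
  have hr0 : 0 < r := lt_min ht.1 ht2
  have hr1 : r ≤ t := min_le_left _ _
  have hr2 : r ≤ τ - t := min_le_right _ _
  have hor : t = r ∨ τ - t = r := by
    rcases min_choice t (τ - t) with h | h
    · exact Or.inl (h ▸ hr.symm)
    · exact Or.inr (h ▸ hr.symm)
  refine Complex.norm_iteratedDeriv_le_of_forall_mem_sphere_norm_le j (by linarith) ?_ ?_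
  · refine DifferentiableOn.diffContOnCl fun z hz => ?_
    have hz1 : ‖z - t‖ ≤ r / 2 := by
      have := Metric.closure_ball_subset_closedBall hz
      rwa [Metric.mem_closedBall, dist_eq_norm] at this
    have h1 : |z.re - t| ≤ r / 2 := by simpa using (Complex.abs_re_le_norm (z - t)).trans hz1
    have h1' := abs_le.1 h1
    refine (flat_analyticAt ?_ ?_).differentiableAt.differentiableWithinAt
    · rintro rfl; simp at h1'; linarith
    · rintro rfl; simp at h1'; linarith
  · intro z hz
    refine norm_flat_le hr0 hr1 hr2 hor ?_
    rw [mem_sphere_iff_norm] at hz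
    exact hz.le

/-- This fixes the constant `288`. With `r = min t (τ - t)` and `(j!)² ≤ (2j)!`, the term is at most
`(32/r)^j exp (-64/r) / j!`. Since `x^j / j! ≤ exp x` at `x = 64/r`, a geometric factor `2^{-j}`
remains, uniformly in `t` and `|s| ≤ 4`. -/
theorem norm_kernel_term_le {τ t s : ℝ} (ht : t ∈ Ioo 0 τ) (hs : |s| ≤ 4) (j : ℕ) :
    ‖(((-1) ^ j * s ^ (2 * j) / (2 * j).factorial : ℝ) : ℂ) * iteratedDeriv j (flat τ) t‖ ≤
      (1 / 2) ^ j := by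
  have h := norm_iteratedDeriv_flat_le ht j
  set r := min t (τ - t) with hr
  have hr0 : 0 < r := lt_min ht.1 (sub_pos.2 ht.2)
  have hs2 : s ^ (2 * j) ≤ 16 ^ j := by
    rw [pow_mul]
    refine pow_le_pow_left₀ (sq_nonneg s) ?_ j
    nlinarith [sq_abs s, abs_nonneg s]
  have hf : (j.factorial : ℝ) * j.factorial ≤ (2 * j).factorial := by
    have := Nat.le_of_dvd (Nat.factorial_pos _) (Nat.factorial_mul_factorial_dvd_factorial_add j j)
    rw [two_mul]
    exact_mod_cast this
  have he := Real.pow_div_factorial_le_exp (x := 64 / r) (by positivity) j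
  have hj0 : (0 : ℝ) < j.factorial := by exact_mod_cast Nat.factorial_pos j
  have hj1 : (0 : ℝ) < (2 * j).factorial := by exact_mod_cast Nat.factorial_pos _
  rw [norm_mul, Complex.norm_real, norm_div, norm_mul, norm_pow, norm_neg, norm_one, one_pow,
    one_mul, Real.norm_of_nonneg hj1.le, Real.norm_of_nonneg (by rw [pow_mul]; positivity)]
  have he2 : (64 / r) ^ j * Real.exp (-64 / r) ≤ j.factorial := by
    rw [neg_div, Real.exp_neg, ← div_eq_mul_inv, div_le_iff₀ (Real.exp_pos _)]
    rwa [div_le_iff₀ hj0, mul_comm] at he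
  calc s ^ (2 * j) / (2 * j).factorial * ‖iteratedDeriv j (flat τ) t‖
      ≤ 16 ^ j / (j.factorial * j.factorial) *
        (j.factorial * Real.exp (-64 / r) / (r / 2) ^ j) := by gcongr
    _ = (1 / 2) ^ j * ((64 / r) ^ j * Real.exp (-64 / r)) / j.factorial := by
        have : (1 / 2 : ℝ) ^ j * (64 / r) ^ j = 16 ^ j / (r / 2) ^ j := by
          rw [← mul_pow, ← div_pow]; congr 1; field_simp; norm_num
        rw [← mul_assoc, this]; field_simp
    _ ≤ (1 / 2) ^ j * j.factorial / j.factorial := by gcongr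
    _ = (1 / 2) ^ j := by field_simp

/-- One more power of `1/r` than needed is absorbed by the exponential. The spare factor `min t (τ -
t)` makes every derivative vanish at both ends, so integrations by parts have no boundary terms. -/
theorem norm_iteratedDeriv_flat_le_const {τ t : ℝ} (ht : t ∈ Ioo 0 τ) (j : ℕ) :
    ‖iteratedDeriv j (flat τ) t‖ ≤ j.factorial * 2 ^ j * (j + 1).factorial * min t (τ - t) := by
  have h := norm_iteratedDeriv_flat_le ht j
  set r := min t (τ - t) with hr
  have hr0 : 0 < r := lt_min ht.1 (sub_pos.2 ht.2)
  refine h.trans ?_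
  have he := Real.pow_div_factorial_le_exp (x := 1 / r) (by positivity) (j + 1)
  have hj0 : (0 : ℝ) < (j + 1).factorial := by exact_mod_cast Nat.factorial_pos _
  have hmono : Real.exp (1 / r) ≤ Real.exp (64 / r) := by
    rw [Real.exp_le_exp]; gcongr; norm_num
  have he2 : (1 / r) ^ (j + 1) * Real.exp (-64 / r) ≤ (j + 1).factorial := by
    rw [neg_div, Real.exp_neg, ← div_eq_mul_inv, div_le_iff₀ (Real.exp_pos _)]
    rw [div_le_iff₀ hj0, mul_comm] at he
    exact he.trans (by gcongr)
  calc (j.factorial : ℝ) * Real.exp (-64 / r) / (r / 2) ^ j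
      = j.factorial * 2 ^ j * ((1 / r) ^ (j + 1) * Real.exp (-64 / r)) * r := by
        rw [div_pow, div_pow, one_pow, pow_succ]; field_simp
    _ ≤ _ := by gcongr

theorem continuousOn_iteratedDeriv_flat (τ : ℝ) (j : ℕ) :
    ContinuousOn (fun t : ℝ => iteratedDeriv j (flat τ) t) (Ioo 0 τ) := by
  intro t ht
  have h0 : (t : ℂ) ≠ 0 := by exact_mod_cast ht.1.ne'
  have h1 : (t : ℂ) ≠ τ := by exact_mod_cast ht.2.ne
  exact ((hasDerivAt_iteratedDeriv_flat h0 h1 j).continuousAt.comp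
    Complex.continuous_ofReal.continuousAt).continuousWithinAt

theorem integrableOn_of_bounded_Ioo {E : Type*} [NormedAddCommGroup E] {f : ℝ → E} {τ C : ℝ}
    (hc : ContinuousOn f (Ioo 0 τ)) (hb : ∀ t ∈ Ioo 0 τ, ‖f t‖ ≤ C) : IntegrableOn f (Ioo 0 τ) :=
  Integrable.of_bound (hc.aestronglyMeasurable measurableSet_Ioo) C
    ((ae_restrict_mem measurableSet_Ioo).mono hb)

theorem integrableOn_iteratedDeriv_flat_mul_exp {τ : ℝ} (hτ : 0 < τ) (lam : ℝ) (j : ℕ) :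
    IntegrableOn (fun t : ℝ => iteratedDeriv j (flat τ) t * (Real.exp (-lam * t) : ℂ))
      (Ioo 0 τ) := by
  refine integrableOn_of_bounded_Ioo
    (C := (j.factorial * 2 ^ j * (j + 1).factorial * τ) * Real.exp (|lam| * τ))
    ((continuousOn_iteratedDeriv_flat τ j).mul (by fun_prop)) fun t ht => ?_
  rw [norm_mul, Complex.norm_real, Real.norm_of_nonneg (Real.exp_pos _).le]
  have h1 := norm_iteratedDeriv_flat_le_const ht j
  have h2 : min t (τ - t) ≤ τ := (min_le_left _ _).trans ht.2.le
  have h3 : -lam * t ≤ |lam| * τ := by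
    calc -lam * t ≤ |lam| * t := mul_le_mul_of_nonneg_right (neg_le_abs _) ht.1.le
      _ ≤ _ := mul_le_mul_of_nonneg_left ht.2.le (abs_nonneg _)
  have h4 := Real.exp_le_exp.2 h3
  refine mul_le_mul (h1.trans ?_) h4 (Real.exp_pos _).le (by positivity)
  gcongr

/-- Integration by parts: each time derivative of the flat function becomes a factor `lam`.
Iterating produces the powers `ω^{2j}` of the cosine series. -/
theorem integral_iteratedDeriv_flat_succ {τ : ℝ} (hτ : 0 < τ) (lam : ℝ) (j : ℕ) :
    ∫ t in Ioo 0 τ, iteratedDeriv (j + 1) (flat τ) t * (Real.exp (-lam * t) : ℂ) =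
      lam * ∫ t in Ioo 0 τ, iteratedDeriv j (flat τ) t * (Real.exp (-lam * t) : ℂ) := by
  set f : ℝ → ℂ := fun t => iteratedDeriv j (flat τ) t * (Real.exp (-lam * t) : ℂ) with hf
  set f' : ℝ → ℂ := fun t => iteratedDeriv (j + 1) (flat τ) t * (Real.exp (-lam * t) : ℂ) with hf'
  have hd : ∀ t ∈ Ioo 0 τ, HasDerivAt f (f' t - lam * f t) t := by
    intro t ht
    have h0 : (t : ℂ) ≠ 0 := by exact_mod_cast ht.1.ne'
    have h1 : (t : ℂ) ≠ τ := by exact_mod_cast ht.2.ne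
    have e1 := (hasDerivAt_iteratedDeriv_flat h0 h1 j).comp_ofReal
    have e2 : HasDerivAt (fun t : ℝ => (Real.exp (-lam * t) : ℂ))
        ((Real.exp (-lam * t) * (-lam) : ℝ) : ℂ) t := by
      have : HasDerivAt (fun t : ℝ => -lam * t) (-lam) t := by
        simpa using (hasDerivAt_id t).const_mul (-lam)
      exact this.exp.ofReal_comp
    refine (e1.mul e2).congr_deriv ?_
    simp only [hf, hf']; push_cast; ring
  have i1 := integrableOn_iteratedDeriv_flat_mul_exp hτ lam j
  have i2 := integrableOn_iteratedDeriv_flat_mul_exp hτ lam (j + 1)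
  have hint : IntegrableOn (fun t => f' t - lam * f t) (Ioo 0 τ) := i2.sub (i1.const_mul _)
  have hb : ∀ t ∈ Ioo 0 τ, ‖f t‖ ≤ (j.factorial * 2 ^ j * (j + 1).factorial)
      * Real.exp (|lam| * τ) * min t (τ - t) := by
    intro t ht
    have h1 := norm_iteratedDeriv_flat_le_const ht j
    have h3 : -lam * t ≤ |lam| * τ := by
      calc -lam * t ≤ |lam| * t := mul_le_mul_of_nonneg_right (neg_le_abs _) ht.1.le
        _ ≤ _ := mul_le_mul_of_nonneg_left ht.2.le (abs_nonneg _)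
    have h4 := Real.exp_le_exp.2 h3
    have h5 : 0 ≤ min t (τ - t) := le_min ht.1.le (sub_nonneg.2 ht.2.le)
    simp only [hf]
    rw [norm_mul, Complex.norm_real, Real.norm_of_nonneg (Real.exp_pos _).le]
    calc _ ≤ (j.factorial * 2 ^ j * (j + 1).factorial * min t (τ - t)) * Real.exp (|lam| * τ) :=
          mul_le_mul h1 h4 (Real.exp_pos _).le (by positivity)
      _ = _ := by ring
  have hcont : Continuous fun t : ℝ => (j.factorial * 2 ^ j * (j + 1).factorial : ℝ)
      * Real.exp (|lam| * τ) * min t (τ - t) := by fun_prop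
  have l0 : Filter.Tendsto f (nhdsWithin 0 (Ioi 0)) (nhds 0) := by
    refine squeeze_zero_norm' (a := fun t => (j.factorial * 2 ^ j * (j + 1).factorial : ℝ)
      * Real.exp (|lam| * τ) * min t (τ - t)) ?_ ?_
    · filter_upwards [Ioo_mem_nhdsGT hτ] with t ht using hb t ht
    · have := (hcont.tendsto 0).mono_left (nhdsWithin_le_nhds (s := Ioi 0))
      simpa [hτ.le] using this
  have l1 : Filter.Tendsto f (nhdsWithin τ (Iio τ)) (nhds 0) := by
    refine squeeze_zero_norm' (a := fun t => (j.factorial * 2 ^ j * (j + 1).factorial : ℝ)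
      * Real.exp (|lam| * τ) * min t (τ - t)) ?_ ?_
    · filter_upwards [Ioo_mem_nhdsLT hτ] with t ht using hb t ht
    · have := (hcont.tendsto τ).mono_left (nhdsWithin_le_nhds (s := Iio τ))
      simpa [hτ.le] using this
  have key := intervalIntegral.integral_eq_sub_of_hasDerivAt_of_tendsto hτ hd
    ((intervalIntegrable_iff_integrableOn_Ioo_of_le hτ.le).2 hint) l0 l1
  rw [intervalIntegral.integral_of_le hτ.le, integral_Ioc_eq_integral_Ioo,
    integral_sub i2 (i1.const_mul _), integral_const_mul, sub_zero, sub_eq_zero] at key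
  exact key

theorem integral_iteratedDeriv_flat {τ : ℝ} (hτ : 0 < τ) (lam : ℝ) (j : ℕ) :
    ∫ t in Ioo 0 τ, iteratedDeriv j (flat τ) t * (Real.exp (-lam * t) : ℂ) =
      lam ^ j * ∫ t in Ioo 0 τ, flat τ t * (Real.exp (-lam * t) : ℂ) := by
  induction j with
  | zero => simp
  | succ j ih => rw [integral_iteratedDeriv_flat_succ hτ, ih, pow_succ]; ring

theorem flat_ofReal (τ t : ℝ) :
    flat τ t = (Real.exp (-288 / t - 288 / (τ - t)) : ℂ) := by
  rw [flat]; push_cast; rfl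

/-- A kernel `k` with `∫₀^τ k(s,t) e^{-λt} dt = cos(√λ s) m(λ)`, and a lower bound for `m`. -/
theorem exists_transmutation {τ : ℝ} (hτ : 0 < τ) : ∃ (k : ℝ → ℝ → ℝ) (m : ℝ → ℝ),
    (∀ s, |s| ≤ 4 → ContinuousOn (k s) (Ioo 0 τ)) ∧
    (∀ s, |s| ≤ 4 → ∀ t ∈ Ioo 0 τ, |k s t| ≤ 2) ∧
    (∀ s, |s| ≤ 4 → ∀ om : ℝ, ∫ t in Ioo 0 τ, k s t * Real.exp (-om ^ 2 * t) =
      Real.cos (om * s) * m om) ∧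
    (∀ om, τ / 2 * Real.exp (-2304 / τ) * Real.exp (-om ^ 2 * τ) ≤ m om) := by
  -- The terms of the formal series `cos (s √∂ₜ)` applied to the flat function. Its sum solves `∂ₛ²
  -- k = -∂ₜ k` formally, which is what converts heat into waves.
  set T : ℝ → ℕ → ℝ → ℂ := fun s j t =>
    (((-1) ^ j * s ^ (2 * j) / (2 * j).factorial : ℝ) : ℂ) * iteratedDeriv j (flat τ) t with hT
  have hsum : Summable fun j : ℕ => (1 / 2 : ℝ) ^ j := summable_geometric_two
  have hTc : ∀ s, |s| ≤ 4 → ContinuousOn (fun t => ∑' j, T s j t) (Ioo 0 τ) := fun s hs =>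
    continuousOn_tsum (fun j => continuousOn_const.mul (continuousOn_iteratedDeriv_flat τ j)) hsum
      fun j t ht => norm_kernel_term_le ht hs j
  have hTb : ∀ s, |s| ≤ 4 → ∀ t ∈ Ioo 0 τ, ‖∑' j, T s j t‖ ≤ 2 := fun s hs t ht =>
    tsum_of_norm_bounded hasSum_geometric_two fun j => norm_kernel_term_le ht hs j
  set m : ℝ → ℝ := fun om => ∫ t in Ioo 0 τ,
    Real.exp (-288 / t - 288 / (τ - t)) * Real.exp (-om ^ 2 * t) with hm
  have hmC : ∀ om : ℝ, ∫ t in Ioo 0 τ, flat τ t * (Real.exp (-om ^ 2 * t) : ℂ) = (m om : ℂ) := by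
    intro om
    simp only [hm]
    rw [← integral_complex_ofReal]
    refine integral_congr_ae (Filter.Eventually.of_forall fun t => ?_)
    simp only [flat_ofReal]; push_cast; rfl
  refine ⟨fun s t => (∑' j, T s j t).re, m, fun s hs => Complex.continuous_re.comp_continuousOn
    (hTc s hs), fun s hs t ht => (Complex.abs_re_le_norm _).trans (hTb s hs t ht), ?_, ?_⟩
  · intro s hs om
    have hTi : ∀ j, IntegrableOn (fun t => T s j t * (Real.exp (-om ^ 2 * t) : ℂ)) (Ioo 0 τ) :=
      fun j => by
        have := (integrableOn_iteratedDeriv_flat_mul_exp hτ (om ^ 2) j).const_mul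
          (((-1) ^ j * s ^ (2 * j) / (2 * j).factorial : ℝ) : ℂ)
        refine this.congr (Filter.Eventually.of_forall fun t => ?_)
        simp only [hT]; ring_nf
    have hTn : Summable fun j => ∫ t in Ioo 0 τ, ‖T s j t * (Real.exp (-om ^ 2 * t) : ℂ)‖ := by
      refine Summable.of_nonneg_of_le (fun j => integral_nonneg fun t => norm_nonneg _) (fun j => ?_)
        (hsum.mul_right τ)
      have hle : ∀ t ∈ Ioo 0 τ, ‖T s j t * (Real.exp (-om ^ 2 * t) : ℂ)‖ ≤ (1 / 2) ^ j := by
        intro t ht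
        rw [norm_mul, Complex.norm_real, Real.norm_of_nonneg (Real.exp_pos _).le]
        have h1 : Real.exp (-om ^ 2 * t) ≤ 1 := by
          rw [Real.exp_le_one_iff]; nlinarith [sq_nonneg om, ht.1]
        calc _ ≤ (1 / 2) ^ j * 1 := mul_le_mul (norm_kernel_term_le ht hs j) h1
              (Real.exp_pos _).le (by positivity)
          _ = _ := mul_one _
      calc _ ≤ ∫ t in Ioo 0 τ, ((1 / 2) ^ j : ℝ) :=
            setIntegral_mono_on (hTi j).norm (by simp) measurableSet_Ioo hle
        _ = _ := by simp [hτ.le, mul_comm]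
    have h1 := hasSum_integral_of_summable_integral_norm hTi hTn
    have h2 : ∀ j, ∫ t in Ioo 0 τ, T s j t * (Real.exp (-om ^ 2 * t) : ℂ) =
        (((-1) ^ j * (om * s) ^ (2 * j) / (2 * j).factorial * m om : ℝ) : ℂ) := by
      intro j
      simp only [hT, mul_assoc]
      rw [integral_const_mul]
      have := integral_iteratedDeriv_flat hτ (om ^ 2) j
      simp only [neg_mul] at this hmC ⊢
      rw [this, hmC]
      push_cast; ring
    simp only [h2] at h1
    have h3 := ((Real.hasSum_cos (om * s)).mul_right (m om)).mapL Complex.ofRealCLM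
    have h4 := h1.unique h3
    have h5 : ∫ t in Ioo 0 τ, (∑' j, T s j t).re * Real.exp (-om ^ 2 * t) =
        (∫ t in Ioo 0 τ, ∑' j, T s j t * (Real.exp (-om ^ 2 * t) : ℂ)).re := by
      have hi : IntegrableOn (fun t => (∑' j, T s j t) * (Real.exp (-om ^ 2 * t) : ℂ)) (Ioo 0 τ) := by
        refine integrableOn_of_bounded_Ioo (C := 2 * 1) ((hTc s hs).mul (by fun_prop)) fun t ht => ?_
        rw [norm_mul, Complex.norm_real, Real.norm_of_nonneg (Real.exp_pos _).le]
        have h1 : Real.exp (-om ^ 2 * t) ≤ 1 := by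
          rw [Real.exp_le_one_iff]; nlinarith [sq_nonneg om, ht.1]
        exact mul_le_mul (hTb s hs t ht) h1 (Real.exp_pos _).le (by norm_num)
      simp only [tsum_mul_right]
      have := Complex.reCLM.integral_comp_comm hi
      simp only [Complex.reCLM_apply] at this
      rw [← this]
      refine integral_congr_ae (Filter.Eventually.of_forall fun t => ?_)
      simp only [Complex.re_mul_ofReal]
    rw [h5, h4]
    exact Complex.ofReal_re _
  · intro om
    have hi : IntegrableOn (fun t => Real.exp (-288 / t - 288 / (τ - t)) * Real.exp (-om ^ 2 * t))
        (Ioo 0 τ) := by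
      have := (integrableOn_iteratedDeriv_flat_mul_exp hτ (om ^ 2) 0).re
      refine this.congr (Filter.Eventually.of_forall fun t => ?_)
      simp only [iteratedDeriv_zero, flat_ofReal]
      rw [← Complex.ofReal_mul]
      rfl
    -- On the middle half both `288/t` and `288/(τ-t)` are at most `1152/τ`, whence `2304/τ`; its
    -- length gives the factor `τ/2`.
    have hsub : Ioo (τ / 4) (3 * τ / 4) ⊆ Ioo 0 τ := Ioo_subset_Ioo (by linarith) (by linarith)
    calc τ / 2 * Real.exp (-2304 / τ) * Real.exp (-om ^ 2 * τ)
        = ∫ t in Ioo (τ / 4) (3 * τ / 4), Real.exp (-2304 / τ) * Real.exp (-om ^ 2 * τ) := by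
          rw [setIntegral_const, Real.volume_real_Ioo_of_le (by linarith), smul_eq_mul]; ring
      _ ≤ ∫ t in Ioo (τ / 4) (3 * τ / 4),
            Real.exp (-288 / t - 288 / (τ - t)) * Real.exp (-om ^ 2 * t) := by
          refine setIntegral_mono_on (integrable_const _) (hi.mono_set hsub) measurableSet_Ioo fun t ht => ?_
          have ht1 : 288 / t ≤ 288 / (τ / 4) := by
            have := ht.1
            gcongr
          have ht2 : 288 / (τ - t) ≤ 288 / (τ / 4) := by
            have : τ / 4 ≤ τ - t := by linarith [ht.2]
            gcongr
          have h1 : 288 / (τ / 4) = 1152 / τ := by field_simp; norm_num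
          refine mul_le_mul (Real.exp_le_exp.2 ?_) (Real.exp_le_exp.2 ?_) (Real.exp_pos _).le
            (Real.exp_pos _).le
          · rw [h1] at ht1 ht2
            have : -2304 / τ = -(1152 / τ) - 1152 / τ := by ring
            rw [this, neg_div]; linarith
          · nlinarith [sq_nonneg om, ht.2]
      _ ≤ m om := setIntegral_mono_set hi
          (Filter.Eventually.of_forall fun t => by positivity) hsub.eventuallyLE

/-! ### Observability of finite sums of eigenmodes -/

/-- A Dirichlet eigenfunction of `-∂ₓ² + V` on `[-1,1]`, extended to a `C²` function on `ℝ`. -/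
structure IsEigenfunction (V : ℝ → ℝ) (lam : ℝ) (e e' e'' : ℝ → ℝ) : Prop where
  deriv : ∀ x, HasDerivAt e (e' x) x
  deriv_two : ∀ x, HasDerivAt e' (e'' x) x
  continuous_two : Continuous e''
  eqn : ∀ x ∈ Icc (-1 : ℝ) 1, e'' x = (V x - lam) * e x
  left : e (-1) = 0
  right : e 1 = 0

theorem IsEigenfunction.continuous {V : ℝ → ℝ} {lam : ℝ} {e e' e'' : ℝ → ℝ}
    (h : IsEigenfunction V lam e e' e'') : Continuous e :=
  continuous_iff_continuousAt.2 fun x => (h.deriv x).continuousAt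

theorem IsEigenfunction.continuous_one {V : ℝ → ℝ} {lam : ℝ} {e e' e'' : ℝ → ℝ}
    (h : IsEigenfunction V lam e e' e'') : Continuous e' :=
  continuous_iff_continuousAt.2 fun x => (h.deriv_two x).continuousAt

/-- The wave of interest is the cosine sum, which is `Ws` here. Its primitive in `s` is used as `W`
so that `W` vanishes at `s = 0`, as the Poincaré inequality in `s` requires. -/
theorem IsEigenfunction.isWave_sum {ι : Type*} {V : ℝ → ℝ} {lam om : ι → ℝ}
    {e e' e'' : ι → ℝ → ℝ} (h : ∀ i, IsEigenfunction V (lam i) (e i) (e' i) (e'' i))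
    (hom : ∀ i, 0 < om i) (hlam : ∀ i, om i ^ 2 = lam i) (F : Finset ι) (β : ι → ℝ) :
    IsWave (Icc (-1) 1) V (fun s x => ∑ i ∈ F, β i * (Real.sin (om i * s) / om i) * e i x)
      (fun s x => ∑ i ∈ F, β i * Real.cos (om i * s) * e i x)
      (fun s x => ∑ i ∈ F, β i * (Real.sin (om i * s) / om i) * e' i x)
      (fun s x => ∑ i ∈ F, β i * (-om i * Real.sin (om i * s)) * e i x)
      (fun s x => ∑ i ∈ F, β i * Real.cos (om i * s) * e' i x)
      (fun s x => ∑ i ∈ F, β i * (Real.sin (om i * s) / om i) * e'' i x) := by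
  have c0 := fun i => (h i).continuous
  have c1 := fun i => (h i).continuous_one
  have c2 := fun i => (h i).continuous_two
  have hlin : ∀ i s, HasDerivAt (fun s => om i * s) (om i) s := fun i s => by
    simpa using (hasDerivAt_id s).const_mul (om i)
  have hsin : ∀ i s, HasDerivAt (fun s => Real.sin (om i * s) / om i) (Real.cos (om i * s)) s :=
    fun i s => by
      have h0 := (hom i).ne'
      refine ((hlin i s).sin.div_const (om i)).congr_deriv ?_
      field_simp
  have hcos : ∀ i s, HasDerivAt (fun s => Real.cos (om i * s)) (-om i * Real.sin (om i * s)) s :=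
    fun i s => (hlin i s).cos.congr_deriv (by ring)
  refine ⟨by fun_prop, by fun_prop, by fun_prop, by fun_prop, by fun_prop, by fun_prop,
    fun s x => HasDerivAt.fun_sum fun i _ => ((hsin i s).const_mul (β i)).mul_const _,
    fun s x => HasDerivAt.fun_sum fun i _ => ((hcos i s).const_mul (β i)).mul_const _,
    fun s x => HasDerivAt.fun_sum fun i _ => ((hsin i s).const_mul (β i)).mul_const _,
    fun s x => HasDerivAt.fun_sum fun i _ => ((h i).deriv x).const_mul _,
    fun s x => HasDerivAt.fun_sum fun i _ => ((h i).deriv x).const_mul _,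
    fun s x => HasDerivAt.fun_sum fun i _ => ((h i).deriv_two x).const_mul _,
    fun s x hx => ?_⟩
  rw [Finset.mul_sum, ← Finset.sum_add_distrib]
  refine Finset.sum_congr rfl fun i _ => ?_
  have h0 := (hom i).ne'
  rw [(h i).eqn x hx, ← hlam i]
  field_simp
  ring

open Classical in
theorem integral_sq_sum {ι : Type*} {e : ι → ℝ → ℝ} (hc : ∀ i, Continuous (e i))
    (ho : ∀ i j, ∫ x in (-1 : ℝ)..1, e i x * e j x = if i = j then 1 else 0)
    (F : Finset ι) (c : ι → ℝ) :
    ∫ x in (-1 : ℝ)..1, (∑ i ∈ F, c i * e i x) ^ 2 = ∑ i ∈ F, c i ^ 2 := by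
  have : ∀ x, (∑ i ∈ F, c i * e i x) ^ 2 =
      ∑ i ∈ F, ∑ j ∈ F, c i * c j * (e i x * e j x) := fun x => by
    rw [sq, Finset.sum_mul_sum]
    exact Finset.sum_congr rfl fun i _ => Finset.sum_congr rfl fun j _ => by ring
  simp only [this]
  rw [intervalIntegral.integral_finsetSum
    fun i _ => Continuous.intervalIntegrable (by fun_prop) _ _]
  refine Finset.sum_congr rfl fun i hi => ?_
  rw [intervalIntegral.integral_finsetSum
    fun j _ => Continuous.intervalIntegrable (by fun_prop) _ _]
  simp only [intervalIntegral.integral_const_mul, ho]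
  simp [hi, sq]

/-- The integral equals `1/2 + sin om / (2 om)`, and `sin om / om ≥ -1/3`: the sine is nonnegative
up to `π`, and beyond it `om > 3`. -/
theorem integral_cos_sq_ge {om : ℝ} (h : 1 / 2 ≤ om) :
    1 / 3 ≤ ∫ s in (-(1 / 2) : ℝ)..(1 / 2), Real.cos (om * s) ^ 2 := by
  have h0 : 0 < om := by linarith
  have hd : ∀ s, HasDerivAt (fun s => s / 2 + Real.sin (2 * om * s) / (4 * om))
      (Real.cos (om * s) ^ 2) s := fun s => by
    have h1 : HasDerivAt (fun s => 2 * om * s) (2 * om) s := by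
      simpa using (hasDerivAt_id s).const_mul (2 * om)
    refine (((hasDerivAt_id s).div_const 2).add (h1.sin.div_const (4 * om))).congr_deriv ?_
    rw [Real.cos_sq, ← mul_assoc]
    field_simp
    ring
  rw [intervalIntegral.integral_eq_sub_of_hasDerivAt (fun s _ => hd s)
    (Continuous.intervalIntegrable (by fun_prop) _ _)]
  have e1 : 2 * om * (1 / 2) = om := by ring
  have e2 : 2 * om * -(1 / 2) = -om := by ring
  rw [e1, e2, Real.sin_neg]
  have key : -(1 / 3) ≤ Real.sin om / om := by
    rcases le_or_gt om Real.pi with hp | hp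
    · have := div_nonneg (Real.sin_nonneg_of_nonneg_of_le_pi h0.le hp) h0.le
      linarith
    · rw [le_div_iff₀ h0]
      have := Real.neg_one_le_sin om
      have := Real.pi_gt_three
      linarith
  have e3 : Real.sin om / (4 * om) = Real.sin om / om / 4 := by rw [div_div, mul_comm]
  rw [neg_div (4 * om) (Real.sin om), e3]
  linarith

open Classical in
/-- Observability from `(a,b)` of finite sums of eigenmodes of the heat equation. -/
theorem heat_observability_finite {a b : ℝ} (ha : -1 ≤ a) (hab : a < b) (hb : b ≤ 1) :
    ∃ C : ℝ, 0 < C ∧ ∀ {ι : Type} {V : ℝ → ℝ} {M : ℝ} {lam : ι → ℝ} {e e' e'' : ι → ℝ → ℝ},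
      (∀ y ∈ Icc (-1 : ℝ) 1, 0 ≤ V y) → (∀ y ∈ Icc (-1 : ℝ) 1, V y ≤ M ^ 2) → 1 ≤ M →
      (∀ i, IsEigenfunction V (lam i) (e i) (e' i) (e'' i)) → (∀ i, 1 / 4 ≤ lam i) →
      (∀ i j, ∫ x in (-1 : ℝ)..1, e i x * e j x = if i = j then 1 else 0) →
      ∀ {τ : ℝ}, 0 < τ → ∀ (F : Finset ι) (c : ι → ℝ),
      ∑ i ∈ F, (Real.exp (-lam i * τ) * c i) ^ 2 ≤ C * Real.exp (4609 / τ + 6 * M) *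
        ∫ t in (0 : ℝ)..τ, ∫ x in a..b, (∑ i ∈ F, Real.exp (-lam i * t) * c i * e i x) ^ 2 := by
  obtain ⟨C, hC, hobs⟩ := IsWave.observability ha hab hb
  refine ⟨384 * C, by positivity, ?_⟩
  intro ι V M lam e e' e'' hV hVM hM he hlam ho τ hτ F c
  obtain ⟨k, m, kc, kb, kt, hm⟩ := exists_transmutation hτ
  set om : ι → ℝ := fun i => Real.sqrt (lam i) with hom
  have hlam0 : ∀ i, 0 < lam i := fun i => by linarith [hlam i]
  have hom2 : ∀ i, om i ^ 2 = lam i := fun i => Real.sq_sqrt (hlam0 i).le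
  have hom0 : ∀ i, 0 < om i := fun i => Real.sqrt_pos.2 (hlam0 i)
  have hom1 : ∀ i, 1 / 2 ≤ om i := fun i => by
    apply Real.le_sqrt_of_sq_le; linarith [hlam i]
  have ce : ∀ i, Continuous (e i) := fun i => (he i).continuous
  set β : ι → ℝ := fun i => c i * m (om i) with hβ
  have hw := IsEigenfunction.isWave_sum he hom0 hom2 F β
  have h1 := hobs hw hV hVM hM (fun x => by simp)
  set w : ℝ → ℝ → ℝ := fun s x => ∑ i ∈ F, β i * Real.cos (om i * s) * e i x with hwdef
  have cw : Continuous fun z : ℝ × ℝ => w z.1 z.2 := hw.cont_s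
  set u : ℝ → ℝ → ℝ := fun t x => ∑ i ∈ F, Real.exp (-lam i * t) * c i * e i x with hu
  have cu : Continuous fun z : ℝ × ℝ => u z.1 z.2 := by simp only [hu]; fun_prop
  have swp : ∀ {f : ℝ → ℝ → ℝ}, (Continuous fun p : ℝ × ℝ => f p.1 p.2) →
      Continuous fun p : ℝ × ℝ => f p.2 p.1 := fun hf =>
    hf.comp (by fun_prop : Continuous fun p : ℝ × ℝ => (p.2, p.1))
  have sec1 : ∀ {f : ℝ → ℝ → ℝ}, (Continuous fun p : ℝ × ℝ => f p.1 p.2) → ∀ y,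
      Continuous fun s => f s y := fun hf y =>
    hf.comp (by fun_prop : Continuous fun s : ℝ => (s, y))
  have hcont : ∀ {f : ℝ → ℝ → ℝ} (u v : ℝ), (Continuous fun p : ℝ × ℝ => f p.1 p.2) →
      Continuous fun x => ∫ s in u..v, f s x := fun u v hf =>
    intervalIntegral.continuous_parametric_intervalIntegral_of_continuous' (swp hf) _ _
  -- lower bound
  have hlow : 1 / 3 * ∑ i ∈ F, β i ^ 2 ≤
      ∫ x in (-1 : ℝ)..1, ∫ s in (-(1 / 2) : ℝ)..(1 / 2), w s x ^ 2 := by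
    rw [intervalIntegral_swap_of_continuous (F := fun x s => w s x ^ 2)
      (swp (f := fun s x => w s x ^ 2) (cw.pow 2))]
    have e1 : ∀ s, ∫ x in (-1 : ℝ)..1, w s x ^ 2 = ∑ i ∈ F, (β i * Real.cos (om i * s)) ^ 2 :=
      fun s => integral_sq_sum ce ho F fun i => β i * Real.cos (om i * s)
    simp only [e1]
    rw [intervalIntegral.integral_finsetSum
      fun i _ => Continuous.intervalIntegrable (by fun_prop) _ _, Finset.mul_sum]
    refine Finset.sum_le_sum fun i _ => ?_
    simp only [mul_pow, intervalIntegral.integral_const_mul]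
    rw [mul_comm]
    exact mul_le_mul_of_nonneg_left (integral_cos_sq_ge (hom1 i)) (sq_nonneg _)
  -- upper bound
  have hup : ∀ x, ∀ s ∈ Icc (-4 : ℝ) 4, w s x ^ 2 ≤ 4 * (τ * ∫ t in (0 : ℝ)..τ, u t x ^ 2) := by
    intro x s hs
    have hs' : |s| ≤ 4 := abs_le.2 hs
    have cux := sec1 cu x
    have hint : ∀ i, IntegrableOn (fun t => k s t * Real.exp (-om i ^ 2 * t)) (Ioo 0 τ) := by
      intro i
      refine integrableOn_of_bounded_Ioo (C := 2 * 1) ((kc s hs').mul (by fun_prop)) fun t ht => ?_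
      rw [norm_mul, Real.norm_of_nonneg (Real.exp_pos _).le]
      have h1 : Real.exp (-om i ^ 2 * t) ≤ 1 := by
        rw [Real.exp_le_one_iff]; nlinarith [sq_nonneg (om i), ht.1]
      exact mul_le_mul (kb s hs' t ht) h1 (Real.exp_pos _).le (by norm_num)
    -- The kernel acts in time alone, so the wave at `x` depends only on the heat evolution at the
    -- same `x`. Observation on `(a,b)` is thus preserved.
    have e1 : w s x = ∫ t in Ioo 0 τ, k s t * u t x := by
      have e2 : ∀ t, k s t * u t x =
          ∑ i ∈ F, (c i * e i x) * (k s t * Real.exp (-om i ^ 2 * t)) := fun t => by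
        simp only [hu, Finset.mul_sum]
        refine Finset.sum_congr rfl fun i _ => ?_
        rw [hom2]; ring
      simp only [e2]
      rw [integral_finsetSum _ fun i _ => (hint i).const_mul _]
      refine Finset.sum_congr rfl fun i _ => ?_
      rw [integral_const_mul, kt s hs']
      simp only [hβ]; ring
    have e3 : |w s x| ≤ 2 * ∫ t in (0 : ℝ)..τ, |u t x| := by
      rw [e1, ← intervalIntegral.integral_const_mul, intervalIntegral.integral_of_le hτ.le,
        integral_Ioc_eq_integral_Ioo, ← Real.norm_eq_abs]
      refine norm_integral_le_of_norm_le ?_ ?_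
      · exact ((Continuous.integrableOn_Icc (a := 0) (b := τ)
          (by fun_prop : Continuous fun t => 2 * |u t x|)).mono_set Ioo_subset_Icc_self)
      · refine (ae_restrict_mem measurableSet_Ioo).mono fun t ht => ?_
        rw [norm_mul]
        exact mul_le_mul_of_nonneg_right (kb s hs' t ht) (norm_nonneg _)
    have e4 := sq_intervalIntegral_le (f := fun t => |u t x|) (by fun_prop) hτ.le
    simp only [sq_abs, sub_zero] at e4
    rw [← sq_abs]
    calc |w s x| ^ 2 ≤ (2 * ∫ t in (0 : ℝ)..τ, |u t x|) ^ 2 := by gcongr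
      _ = 4 * (∫ t in (0 : ℝ)..τ, |u t x|) ^ 2 := by ring
      _ ≤ _ := by gcongr
  set J := ∫ t in (0 : ℝ)..τ, ∫ x in a..b, u t x ^ 2 with hJ
  have hJ0 : 0 ≤ J := intervalIntegral.integral_nonneg hτ.le fun t _ =>
    intervalIntegral.integral_nonneg hab.le fun x _ => sq_nonneg _
  have hup2 : ∫ x in a..b, ∫ s in (-4 : ℝ)..4, w s x ^ 2 ≤ 32 * τ * J := by
    rw [hJ, intervalIntegral_swap_of_continuous (F := fun t x => u t x ^ 2) (cu.pow 2),
      ← intervalIntegral.integral_const_mul]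
    have c1 := hcont (f := fun s x => w s x ^ 2) (-4) 4 (cw.pow 2)
    have c2 := hcont (f := fun s x => u s x ^ 2) 0 τ (cu.pow 2)
    refine intervalIntegral.integral_mono_on hab.le (c1.intervalIntegrable _ _)
      ((continuous_const.mul c2).intervalIntegrable _ _) fun x _ => ?_
    have cwx := sec1 cw x
    calc ∫ s in (-4 : ℝ)..4, w s x ^ 2
        ≤ ∫ _s in (-4 : ℝ)..4, 4 * (τ * ∫ t in (0 : ℝ)..τ, u t x ^ 2) :=
          intervalIntegral.integral_mono_on (by norm_num)
            (Continuous.intervalIntegrable (by fun_prop) _ _)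
            (_root_.intervalIntegrable_const (μ := volume)) (hup x)
      _ = _ := by rw [intervalIntegral.integral_const, smul_eq_mul]; ring
  -- The lower bound for `m` contains the factor `exp (-lam τ)`, so the wave data dominate the heat
  -- state at the final time `τ`.
  have hβlow : τ ^ 2 / 4 * Real.exp (-4608 / τ) * ∑ i ∈ F, (Real.exp (-lam i * τ) * c i) ^ 2 ≤
      ∑ i ∈ F, β i ^ 2 := by
    rw [Finset.mul_sum]
    refine Finset.sum_le_sum fun i _ => ?_
    have h2 := hm (om i)
    rw [hom2] at h2
    have h3 : (τ / 2 * Real.exp (-2304 / τ) * Real.exp (-lam i * τ)) ^ 2 ≤ m (om i) ^ 2 := by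
      gcongr
    have h4 : Real.exp (-4608 / τ) = Real.exp (-2304 / τ) ^ 2 := by
      rw [← Real.exp_nat_mul]; congr 1; push_cast; ring
    calc _ = c i ^ 2 * (τ / 2 * Real.exp (-2304 / τ) * Real.exp (-lam i * τ)) ^ 2 := by
          rw [h4]; ring
      _ ≤ c i ^ 2 * m (om i) ^ 2 := by gcongr
      _ = _ := by simp only [hβ]; ring
  set Q := ∑ i ∈ F, (Real.exp (-lam i * τ) * c i) ^ 2
  have hfin : τ ^ 2 / 4 * Real.exp (-4608 / τ) * Q ≤
      3 * (C * Real.exp (6 * M) * (32 * τ * J)) := by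
    have := mul_le_mul_of_nonneg_left hup2 (by positivity : 0 ≤ C * Real.exp (6 * M))
    linarith
  have h5 : Q ≤ 384 * C * (1 / τ * Real.exp (4608 / τ)) * Real.exp (6 * M) * J := by
    have h6 : Real.exp (-4608 / τ) * Real.exp (4608 / τ) = 1 := by
      rw [← Real.exp_add]; simp [neg_div]
    have h7 := mul_le_mul_of_nonneg_left hfin
      (by positivity : 0 ≤ 4 / τ ^ 2 * Real.exp (4608 / τ))
    calc Q = (Real.exp (-4608 / τ) * Real.exp (4608 / τ)) * Q := by rw [h6, one_mul]
      _ = 4 / τ ^ 2 * Real.exp (4608 / τ) * (τ ^ 2 / 4 * Real.exp (-4608 / τ) * Q) := by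
        field_simp
      _ ≤ _ := h7
      _ = _ := by field_simp; ring
  refine h5.trans ?_
  -- The factor `1/τ` is absorbed by `1/τ ≤ exp (1/τ)`, which turns `4608` into `4609`.
  have h8 : 1 / τ * Real.exp (4608 / τ) * Real.exp (6 * M) ≤ Real.exp (4609 / τ + 6 * M) := by
    have h9 : 1 / τ ≤ Real.exp (1 / τ) := by linarith [Real.add_one_le_exp (1 / τ)]
    have : (4609 / τ + 6 * M) = 1 / τ + 4608 / τ + 6 * M := by ring
    rw [this, Real.exp_add, Real.exp_add]
    gcongr
  calc _ = 384 * C * (1 / τ * Real.exp (4608 / τ) * Real.exp (6 * M)) * J := by ring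
    _ ≤ _ := by gcongr

/-! ### Eigenbases of `(B B†)⁻¹ + V` -/

section Abstract

open Module.End

variable {H : Type} [NormedAddCommGroup H] [InnerProductSpace ℝ H] [CompleteSpace H]

/-- A compact injective symmetric operator has a Hilbert basis of eigenvectors with nonzero
eigenvalues. -/
theorem exists_hilbertBasis_of_compact {R : H →L[ℝ] H} (hc : IsCompactOperator R)
    (hs : (R : H →ₗ[ℝ] H).IsSymmetric) (hinj : ∀ x, R x = 0 → x = 0) :
    ∃ (ι : Type) (b : HilbertBasis ι ℝ H) (μ : ι → ℝ), ∀ i, μ i ≠ 0 ∧ R (b i) = μ i • b i := by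
  -- Compactness gives finite dimension for `μ ≠ 0`, and injectivity makes the eigenspace of `0`
  -- trivial. Each eigenspace therefore has a finite orthonormal basis.
  have hfd : ∀ μ : ℝ, FiniteDimensional ℝ (eigenspace (R : H →ₗ[ℝ] H) μ) := by
    intro μ
    by_cases hμ : μ = 0
    · have : eigenspace (R : H →ₗ[ℝ] H) μ = ⊥ := by
        rw [eq_bot_iff]
        intro x hx
        rw [mem_eigenspace_iff, hμ, zero_smul] at hx
        exact (Submodule.mem_bot ℝ).2 (hinj x hx)
      rw [this]; infer_instance
    · exact ContinuousLinearMap.finite_dimensional_eigenspace hc μ hμ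
  set v : (Σ μ : ℝ, Fin (Module.finrank ℝ (eigenspace (R : H →ₗ[ℝ] H) μ))) → H := fun a =>
    ((stdOrthonormalBasis ℝ (eigenspace (R : H →ₗ[ℝ] H) a.1)) a.2 : H) with hv
  have hon : Orthonormal ℝ v :=
    hs.orthogonalFamily_eigenspaces.orthonormal_sigma_orthonormal
      fun μ => (stdOrthonormalBasis ℝ (eigenspace (R : H →ₗ[ℝ] H) μ)).orthonormal
  have hspan : (Submodule.span ℝ (Set.range v))ᗮ = ⊥ := by
    rw [eq_bot_iff, ← ContinuousLinearMap.orthogonalComplement_iSup_eigenspaces_eq_bot hc hs]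
    refine Submodule.orthogonal_le (iSup_le fun μ x hx => ?_)
    have hrep := (stdOrthonormalBasis ℝ (eigenspace (R : H →ₗ[ℝ] H) μ)).sum_repr ⟨x, hx⟩
    have hrep' := congrArg (Submodule.subtype _) hrep
    simp only [map_sum, map_smul, Submodule.subtype_apply] at hrep'
    rw [← hrep']
    exact Submodule.sum_mem _ fun i _ => Submodule.smul_mem _ _
      (Submodule.subset_span ⟨⟨μ, i⟩, rfl⟩)
  refine ⟨_, HilbertBasis.mkOfOrthogonalEqBot hon hspan, fun a => a.1, fun a => ?_⟩
  rw [HilbertBasis.coe_mkOfOrthogonalEqBot]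
  have hmem : R (v a) = a.1 • v a := mem_eigenspace_iff.1
    ((stdOrthonormalBasis ℝ (eigenspace (R : H →ₗ[ℝ] H) a.1)) a.2).2
  refine ⟨fun h0 => ?_, hmem⟩
  have h0' : a.1 = 0 := h0
  rw [h0', zero_smul] at hmem
  exact hon.ne_zero a (hinj _ hmem)

/-- The inverse of `(B B†)⁻¹ + V` is `R = B (1 + B† V B)⁻¹ B†`, which needs no unbounded operators.
The operator `S = B† V B` is compact and nonnegative, so `-1` is not an eigenvalue and the Fredholm
alternative inverts `1 + S`. Then `R` is compact, symmetric and injective, and `R b = μ b`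
rearranges to the stated identity with `lam = 1/μ`. -/
theorem exists_eigenbasis {B V : H →L[ℝ] H} (hB : IsCompactOperator B)
    (hVs : ∀ x y, inner ℝ (V x) y = inner ℝ x (V y)) (hV0 : ∀ x, 0 ≤ inner ℝ (V x) x)
    (hinj : ∀ x, B.adjoint x = 0 → x = 0) :
    ∃ (ι : Type) (b : HilbertBasis ι ℝ H) (lam : ι → ℝ), ∀ i,
      b i = B (B.adjoint (lam i • b i - V (b i))) := by
  set S : H →L[ℝ] H := B.adjoint ∘L V ∘L B with hS
  have hSc : IsCompactOperator S := (hB.clm_comp V).clm_comp B.adjoint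
  have hSin : ∀ x y, inner ℝ (S x) y = inner ℝ (V (B x)) (B y) := fun x y => by
    simp only [hS, ContinuousLinearMap.comp_apply, ContinuousLinearMap.adjoint_inner_left]
  have hnot : ¬ HasEigenvalue (S : Module.End ℝ H) (-1) := by
    intro h
    obtain ⟨x, hx⟩ := h.exists_hasEigenvector
    have h1 : S x = (-1 : ℝ) • x := hx.apply_eq_smul
    have h2 := hSin x x
    rw [h1, inner_smul_left, real_inner_self_eq_norm_sq] at h2
    have h3 := hV0 (B x)
    have h4 : ‖x‖ ^ 2 ≤ 0 := by
      simp at h2; linarith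
    have h5 : 0 < ‖x‖ := norm_pos_iff.2 hx.2
    nlinarith
  have hres := (hSc.hasEigenvalue_or_mem_resolventSet (μ := (-1 : ℝ)) (by norm_num)).resolve_left
    hnot
  rw [spectrum.mem_resolventSet_iff] at hres
  obtain ⟨U, hU⟩ := hres
  set N : H →L[ℝ] H := -(↑U⁻¹ : H →L[ℝ] H) with hN
  have hTapp : ∀ x, (U : H →L[ℝ] H) x = -(x + S x) := fun x => by
    rw [hU]; simp [Algebra.algebraMap_eq_smul_one]; abel
  have hN1 : ∀ x, N x + S (N x) = x := fun x => by
    have h1 : (U : H →L[ℝ] H) ((↑U⁻¹ : H →L[ℝ] H) x) = x := by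
      rw [← mul_apply_eq_comp, Units.mul_inv]; rfl
    rw [hTapp] at h1
    have h2 : N x = -((↑U⁻¹ : H →L[ℝ] H) x) := rfl
    rw [h2, map_neg, ← neg_add, h1]
  have hNs : ∀ x y, inner ℝ (N x) y = inner ℝ x (N y) := fun x y => by
    have h1 : inner ℝ (N x) (N y + S (N y)) = inner ℝ (N x + S (N x)) (N y) := by
      rw [inner_add_left, inner_add_right, hSin, real_inner_comm (S (N y)) (N x), hSin, hVs,
        real_inner_comm (B (N y))]
    rwa [hN1, hN1] at h1
  set R : H →L[ℝ] H := B ∘L N ∘L B.adjoint with hR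
  have hRin : ∀ x y, inner ℝ (R x) y = inner ℝ (N (B.adjoint x)) (B.adjoint y) := fun x y => by
    simp only [hR, ContinuousLinearMap.comp_apply, ContinuousLinearMap.adjoint_inner_right]
  have hRc : IsCompactOperator R := hB.comp_clm (N ∘L B.adjoint)
  have hRs : (R : H →ₗ[ℝ] H).IsSymmetric := fun x y => by
    show inner ℝ (R x) y = inner ℝ x (R y)
    rw [hRin, hNs, real_inner_comm (R y) x, hRin, real_inner_comm]
  have hRinj : ∀ x, R x = 0 → x = 0 := by
    intro x hx
    have h1 := hRin x x
    rw [hx, inner_zero_left] at h1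
    set y := N (B.adjoint x) with hy
    have h2 : y + S y = B.adjoint x := hN1 _
    rw [← h2, inner_add_right, real_inner_self_eq_norm_sq, real_inner_comm, hSin] at h1
    have h3 := hV0 (B y)
    have h4 : y = 0 := by
      have h6 : ‖y‖ = 0 := by nlinarith [norm_nonneg y]
      exact norm_eq_zero.1 h6
    rw [h4] at h2
    exact hinj x (by rw [← h2]; simp)
  obtain ⟨ι, b, μ, hb⟩ := exists_hilbertBasis_of_compact hRc hRs hRinj
  refine ⟨ι, b, fun i => (μ i)⁻¹, fun i => ?_⟩
  obtain ⟨hμ, hbi⟩ := hb i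
  set y := N (B.adjoint (b i)) with hy
  have hBy : B y = μ i • b i := hbi
  have h2 : y + S y = B.adjoint (b i) := hN1 _
  have h3 : S y = B.adjoint (V (μ i • b i)) := by rw [← hBy]; rfl
  have h4 : B.adjoint ((μ i)⁻¹ • b i - V (b i)) = (μ i)⁻¹ • y := by
    have h5 : (μ i)⁻¹ • b i - V (b i) = (μ i)⁻¹ • (b i - V (μ i • b i)) := by
      rw [smul_sub, map_smul, smul_smul, inv_mul_cancel₀ hμ, one_smul]
    rw [h5, map_smul, map_sub, ← h3, ← h2, add_sub_cancel_right]
  simp only [h4]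
  rw [map_smul, hBy, smul_smul, inv_mul_cancel₀ hμ, one_smul]

end Abstract

/-! ### The primitive as a compact operator on `L²(-1,1;ℝ)` -/

/-- The space `L²(-1,1;ℝ)`. -/
abbrev RealL2 : Type := Lp ℝ 2 (volume.restrict (Ioo (-1 : ℝ) 1))

/-- The indicator function of `(-∞,x]` in `L²(-1,1)`. -/
noncomputable def step (x : ℝ) : RealL2 :=
  indicatorConstLp 2 (measurableSet_Iic (a := x)) (measure_ne_top _ _) (1 : ℝ)

theorem continuous_step : Continuous step := by
  refine continuous_indicatorConstLp_set (by norm_num) fun x => ?_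
  have h1 : Filter.Tendsto (fun y : ℝ => ENNReal.ofReal |y - x|) (nhds x) (nhds 0) := by
    have : Continuous fun y : ℝ => ENNReal.ofReal |y - x| :=
      ENNReal.continuous_ofReal.comp (by fun_prop)
    simpa using this.tendsto x
  refine tendsto_of_tendsto_of_tendsto_of_le_of_le tendsto_const_nhds h1 (fun _ => zero_le)
    fun y => ?_
  calc (volume.restrict (Ioo (-1 : ℝ) 1)) (symmDiff (Iic y) (Iic x))
      ≤ volume (symmDiff (Iic y) (Iic x)) := Measure.restrict_le_self _
    _ ≤ volume (uIoc x y) := by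
        refine measure_mono fun z hz => ?_
        rw [mem_symmDiff] at hz
        simp only [mem_Iic, not_le] at hz
        rw [mem_uIoc]
        rcases hz with hz | hz
        · exact Or.inl ⟨hz.2, hz.1⟩
        · exact Or.inr ⟨hz.2, hz.1⟩
    _ = ENNReal.ofReal |y - x| := by rw [Real.volume_uIoc]

/-- The primitive of `f` vanishing at `-1`. -/
noncomputable def primitive (f : RealL2) (x : ℝ) : ℝ := inner ℝ (step x) f

theorem primitive_eq (f : RealL2) (x : ℝ) :
    primitive f x = ∫ y in Iic x, f y ∂(volume.restrict (Ioo (-1 : ℝ) 1)) :=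
  L2.inner_indicatorConstLp_one _ _ _

theorem continuous_primitive (f : RealL2) : Continuous (primitive f) :=
  continuous_step.inner continuous_const

theorem exists_norm_step_le : ∃ C, ∀ x : Icc (-1 : ℝ) 1, ‖step x‖ ≤ C := by
  obtain ⟨C, hC⟩ := isCompact_Icc.exists_bound_of_continuousOn (s := Icc (-1 : ℝ) 1)
    continuous_step.continuousOn
  exact ⟨C, fun x => hC x x.2⟩

/-- The primitive as a continuous function on `[-1,1]`. -/
noncomputable def primitiveBCF : RealL2 →L[ℝ] BoundedContinuousFunction (Icc (-1 : ℝ) 1) ℝ :=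
  LinearMap.mkContinuousOfExistsBound
    { toFun := fun f => BoundedContinuousFunction.mkOfCompact
        ⟨fun x => primitive f x, (continuous_primitive f).comp continuous_subtype_val⟩
      map_add' := fun f g => by ext x; simp [primitive, inner_add_right]
      map_smul' := fun c f => by ext x; simp [primitive, inner_smul_right] }
    (by
      obtain ⟨C, hC⟩ := exists_norm_step_le
      refine ⟨C, fun f => ?_⟩
      have h0 : 0 ≤ C := (norm_nonneg _).trans (hC ⟨0, by norm_num⟩)
      refine (BoundedContinuousFunction.norm_le (by positivity)).2 fun x => ?_
      exact (norm_inner_le_norm (𝕜 := ℝ) (step x) f).trans (by exact mul_le_mul_of_nonneg_right (hC x) (norm_nonneg f)))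

theorem primitiveBCF_apply (f : RealL2) (x : Icc (-1 : ℝ) 1) : primitiveBCF f x = primitive f x :=
  rfl

/-- Primitives are inner products with `step x`, so those of the unit ball share the modulus of
continuity of `x ↦ step x`; Arzelà–Ascoli applies. -/
theorem isCompactOperator_primitiveBCF : IsCompactOperator primitiveBCF := by
  obtain ⟨C, hC⟩ := exists_norm_step_le
  have h0 : 0 ≤ C := (norm_nonneg _).trans (hC ⟨0, by norm_num⟩)
  refine (isCompactOperator_iff_isCompact_closure_image_closedBall
    primitiveBCF.toLinearMap one_pos).2 ?_
  refine BoundedContinuousFunction.arzela_ascoli (Metric.closedBall 0 C) (isCompact_closedBall _ _)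
    _ ?_ ?_
  · rintro _ x ⟨f, hf, rfl⟩
    rw [mem_closedBall_zero_iff] at hf ⊢
    show ‖primitive f x‖ ≤ C
    refine (norm_inner_le_norm _ _).trans ?_
    calc ‖step x‖ * ‖f‖ ≤ C * 1 := mul_le_mul (hC x) hf (norm_nonneg _) h0
      _ = C := mul_one C
  · intro x
    rw [Metric.equicontinuousAt_iff]
    intro ε hε
    have hc : Continuous fun y : Icc (-1 : ℝ) 1 => step y :=
      continuous_step.comp continuous_subtype_val
    obtain ⟨δ, hδ, h⟩ := Metric.continuousAt_iff.1 (hc.continuousAt (x := x)) ε hε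
    refine ⟨δ, hδ, fun y hy => ?_⟩
    rintro ⟨_, f, hf, rfl⟩
    rw [mem_closedBall_zero_iff] at hf
    show dist (primitive f x) (primitive f y) < ε
    rw [dist_comm, Real.dist_eq, primitive, primitive, ← inner_sub_left]
    calc |inner ℝ (step y - step x) f| ≤ ‖step y - step x‖ * ‖f‖ := abs_real_inner_le_norm _ _
      _ ≤ ‖step y - step x‖ * 1 := by gcongr
      _ < ε := by rw [mul_one, ← dist_eq_norm]; exact h hy

/-- Continuous functions on `[-1,1]` as elements of `L²(-1,1)`. -/
noncomputable def extendBCF : BoundedContinuousFunction (Icc (-1 : ℝ) 1) ℝ →L[ℝ] RealL2 where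
  toFun := fun h => BoundedContinuousFunction.toLp (E := ℝ) 2 (volume.restrict (Ioo (-1 : ℝ) 1)) ℝ
    (h.compContinuous ⟨projIcc (-1) 1 (by norm_num), continuous_projIcc⟩)
  map_add' := fun f g => by rw [← map_add]; rfl
  map_smul' := fun c f => by rw [RingHom.id_apply, ← map_smul]; rfl
  cont := (BoundedContinuousFunction.toLp (E := ℝ) 2
    (volume.restrict (Ioo (-1 : ℝ) 1)) ℝ).continuous.comp
      (BoundedContinuousFunction.continuous_compContinuous _)

/-- The primitive as an operator on `L²(-1,1)`. -/
noncomputable def volterra : RealL2 →L[ℝ] RealL2 := extendBCF ∘L primitiveBCF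

theorem isCompactOperator_volterra : IsCompactOperator volterra :=
  isCompactOperator_primitiveBCF.clm_comp extendBCF

theorem volterra_coeFn (f : RealL2) :
    volterra f =ᵐ[volume.restrict (Ioo (-1 : ℝ) 1)] primitive f := by
  have h := BoundedContinuousFunction.coeFn_toLp (p := 2) (𝕜 := ℝ)
    (volume.restrict (Ioo (-1 : ℝ) 1)) ((primitiveBCF f).compContinuous
      ⟨projIcc (-1) 1 (by norm_num), continuous_projIcc⟩)
  filter_upwards [h, ae_restrict_mem measurableSet_Ioo] with x hx hx'
  refine hx.trans ?_
  rw [BoundedContinuousFunction.compContinuous_apply, primitiveBCF_apply]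
  simp [projIcc_of_mem (by norm_num : (-1 : ℝ) ≤ 1) (Ioo_subset_Icc_self hx')]

theorem step_one_coeFn : step 1 =ᵐ[volume.restrict (Ioo (-1 : ℝ) 1)] fun _ => (1 : ℝ) := by
  have h := indicatorConstLp_coeFn (p := 2) (μ := volume.restrict (Ioo (-1 : ℝ) 1))
    (hs := measurableSet_Iic (a := (1 : ℝ))) (hμs := measure_ne_top _ _) (c := (1 : ℝ))
  filter_upwards [h, ae_restrict_mem measurableSet_Ioo] with x hx hx'
  refine hx.trans (indicator_of_mem (mem_Iic.2 hx'.2.le) _)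

theorem primitive_one (f : RealL2) :
    primitive f 1 = ∫ y, f y ∂(volume.restrict (Ioo (-1 : ℝ) 1)) := by
  rw [primitive_eq, Measure.restrict_restrict measurableSet_Iic]
  congr 2
  exact inter_eq_right.2 fun x hx => hx.2.le

theorem primitive_eq_intervalIntegral {f : RealL2} {F : ℝ → ℝ}
    (h : f =ᵐ[volume.restrict (Ioo (-1 : ℝ) 1)] F) {x : ℝ} (hx : x ∈ Icc (-1 : ℝ) 1) :
    primitive f x = ∫ y in (-1 : ℝ)..x, F y := by
  rw [primitive_eq, intervalIntegral.integral_of_le hx.1, integral_Ioc_eq_integral_Ioo,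
    integral_congr_ae (ae_restrict_of_ae h), Measure.restrict_restrict measurableSet_Iic]
  refine setIntegral_congr_set ?_
  have h1 : (Iic x ∩ Ioo (-1 : ℝ) 1 : Set ℝ) =ᵐ[volume] (Iio x ∩ Ioo (-1 : ℝ) 1 : Set ℝ) :=
    Iio_ae_eq_Iic.symm.inter (ae_eq_refl _)
  have h2 : (Iio x ∩ Ioo (-1 : ℝ) 1 : Set ℝ) = Ioo (-1) x := ?_
  · rw [h2] at h1; exact h1
  ext y
  simp only [mem_inter_iff, mem_Iio, mem_Ioo]
  exact ⟨fun h => ⟨h.2.1, h.1⟩, fun h => ⟨h.2, h.1, h.2.trans_le hx.2⟩⟩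

/-- Integration by parts: the primitive is skew-adjoint up to boundary terms. -/
theorem inner_volterra_add (f g : RealL2) :
    inner ℝ (volterra f) g + inner ℝ f (volterra g) =
      inner ℝ (step 1) f * inner ℝ (step 1) g := by
  set μ := volume.restrict (Ioo (-1 : ℝ) 1)
  have hfi : Integrable f μ := (Lp.memLp f).integrable (by norm_num)
  have hgi : Integrable g μ := (Lp.memLp g).integrable (by norm_num)
  have hprod : Integrable (fun z : ℝ × ℝ => g z.1 * f z.2) (μ.prod μ) := hgi.mul_prod hfi
  set A : ℝ → ℝ → ℝ := fun x y => g x * (Iic x).indicator f y with hA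
  set A' : ℝ → ℝ → ℝ := fun x y => (Iic x).indicator g y * f x with hA'
  have hAi : Integrable (Function.uncurry A) (μ.prod μ) := by
    have hm : MeasurableSet {z : ℝ × ℝ | z.2 ≤ z.1} := measurableSet_le measurable_snd measurable_fst
    refine (hprod.indicator hm).congr (Filter.Eventually.of_forall fun z => ?_)
    by_cases hz : z.2 ≤ z.1 <;> simp [hA, Function.uncurry, indicator, hz]
  have e1 : inner ℝ (volterra f) g = ∫ x, ∫ y, A x y ∂μ ∂μ := by
    rw [L2.inner_def]
    refine integral_congr_ae ?_
    filter_upwards [volterra_coeFn f] with x hx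
    rw [hx]
    simp only [hA, integral_const_mul, integral_indicator measurableSet_Iic]
    rw [← primitive_eq]
    simp
  have e2 : inner ℝ f (volterra g) = ∫ x, ∫ y, A' x y ∂μ ∂μ := by
    rw [L2.inner_def]
    refine integral_congr_ae ?_
    filter_upwards [volterra_coeFn g] with x hx
    rw [hx]
    simp only [hA', integral_mul_const, integral_indicator measurableSet_Iic]
    rw [← primitive_eq]
    simp
  have e3 : inner ℝ (step 1) f * inner ℝ (step 1) g = ∫ x, ∫ y, g x * f y ∂μ ∂μ := by
    have h1 : inner ℝ (step 1) f = ∫ y, f y ∂μ := primitive_one f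
    have h2 : inner ℝ (step 1) g = ∫ y, g y ∂μ := primitive_one g
    simp only [integral_const_mul, integral_mul_const]
    rw [h1, h2, mul_comm]
  -- The triangles `y ≤ x` and `x ≤ y` cover the square and overlap only in the null diagonal.
  have e4 : ∫ x, ∫ y, A x y ∂μ ∂μ + ∫ x, ∫ y, A' y x ∂μ ∂μ = ∫ x, ∫ y, g x * f y ∂μ ∂μ := by
    have hA'i : Integrable (fun z : ℝ × ℝ => A' z.2 z.1) (μ.prod μ) := by
      have hm : MeasurableSet {z : ℝ × ℝ | z.1 ≤ z.2} :=
        measurableSet_le measurable_fst measurable_snd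
      refine (hprod.indicator hm).congr (Filter.Eventually.of_forall fun z => ?_)
      by_cases hz : z.1 ≤ z.2 <;> simp [hA', indicator, hz]
    have hadd := integral_integral_add hAi hA'i
    simp only [Function.uncurry] at hadd
    rw [← hadd]
    refine integral_congr_ae (Filter.Eventually.of_forall fun x => integral_congr_ae ?_)
    have hne : ∀ᵐ y ∂μ, y ≠ x := by
      refine ae_restrict_of_ae ?_
      simp [ae_iff]
    filter_upwards [hne] with y hy
    rcases lt_or_gt_of_ne hy with h | h
    · simp [hA, hA', indicator, h.le, not_le.2 h]
    · simp [hA, hA', indicator, h.le, not_le.2 h]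
  have e5 : ∫ x, ∫ y, A' x y ∂μ ∂μ = ∫ x, ∫ y, A' y x ∂μ ∂μ := by
    refine integral_integral_swap ?_
    have hm : MeasurableSet {z : ℝ × ℝ | z.2 ≤ z.1} := measurableSet_le measurable_snd measurable_fst
    have hprod' : Integrable (fun z : ℝ × ℝ => f z.1 * g z.2) (μ.prod μ) := hfi.mul_prod hgi
    refine (hprod'.indicator hm).congr (Filter.Eventually.of_forall fun z => ?_)
    by_cases hz : z.2 ≤ z.1 <;> simp [hA', Function.uncurry, indicator, hz, mul_comm]
  rw [e1, e2, e3, e5, e4]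

/-! ### Dirichlet eigenbasis of `-∂ₓ² + V` -/

theorem inner_step_one_self : inner ℝ (step 1) (step 1) = (2 : ℝ) := by
  have h := primitive_one (step 1)
  rw [integral_congr_ae step_one_coeFn] at h
  simp only [integral_const, smul_eq_mul, mul_one, measureReal_restrict_apply_univ] at h
  rw [Real.volume_real_Ioo_of_le (by norm_num)] at h
  exact h.trans (by norm_num)

/-- The orthogonal projection of `L²(-1,1)` onto the functions of mean zero. -/
noncomputable def meanZero : RealL2 →L[ℝ] RealL2 :=
  ContinuousLinearMap.id ℝ RealL2 - (1 / 2 : ℝ) • (innerSL ℝ (step 1)).smulRight (step 1)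

theorem meanZero_apply (f : RealL2) :
    meanZero f = f - (1 / 2 * inner ℝ (step 1) f) • step 1 := by
  simp [meanZero, smul_smul]

theorem inner_step_one_meanZero (f : RealL2) : inner ℝ (step 1) (meanZero f) = 0 := by
  rw [meanZero_apply, inner_sub_right, inner_smul_right, inner_step_one_self]; ring

theorem meanZero_meanZero (f : RealL2) : meanZero (meanZero f) = meanZero f := by
  rw [meanZero_apply (meanZero f), inner_step_one_meanZero]; simp

/-- By `inner_volterra_add`, the adjoint of the primitive is its negative plus a multiple of the
constant function, and the mean-zero projection kills constants. Hence for `B = volterra ∘L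
meanZero`, `B B†` integrates twice with the constant chosen so that the result vanishes at both
ends: it inverts the Dirichlet operator `-∂ₓ²`. -/
theorem adjoint_volterra_meanZero (g : RealL2) :
    (volterra ∘L meanZero).adjoint g = -meanZero (volterra g) := by
  refine ext_inner_right ℝ fun f => ?_
  rw [ContinuousLinearMap.adjoint_inner_left, ContinuousLinearMap.comp_apply, meanZero_apply f,
    meanZero_apply (volterra g), map_sub, map_smul, inner_sub_right, inner_smul_right,
    inner_neg_left, inner_sub_left, inner_smul_left]
  have h1 := inner_volterra_add f g
  have h2 := inner_volterra_add (step 1) g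
  rw [inner_step_one_self] at h2
  have h3 := real_inner_comm (volterra f) g
  have h4 := real_inner_comm (volterra (step 1)) g
  have h5 := real_inner_comm (volterra g) f
  simp only [conj_trivial]
  rw [← real_inner_comm (volterra f) g, ← real_inner_comm (volterra (step 1)) g] at *
  linear_combination h1 - (1 / 2 * inner ℝ (step 1) f) * h2 - h5

/-- Multiplication by a function that is continuous on `ℝ`. -/
noncomputable def mulOp (v : ℝ → ℝ) : RealL2 →L[ℝ] RealL2 :=
  open Classical in
  -- The potentials in use are continuous, hence bounded on `(-1,1)`; the default `0` never matters
  -- for them.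
  if h : MemLp v ⊤ (volume.restrict (Ioo (-1 : ℝ) 1)) then
    (ContinuousLinearMap.mul ℝ ℝ).holderL (volume.restrict (Ioo (-1 : ℝ) 1)) ⊤ 2 2 (h.toLp v)
  else 0

theorem memLp_top_of_continuous {v : ℝ → ℝ} (hv : Continuous v) (q : ENNReal) :
    MemLp v q (volume.restrict (Ioo (-1 : ℝ) 1)) := by
  obtain ⟨C, hC⟩ := isCompact_Icc.exists_bound_of_continuousOn (s := Icc (-1 : ℝ) 1) hv.continuousOn
  exact MemLp.of_bound hv.aestronglyMeasurable C
    ((ae_restrict_mem measurableSet_Ioo).mono fun x hx => hC x (Ioo_subset_Icc_self hx))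

theorem mulOp_coeFn {v : ℝ → ℝ} (hv : Continuous v) (f : RealL2) :
    mulOp v f =ᵐ[volume.restrict (Ioo (-1 : ℝ) 1)] fun x => v x * f x := by
  have h := memLp_top_of_continuous hv ⊤
  have h1 := (ContinuousLinearMap.mul ℝ ℝ).coeFn_holder (r := 2) (h.toLp v) f
  have h2 := h.coeFn_toLp
  rw [mulOp, dif_pos h]
  filter_upwards [h1, h2] with x hx1 hx2
  refine Eq.trans hx1 ?_
  rw [hx2]; rfl

theorem inner_mulOp {v : ℝ → ℝ} (hv : Continuous v) (f g : RealL2) :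
    inner ℝ (mulOp v f) g = inner ℝ f (mulOp v g) := by
  rw [L2.inner_def, L2.inner_def]
  refine integral_congr_ae ?_
  filter_upwards [mulOp_coeFn hv f, mulOp_coeFn hv g] with x h1 h2
  rw [h1, h2]
  simp; ring

theorem inner_mulOp_nonneg {v : ℝ → ℝ} (hv : Continuous v) (h0 : ∀ x, 0 ≤ v x) (f : RealL2) :
    0 ≤ inner ℝ (mulOp v f) f := by
  rw [L2.inner_def]
  refine integral_nonneg_of_ae ?_
  filter_upwards [mulOp_coeFn hv f] with x h1
  rw [h1]
  have h2 : inner ℝ (v x * f x) (f x) = f x * (v x * f x) := rfl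
  rw [h2, Pi.zero_apply]
  nlinarith [mul_nonneg (h0 x) (mul_self_nonneg (f x))]

/-- The hypothesis says that the primitive of `f` is constant. Pairing it with `η'` for a test
function `η` and integrating by parts gives `∫ η f = 0`, so `f = 0` almost everywhere. -/
theorem eq_zero_of_meanZero_volterra {f : RealL2} (h : meanZero (volterra f) = 0) : f = 0 := by
  rw [meanZero_apply, sub_eq_zero] at h
  refine Lp.eq_zero_iff_ae_eq_zero.2 ?_
  rw [Filter.EventuallyEq, ae_restrict_iff' measurableSet_Ioo]
  have hint : IntegrableOn f (Ioo (-1 : ℝ) 1) := (Lp.memLp f).integrable (by norm_num)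
  refine isOpen_Ioo.ae_eq_zero_of_integral_contDiff_smul_eq_zero hint.locallyIntegrableOn ?_
  intro η hη _ hsupp
  have hz : ∀ x, x ∉ Ioo (-1 : ℝ) 1 → η x = 0 := fun x hx =>
    image_eq_zero_of_notMem_tsupport fun h => hx (hsupp h)
  have hd : ContDiff ℝ ∞ (deriv η) := hη.deriv' 
  have hdiff : ∀ x, HasDerivAt η (deriv η x) x := fun x =>
    (hη.differentiable (by simp)).differentiableAt.hasDerivAt
  have m1 := memLp_top_of_continuous hη.continuous 2
  have m2 := memLp_top_of_continuous hd.continuous 2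
  have hprim : ∀ x ∈ Icc (-1 : ℝ) 1, primitive (m2.toLp _) x = η x := by
    intro x hx
    rw [primitive_eq_intervalIntegral m2.coeFn_toLp hx,
      intervalIntegral.integral_eq_sub_of_hasDerivAt (fun y _ => hdiff y)
        (hd.continuous.intervalIntegrable _ _), hz (-1) (by simp), sub_zero]
  have hK : volterra (m2.toLp _) = m1.toLp η := by
    refine Lp.ext ?_
    filter_upwards [volterra_coeFn (m2.toLp _), m1.coeFn_toLp, ae_restrict_mem measurableSet_Ioo]
      with x h1 h2 h3
    rw [h1, h2, hprim x (Ioo_subset_Icc_self h3)]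
  have hs : inner ℝ (step 1) (m2.toLp _) = 0 := by
    have := hprim 1 (by norm_num)
    rw [hz 1 (by simp)] at this
    exact this
  have key := inner_volterra_add (m2.toLp _) f
  rw [hK, h, inner_smul_right, real_inner_comm, real_inner_comm (step 1), hs] at key
  simp only [mul_zero, add_zero, zero_mul] at key
  rw [real_inner_comm, L2.inner_def] at key
  have hset : ∫ x, η x • f x = ∫ x in Ioo (-1 : ℝ) 1, η x • f x := by
    rw [setIntegral_eq_integral_of_forall_compl_eq_zero]
    intro x hx
    rw [hz x hx, zero_smul]
  rw [hset, ← key]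
  refine integral_congr_ae ?_
  filter_upwards [m1.coeFn_toLp] with x hx
  rw [hx]
  simp [inner, mul_comm]

/-- Regularity of eigenvectors. -/
theorem exists_isEigenfunction {v : ℝ → ℝ} (hv : Continuous v) {lam : ℝ} {f : RealL2}
    (h : f = -volterra (meanZero (volterra (lam • f - mulOp v f)))) :
    ∃ e e' e'' : ℝ → ℝ, IsEigenfunction v lam e e' e'' ∧
      f =ᵐ[volume.restrict (Ioo (-1 : ℝ) 1)] e := by
  set g := lam • f - mulOp v f with hg
  set q := meanZero (volterra g) with hq
  set c := 1 / 2 * inner ℝ (step 1) (volterra g) with hc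
  set e₀ : ℝ → ℝ := fun x => -primitive q x with he₀
  have ce₀ : Continuous e₀ := (continuous_primitive q).neg
  have hf : f =ᵐ[volume.restrict (Ioo (-1 : ℝ) 1)] e₀ := by
    have h1 := Lp.coeFn_neg (volterra q)
    rw [← h] at h1
    filter_upwards [h1, volterra_coeFn q] with x hx1 hx2
    rw [hx1, Pi.neg_apply, hx2]
  set G : ℝ → ℝ := fun x => (lam - v x) * e₀ x with hG
  have cG : Continuous G := by fun_prop
  have hgG : g =ᵐ[volume.restrict (Ioo (-1 : ℝ) 1)] G := by
    filter_upwards [Lp.coeFn_sub (lam • f) (mulOp v f), Lp.coeFn_smul lam f, mulOp_coeFn hv f, hf]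
      with x h1 h2 h3 h4
    rw [h1, Pi.sub_apply, h2, Pi.smul_apply, h3, h4, smul_eq_mul]
    simp only [hG]; ring
  set Q : ℝ → ℝ := fun x => (∫ y in (-1 : ℝ)..x, G y) - c with hQ
  have hQd : ∀ x, HasDerivAt Q (G x) x := fun x =>
    (intervalIntegral.integral_hasDerivAt_right (cG.intervalIntegrable _ _)
      (cG.stronglyMeasurableAtFilter _ _) cG.continuousAt).sub_const c
  have cQ : Continuous Q := continuous_iff_continuousAt.2 fun x => (hQd x).continuousAt
  have hqQ : q =ᵐ[volume.restrict (Ioo (-1 : ℝ) 1)] Q := by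
    rw [hq, meanZero_apply, ← hc]
    filter_upwards [Lp.coeFn_sub (volterra g) (c • step 1), Lp.coeFn_smul c (step 1),
      step_one_coeFn, volterra_coeFn g, ae_restrict_mem measurableSet_Ioo] with x h1 h2 h3 h4 h5
    rw [h1, Pi.sub_apply, h2, Pi.smul_apply, h3, h4,
      primitive_eq_intervalIntegral hgG (Ioo_subset_Icc_self h5)]
    simp [hQ]
  -- Outside `[-1,1]` the function `e₀` is constant, hence in general not `C²` across the endpoints.
  -- Integrating the continuous `Q` gives a `C²` function on `ℝ` equal to `e₀` on `[-1,1]`.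
  set e : ℝ → ℝ := fun x => -∫ y in (-1 : ℝ)..x, Q y with he
  have hee : ∀ x ∈ Icc (-1 : ℝ) 1, e x = e₀ x := fun x hx => by
    simp only [he, he₀]
    rw [primitive_eq_intervalIntegral hqQ hx]
  refine ⟨e, fun x => -Q x, fun x => -G x, ⟨fun x => ?_, fun x => (hQd x).neg, cG.neg, fun x hx => ?_,
    ?_, ?_⟩, ?_⟩
  · exact (intervalIntegral.integral_hasDerivAt_right (cQ.intervalIntegrable _ _)
      (cQ.stronglyMeasurableAtFilter _ _) cQ.continuousAt).neg
  · rw [hee x hx]; simp only [hG]; ring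
  · simp [he]
  · rw [hee 1 (by norm_num)]
    have : primitive q 1 = 0 := inner_step_one_meanZero _
    simp [he₀, this]
  · filter_upwards [hf, ae_restrict_mem measurableSet_Ioo] with x h1 h2
    rw [h1, hee x (Ioo_subset_Icc_self h2)]

/-- A Hilbert basis of `L²(-1,1)` made of Dirichlet eigenfunctions of `-∂ₓ² + V`. -/
theorem exists_dirichlet_eigenbasis {v : ℝ → ℝ} (hv : Continuous v) (h0 : ∀ x, 0 ≤ v x) :
    ∃ (ι : Type) (b : HilbertBasis ι ℝ RealL2) (lam : ι → ℝ) (e e' e'' : ι → ℝ → ℝ),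
      ∀ i, IsEigenfunction v (lam i) (e i) (e' i) (e'' i) ∧
        b i =ᵐ[volume.restrict (Ioo (-1 : ℝ) 1)] e i := by
  obtain ⟨ι, b, lam, hb⟩ := exists_eigenbasis (B := volterra ∘L meanZero) (V := mulOp v)
    (isCompactOperator_volterra.comp_clm meanZero) (inner_mulOp hv) (inner_mulOp_nonneg hv h0)
    (fun x hx => by
      rw [adjoint_volterra_meanZero, neg_eq_zero] at hx
      exact eq_zero_of_meanZero_volterra hx)
  have hb' : ∀ i, b i = -volterra (meanZero (volterra (lam i • b i - mulOp v (b i)))) := by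
    intro i
    have h1 := hb i
    rwa [adjoint_volterra_meanZero, map_neg, ContinuousLinearMap.comp_apply,
      meanZero_meanZero] at h1
  choose e e' e'' he using fun i => exists_isEigenfunction hv (hb' i)
  exact ⟨ι, b, lam, e, e', e'', he⟩

/-! ### Lower bounds for the eigenvalues -/

/-- A barrier `φ` with `c ≤ V - φ' - φ²` bounds the Dirichlet eigenvalues from below by `c`. -/
theorem IsEigenfunction.le_of_barrier {V : ℝ → ℝ} {lam c : ℝ} {e e' e'' φ φ' : ℝ → ℝ}
    (h : IsEigenfunction V lam e e' e'') (hn : ∫ x in (-1 : ℝ)..1, e x ^ 2 = 1)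
    (hφ : ∀ x, HasDerivAt φ (φ' x) x) (cφ' : Continuous φ')
    (hc : ∀ x ∈ Icc (-1 : ℝ) 1, c ≤ V x - φ' x - φ x ^ 2) : c ≤ lam := by
  have c0 := h.continuous
  have c1 := h.continuous_one
  have c2 := h.continuous_two
  have cφ : Continuous φ := continuous_iff_continuousAt.2 fun x => (hφ x).continuousAt
  have h1 : ∫ x in (-1 : ℝ)..1, (e' x * e' x + e x * e'' x
      - (φ' x * e x ^ 2 + φ x * (2 * e x * e' x))) = 0 := by
    rw [intervalIntegral.integral_eq_sub_of_hasDerivAt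
      (f := fun x => e x * e' x - φ x * e x ^ 2) (fun x _ => ?_)
      (Continuous.intervalIntegrable (by fun_prop) _ _), h.left, h.right]
    · ring
    · refine (((h.deriv x).mul (h.deriv_two x)).sub
        ((hφ x).mul ((h.deriv x).pow 2))).congr_deriv ?_
      simp only [Pi.pow_apply]; push_cast; ring
  -- The exact derivative equals `(e' - φ e)² + (V - lam - φ' - φ²) e²`, a square plus a term
  -- bounded below by the barrier condition.
  have h2 : ∫ x in (-1 : ℝ)..1, (c - lam) * e x ^ 2 ≤ ∫ x in (-1 : ℝ)..1,
      (e' x * e' x + e x * e'' x - (φ' x * e x ^ 2 + φ x * (2 * e x * e' x))) := by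
    refine intervalIntegral.integral_mono_on (by norm_num)
      (Continuous.intervalIntegrable (by fun_prop) _ _)
      (Continuous.intervalIntegrable (by fun_prop) _ _) fun x hx => ?_
    rw [h.eqn x hx]
    nlinarith [sq_nonneg (e' x - φ x * e x),
      mul_nonneg (sub_nonneg.2 (hc x hx)) (sq_nonneg (e x))]
  rw [intervalIntegral.integral_const_mul, hn, h1] at h2
  linarith

/-- With `φ = -x/2`, the barrier expression is at least `1/2 - x²/4 ≥ 1/4` on `[-1,1]`. -/
theorem IsEigenfunction.quarter_le {V : ℝ → ℝ} {lam : ℝ} {e e' e'' : ℝ → ℝ}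
    (h : IsEigenfunction V lam e e' e'') (hn : ∫ x in (-1 : ℝ)..1, e x ^ 2 = 1)
    (hV : ∀ x, 0 ≤ V x) : 1 / 4 ≤ lam := by
  refine h.le_of_barrier hn (φ := fun x => -1 / 2 * x) (φ' := fun _ => -1 / 2)
    (fun x => by simpa using (hasDerivAt_id x).const_mul (-1 / 2 : ℝ)) continuous_const
    fun x hx => ?_
  nlinarith [hV x, mul_nonneg (sub_nonneg.2 hx.1) (sub_nonneg.2 hx.2)]

/-- The harmonic oscillator factorization: `φ = ±(p x + q)` satisfies `φ² = V`, leaving the constant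
`∓p`. -/
theorem IsEigenfunction.abs_slope_le {p q lam : ℝ} {e e' e'' : ℝ → ℝ}
    (h : IsEigenfunction (fun x => (p * x + q) ^ 2) lam e e' e'')
    (hn : ∫ x in (-1 : ℝ)..1, e x ^ 2 = 1) : |p| ≤ lam := by
  have hd : ∀ (p q x : ℝ), HasDerivAt (fun x => p * x + q) p x := fun p q x => by
    simpa using ((hasDerivAt_id x).const_mul p).add_const q
  refine abs_le'.2 ⟨h.le_of_barrier hn (hd (-p) (-q)) continuous_const fun x _ => ?_,
    h.le_of_barrier hn (hd p q) continuous_const fun x _ => ?_⟩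
  · apply le_of_eq; ring
  · apply le_of_eq; ring

/-- The zero barrier gives the minimum of the potential, and `|p x + q| ≥ |q| - |p| ≥ |q|/2`. -/
theorem IsEigenfunction.sq_div_four_le {p q lam : ℝ} {e e' e'' : ℝ → ℝ}
    (h : IsEigenfunction (fun x => (p * x + q) ^ 2) lam e e' e'')
    (hn : ∫ x in (-1 : ℝ)..1, e x ^ 2 = 1) (hq : 2 * |p| < |q|) : q ^ 2 / 4 ≤ lam := by
  refine h.le_of_barrier hn (φ := fun _ => 0) (φ' := fun _ => 0)
    (fun x => hasDerivAt_const x 0) continuous_const fun x hx => ?_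
  have h1 : |p * x| ≤ |p| := by
    rw [abs_mul]; exact mul_le_of_le_one_right (abs_nonneg p) (abs_le.2 hx)
  have h2 : |q| / 2 ≤ |p * x + q| := by
    have := abs_sub_abs_le_abs_sub q (-(p * x))
    rw [abs_neg, sub_neg_eq_add, add_comm q] at this
    linarith
  have h3 := pow_le_pow_left₀ (by positivity) h2 2
  rw [sq_abs, div_pow, sq_abs] at h3
  linarith

/-! ### From finite sums to perturbed trajectories in a Hilbert space -/

theorem norm_sq_add_three_le {E : Type*} [SeminormedAddCommGroup E] (x y z : E) :
    ‖x + y + z‖ ^ 2 ≤ 3 * ‖x‖ ^ 2 + 3 * ‖y‖ ^ 2 + 3 * ‖z‖ ^ 2 := by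
  have h := pow_le_pow_left₀ (norm_nonneg _) (norm_add₃_le (a := x) (b := y) (c := z)) 2
  nlinarith [sq_nonneg (‖x‖ - ‖y‖), sq_nonneg (‖y‖ - ‖z‖), sq_nonneg (‖x‖ - ‖z‖)]

section Hilbert

variable {ι E E' : Type*} [NormedAddCommGroup E] [InnerProductSpace ℝ E]
  [NormedAddCommGroup E'] [NormedSpace ℝ E']

theorem norm_sq_sum_smul (b : HilbertBasis ι ℝ E) (F : Finset ι) (c : ι → ℝ) :
    ‖∑ i ∈ F, c i • b i‖ ^ 2 = ∑ i ∈ F, c i ^ 2 := by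
  rw [← real_inner_self_eq_norm_sq, b.orthonormal.inner_sum]
  exact Finset.sum_congr rfl fun i _ => by simp [sq]

theorem norm_sq_sub_sum (b : HilbertBasis ι ℝ E) (F : Finset ι) (x : E) :
    ‖x - ∑ i ∈ F, inner ℝ (b i) x • b i‖ ^ 2 = ‖x‖ ^ 2 - ∑ i ∈ F, inner ℝ (b i) x ^ 2 := by
  rw [norm_sub_sq_real, norm_sq_sum_smul, inner_sum]
  have : ∑ i ∈ F, inner ℝ x (inner ℝ (b i) x • b i) = ∑ i ∈ F, inner ℝ (b i) x ^ 2 :=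
    Finset.sum_congr rfl fun i _ => by
      rw [inner_smul_right, real_inner_comm]; ring
  rw [this]; ring

theorem hasSum_inner_sq (b : HilbertBasis ι ℝ E) (x : E) :
    HasSum (fun i => inner ℝ (b i) x ^ 2) (‖x‖ ^ 2) := by
  have h := b.hasSum_inner_mul_inner x x
  rw [real_inner_self_eq_norm_sq] at h
  refine h.congr_fun ?_ |> id
  intro i
  rw [real_inner_comm]; ring

/-- The tails of the expansion are uniformly small along a continuous trajectory. -/
theorem exists_tail_le (b : HilbertBasis ι ℝ E) {G : ℝ → E} {s : Set ℝ} (hs : IsCompact s)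
    (hG : ContinuousOn G s) {δ : ℝ} (hδ : 0 < δ) :
    ∃ F₀ : Finset ι, ∀ F, F₀ ⊆ F → ∀ t ∈ s,
      ‖G t‖ ^ 2 - ∑ i ∈ F, inner ℝ (b i) (G t) ^ 2 ≤ δ := by
  -- Dini's theorem: the partial sums increase to a continuous limit on a compact set.
  have h := Monotone.tendstoUniformlyOn_of_forall_tendsto hs
    (F := fun (F : Finset ι) t => ∑ i ∈ F, inner ℝ (b i) (G t) ^ 2) (f := fun t => ‖G t‖ ^ 2)
    (fun F => by fun_prop) (fun t _ F F' hF => Finset.sum_le_sum_of_subset_of_nonneg hF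
      fun i _ _ => sq_nonneg _) (by fun_prop) (fun t _ => hasSum_inner_sq b (G t))
  obtain ⟨F₀, hF₀⟩ := Filter.eventually_atTop.1 (Metric.tendstoUniformlyOn_iff.1 h δ hδ)
  refine ⟨F₀, fun F hF t ht => ?_⟩
  have := hF₀ F hF t ht
  rw [Real.dist_eq] at this
  exact (le_abs_self _).trans this.le

/-- Observability is applied to the free evolution of finitely many modes, which is then compared
with `G` in two steps: the tail of `G`, uniformly small once the finite set is enlarged, and the
deviation of the retained coefficients, bounded by `N`. -/
theorem sum_sq_le_of_observability (b : HilbertBasis ι ℝ E) {R : E →L[ℝ] E'} (hR : ‖R‖ ≤ 1)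
    {lam : ι → ℝ} {τ K N : ℝ} (hτ : 0 < τ) (hK : 0 ≤ K)
    (hobs : ∀ (F : Finset ι) (c : ι → ℝ), ∑ i ∈ F, (Real.exp (-lam i * τ) * c i) ^ 2 ≤
      K * ∫ t in (0 : ℝ)..τ, ‖R (∑ i ∈ F, (Real.exp (-lam i * t) * c i) • b i)‖ ^ 2)
    {G : ℝ → E} (hG : ContinuousOn G (Icc 0 τ))
    (hd : ∀ t ∈ Icc 0 τ, ∀ F : Finset ι, ∑ i ∈ F,
      (inner ℝ (b i) (G t) - Real.exp (-lam i * t) * inner ℝ (b i) (G 0)) ^ 2 ≤ N)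
    (F : Finset ι) :
    ∑ i ∈ F, (Real.exp (-lam i * τ) * inner ℝ (b i) (G 0)) ^ 2 ≤
      K * (3 * (∫ t in (0 : ℝ)..τ, ‖R (G t)‖ ^ 2) + 3 * τ * N) := by
  classical
  have hRle : ∀ x, ‖R x‖ ^ 2 ≤ ‖x‖ ^ 2 := fun x =>
    pow_le_pow_left₀ (norm_nonneg _) ((R.le_opNorm x).trans
      (mul_le_of_le_one_left (norm_nonneg x) hR)) 2
  have key : ∀ δ > 0, ∑ i ∈ F, (Real.exp (-lam i * τ) * inner ℝ (b i) (G 0)) ^ 2 ≤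
      K * (3 * (∫ t in (0 : ℝ)..τ, ‖R (G t)‖ ^ 2) + 3 * τ * N) + K * (3 * τ) * δ := by
    intro δ hδ
    obtain ⟨F₀, hF₀⟩ := exists_tail_le b isCompact_Icc hG hδ
    have h1 : ∑ i ∈ F, (Real.exp (-lam i * τ) * inner ℝ (b i) (G 0)) ^ 2 ≤
        ∑ i ∈ F ∪ F₀, (Real.exp (-lam i * τ) * inner ℝ (b i) (G 0)) ^ 2 :=
      Finset.sum_le_sum_of_subset_of_nonneg Finset.subset_union_left fun _ _ _ => sq_nonneg _
    refine h1.trans ((hobs (F ∪ F₀) fun i => inner ℝ (b i) (G 0)).trans ?_)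
    have hcont : ContinuousOn (fun t => ‖R (G t)‖ ^ 2) (uIcc 0 τ) := by
      rw [uIcc_of_le hτ.le]; exact (R.continuous.comp_continuousOn hG).norm.pow 2
    have h2 : ∫ t in (0 : ℝ)..τ,
        ‖R (∑ i ∈ F ∪ F₀, (Real.exp (-lam i * t) * inner ℝ (b i) (G 0)) • b i)‖ ^ 2 ≤
        ∫ t in (0 : ℝ)..τ, (3 * ‖R (G t)‖ ^ 2 + (3 * δ + 3 * N)) := by
      refine intervalIntegral.integral_mono_on hτ.le
        (Continuous.intervalIntegrable (by fun_prop) _ _)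
        ((hcont.intervalIntegrable.const_mul 3).add (by simp)) fun t ht => ?_
      set U := ∑ i ∈ F ∪ F₀, (Real.exp (-lam i * t) * inner ℝ (b i) (G 0)) • b i with hU
      set Q := ∑ i ∈ F ∪ F₀, inner ℝ (b i) (G t) • b i with hQ
      have e1 : U = G t + -(G t - Q) + -(Q - U) := by abel
      have e2 : ‖Q - U‖ ^ 2 ≤ N := by
        have : Q - U = ∑ i ∈ F ∪ F₀,
            (inner ℝ (b i) (G t) - Real.exp (-lam i * t) * inner ℝ (b i) (G 0)) • b i := by
          rw [hU, hQ, ← Finset.sum_sub_distrib]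
          exact Finset.sum_congr rfl fun i _ => (sub_smul _ _ _).symm
        rw [this, norm_sq_sum_smul]
        exact hd t ht _
      have e3 : ‖G t - Q‖ ^ 2 ≤ δ := by
        rw [norm_sq_sub_sum]; exact hF₀ _ Finset.subset_union_right t ht
      rw [e1, map_add, map_add]
      refine (norm_sq_add_three_le _ _ _).trans ?_
      have e4 := hRle (-(G t - Q))
      have e5 := hRle (-(Q - U))
      rw [norm_neg] at e4 e5
      linarith
    rw [intervalIntegral.integral_add (hcont.intervalIntegrable.const_mul 3) (by simp),
      intervalIntegral.integral_const_mul, intervalIntegral.integral_const, smul_eq_mul] at h2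
    refine (mul_le_mul_of_nonneg_left h2 hK).trans (le_of_eq ?_)
    ring
  refine le_of_forall_pos_le_add fun η hη => ?_
  -- The added `1` keeps the denominator positive when `K = 0`.
  refine (key (η / (K * (3 * τ) + 1)) (by positivity)).trans ?_
  have : K * (3 * τ) * (η / (K * (3 * τ) + 1)) ≤ η := by
    rw [mul_div_assoc', div_le_iff₀ (by positivity)]
    nlinarith
  linarith

/-- Only `[0,τ]` is used for observation; the time left before `T` supplies the decay `exp (-Λ T)`.
The coefficients at `T` are split into free decay and deviation. -/
theorem norm_sq_le_of_observability (b : HilbertBasis ι ℝ E) {R : E →L[ℝ] E'} (hR : ‖R‖ ≤ 1)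
    {lam : ι → ℝ} {Λ τ T K N : ℝ} (hΛ : 0 < Λ) (hlam : ∀ i, Λ ≤ lam i) (hτ : 0 < τ)
    (hτ1 : τ ≤ 1 / 2) (hτT : 2 * τ ≤ T) (hK : 0 ≤ K) (hN : 0 ≤ N)
    (hobs : ∀ (F : Finset ι) (c : ι → ℝ), ∑ i ∈ F, (Real.exp (-lam i * τ) * c i) ^ 2 ≤
      K * ∫ t in (0 : ℝ)..τ, ‖R (∑ i ∈ F, (Real.exp (-lam i * t) * c i) • b i)‖ ^ 2)
    {G : ℝ → E} (hG : ContinuousOn G (Icc 0 T))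
    (hd : ∀ t ∈ Icc 0 T, ∀ F : Finset ι, ∑ i ∈ F,
      (inner ℝ (b i) (G t) - Real.exp (-lam i * t) * inner ℝ (b i) (G 0)) ^ 2 ≤ N / (2 * Λ)) :
    ‖G T‖ ^ 2 ≤ 6 * (K * Real.exp (-(Λ * T))) * (∫ t in (0 : ℝ)..T, ‖R (G t)‖ ^ 2)
      + (1 + 2 * (K * Real.exp (-(Λ * T)))) / Λ * N := by
  have hT : 0 < T := by linarith
  have hsub : Icc 0 τ ⊆ Icc 0 T := Icc_subset_Icc_right (by linarith)
  have h1 := sum_sq_le_of_observability b hR hτ hK hobs (hG.mono hsub)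
    (fun t ht F => hd t (hsub ht) F)
  have hcont : ContinuousOn (fun t => ‖R (G t)‖ ^ 2) (Icc 0 T) :=
    (R.continuous.comp_continuousOn hG).norm.pow 2
  have h2 : ∫ t in (0 : ℝ)..τ, ‖R (G t)‖ ^ 2 ≤ ∫ t in (0 : ℝ)..T, ‖R (G t)‖ ^ 2 := by
    refine intervalIntegral.integral_mono_interval le_rfl hτ.le (by linarith)
      (Filter.Eventually.of_forall fun _ => by positivity)
      (ContinuousOn.intervalIntegrable (by rwa [uIcc_of_le hT.le]))
  refine (hasSum_inner_sq b (G T)).summable.tsum_le_of_sum_le (fun F => ?_) |>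
    (hasSum_inner_sq b (G T)).tsum_eq.symm.le.trans
  set c : ι → ℝ := fun i => inner ℝ (b i) (G 0)
  have h3 : ∑ i ∈ F, inner ℝ (b i) (G T) ^ 2 ≤
      2 * (Real.exp (-(Λ * T)) * ∑ i ∈ F, (Real.exp (-lam i * τ) * c i) ^ 2)
      + 2 * ∑ i ∈ F, (inner ℝ (b i) (G T) - Real.exp (-lam i * T) * c i) ^ 2 := by
    rw [Finset.mul_sum, Finset.mul_sum, Finset.mul_sum, ← Finset.sum_add_distrib]
    refine Finset.sum_le_sum fun i _ => ?_
    -- From `2τ ≤ T` follows `2 lam (T - τ) ≥ lam T ≥ Λ T`.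
    have e1 : Real.exp (-lam i * T) ^ 2 ≤ Real.exp (-(Λ * T)) * Real.exp (-lam i * τ) ^ 2 := by
      rw [← Real.exp_nat_mul, ← Real.exp_nat_mul, ← Real.exp_add]
      refine Real.exp_le_exp.2 ?_
      push_cast
      nlinarith [mul_le_mul_of_nonneg_right (hlam i) hT.le,
        mul_le_mul_of_nonneg_left hτT (hΛ.le.trans (hlam i))]
    have e2 := mul_le_mul_of_nonneg_right e1 (sq_nonneg (c i))
    nlinarith [sq_nonneg (inner ℝ (b i) (G T) - 2 * (Real.exp (-lam i * T) * c i))]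
  refine h3.trans ?_
  have h4 := h1 F
  have h5 := hd T ⟨hT.le, le_rfl⟩ F
  have hE := Real.exp_pos (-(Λ * T))
  set J := ∫ t in (0 : ℝ)..T, ‖R (G t)‖ ^ 2
  have h6 : K * (3 * (∫ t in (0 : ℝ)..τ, ‖R (G t)‖ ^ 2) + 3 * τ * (N / (2 * Λ))) ≤
      K * (3 * J + N / Λ) := by
    refine mul_le_mul_of_nonneg_left (add_le_add (by linarith) ?_) hK
    have : 3 * τ * (N / (2 * Λ)) = (3 / 2 * τ) * (N / Λ) := by field_simp
    rw [this]
    exact mul_le_of_le_one_left (by positivity) (by linarith)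
  have h7 := mul_le_mul_of_nonneg_left (h4.trans h6) hE.le
  have h8 : 2 * (N / (2 * Λ)) = N / Λ := by field_simp
  have h9 : (1 + 2 * (K * Real.exp (-(Λ * T)))) / Λ * N
    = N / Λ + 2 * (Real.exp (-(Λ * T)) * (K * (N / Λ))) := by field_simp
  rw [h9]
  linarith

end Hilbert

/-! ### Duhamel estimate for one mode -/

theorem absolutelyContinuousOnInterval_clm_comp {X Y : Type*} [NormedAddCommGroup X]
    [NormedSpace ℝ X] [NormedAddCommGroup Y] [NormedSpace ℝ Y] (L : X →L[ℝ] Y) {f : ℝ → X}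
    {a b : ℝ} (hf : AbsolutelyContinuousOnInterval f a b) :
    AbsolutelyContinuousOnInterval (fun x => L (f x)) a b := by
  apply squeeze_zero (fun t => ?_) (fun t => ?_) (by simpa using Filter.Tendsto.const_mul ‖L‖ hf)
  · exact Finset.sum_nonneg fun i _ => dist_nonneg
  · rw [Finset.mul_sum]
    exact Finset.sum_le_sum fun i _ => L.lipschitz.dist_le_mul _ _

theorem integral_exp_sub_sq_le {lam t : ℝ} (hlam : 0 < lam) :
    ∫ r in (0 : ℝ)..t, Real.exp (lam * (r - t)) ^ 2 ≤ 1 / (2 * lam) := by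
  have h : ∀ r ∈ uIcc 0 t, HasDerivAt (fun r => Real.exp (lam * (r - t)) ^ 2 / (2 * lam))
      (Real.exp (lam * (r - t)) ^ 2) r := fun r _ => by
    have h1 : HasDerivAt (fun r => lam * (r - t)) lam r := by
      simpa using ((hasDerivAt_id r).sub_const t).const_mul lam
    refine ((h1.exp.pow 2).div_const (2 * lam)).congr_deriv ?_
    field_simp
    simp [mul_comm]
  rw [intervalIntegral.integral_eq_sub_of_hasDerivAt h
    (Continuous.intervalIntegrable (by fun_prop) _ _)]
  have : 0 ≤ Real.exp (lam * (0 - t)) ^ 2 / (2 * lam) := by positivity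
  simp only [sub_self, mul_zero, Real.exp_zero, one_pow] at *
  linarith

/-- Cauchy–Schwarz, obtained by expanding `∫ (s E - h)² ≥ 0` for the exponential `E` with `s = 2 lam
B`, the minimizer once `∫ E²` is replaced by its bound `1 / (2 lam)`. -/
theorem sq_integral_exp_mul_le {lam t : ℝ} {h : ℝ → ℝ} (hlam : 0 < lam) (ht : 0 ≤ t)
    (h1 : IntervalIntegrable h volume 0 t)
    (h2 : IntervalIntegrable (fun r => h r ^ 2) volume 0 t) :
    (∫ r in (0 : ℝ)..t, Real.exp (lam * (r - t)) * h r) ^ 2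
      ≤ 1 / (2 * lam) * ∫ r in (0 : ℝ)..t, h r ^ 2 := by
  set B := ∫ r in (0 : ℝ)..t, Real.exp (lam * (r - t)) * h r with hB
  set s := 2 * lam * B with hs
  have i1 : IntervalIntegrable (fun r => Real.exp (lam * (r - t)) * h r) volume 0 t :=
    h1.continuousOn_mul (by fun_prop)
  have i2 : IntervalIntegrable (fun r => Real.exp (lam * (r - t)) ^ 2) volume 0 t :=
    Continuous.intervalIntegrable (by fun_prop) _ _
  have h3 : 0 ≤ ∫ r in (0 : ℝ)..t, (s ^ 2 * Real.exp (lam * (r - t)) ^ 2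
      - 2 * s * (Real.exp (lam * (r - t)) * h r) + h r ^ 2) :=
    intervalIntegral.integral_nonneg ht fun r _ => by
      nlinarith [sq_nonneg (s * Real.exp (lam * (r - t)) - h r)]
  rw [intervalIntegral.integral_add ((i2.const_mul _).sub (i1.const_mul _)) h2,
    intervalIntegral.integral_sub (i2.const_mul _) (i1.const_mul _),
    intervalIntegral.integral_const_mul, intervalIntegral.integral_const_mul, ← hB] at h3
  have h4 := mul_le_mul_of_nonneg_left (integral_exp_sub_sq_le (t := t) hlam) (sq_nonneg s)
  have h5 : s ^ 2 * (1 / (2 * lam)) = 2 * lam * B ^ 2 := by rw [hs]; field_simp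
  have h6 : 2 * s * B = 4 * lam * B ^ 2 := by rw [hs]; ring
  rw [h6] at h3
  rw [h5] at h4
  rw [one_div, inv_mul_eq_div, le_div_iff₀ (by positivity)]
  linarith

/-- Duhamel's formula followed by Cauchy–Schwarz. The difference of `exp (lam t) c(t)` and `∫₀ᵗ exp
(lam r) h(r) dr` has derivative zero almost everywhere; absolute continuity makes it constant. -/
theorem sq_sub_exp_mul_le {lam T : ℝ} {c h : ℝ → ℝ} (hlam : 0 < lam) (hT : 0 < T)
    (hc : AbsolutelyContinuousOnInterval c 0 T) (h1 : IntervalIntegrable h volume 0 T)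
    (h2 : IntervalIntegrable (fun r => h r ^ 2) volume 0 T)
    (hd : ∀ᵐ t ∂(volume.restrict (Ioo 0 T)), HasDerivAt c (h t - lam * c t) t)
    {t : ℝ} (ht : t ∈ Icc 0 T) :
    (c t - Real.exp (-lam * t) * c 0) ^ 2 ≤ 1 / (2 * lam) * ∫ r in (0 : ℝ)..T, h r ^ 2 := by
  have hE : ∀ t, HasDerivAt (fun t => Real.exp (lam * t)) (Real.exp (lam * t) * lam) t := fun t =>
    HasDerivAt.exp (by simpa using (hasDerivAt_id t).const_mul lam)
  have i1 : IntervalIntegrable (fun r => Real.exp (lam * r) * h r) volume 0 T :=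
    h1.continuousOn_mul (by fun_prop)
  have hac : AbsolutelyContinuousOnInterval
      ((fun t => Real.exp (lam * t)) * c - fun t => ∫ r in (0 : ℝ)..t, Real.exp (lam * r) * h r)
      0 T := by
    refine AbsolutelyContinuousOnInterval.sub (AbsolutelyContinuousOnInterval.mul ?_ hc)
      (i1.absolutelyContinuousOnInterval_intervalIntegral left_mem_uIcc)
    exact ContDiffOn.absolutelyContinuousOnInterval (ContDiff.contDiffOn (by fun_prop))
  rw [ae_restrict_iff' measurableSet_Ioo] at hd
  obtain ⟨C, hC⟩ := hac.const_of_ae_hasDerivAt_zero (by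
    have n0 : ∀ᵐ t : ℝ, t ≠ 0 := by simp [ae_iff, measure_singleton]
    have nT : ∀ᵐ t : ℝ, t ≠ T := by simp [ae_iff, measure_singleton]
    filter_upwards [hd, i1.ae_hasDerivAt_integral, n0, nT] with t ht1 ht2 ht3 ht4 ht5
    have ht6 := ht5
    rw [uIcc_of_le hT.le] at ht6
    refine (((hE t).mul (ht1 ⟨lt_of_le_of_ne ht6.1 ht3.symm, lt_of_le_of_ne ht6.2 ht4⟩)).sub
      (ht2 ht5 0 left_mem_uIcc)).congr_deriv ?_
    ring)
  have e1 := hC t (by rwa [uIcc_of_le hT.le])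
  have e2 := hC 0 left_mem_uIcc
  simp only [Pi.sub_apply, Pi.mul_apply, intervalIntegral.integral_same, mul_zero, Real.exp_zero,
    one_mul, sub_zero] at e1 e2
  have e3 : c t - Real.exp (-lam * t) * c 0
      = ∫ r in (0 : ℝ)..t, Real.exp (lam * (r - t)) * h r := by
    have e4 : ∀ r, Real.exp (lam * (r - t)) * h r
        = Real.exp (-lam * t) * (Real.exp (lam * r) * h r) := fun r => by
      rw [← mul_assoc, ← Real.exp_add]; ring_nf
    simp_rw [e4]
    rw [intervalIntegral.integral_const_mul]
    have e5 : ∫ r in (0 : ℝ)..t, Real.exp (lam * r) * h r = Real.exp (lam * t) * c t - c 0 := by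
      linarith
    rw [e5, mul_sub, ← mul_assoc, ← Real.exp_add]
    simp
  have hsub : uIcc 0 t ⊆ uIcc 0 T := by
    rw [uIcc_of_le hT.le, uIcc_of_le ht.1]; exact Icc_subset_Icc_right ht.2
  rw [e3]
  refine (sq_integral_exp_mul_le hlam ht.1 (h1.mono_set hsub) (h2.mono_set hsub)).trans ?_
  refine mul_le_mul_of_nonneg_left ?_ (by positivity)
  exact intervalIntegral.integral_mono_interval le_rfl ht.1 ht.2
    (Filter.Eventually.of_forall fun _ => sq_nonneg _) h2

/-! ### Eigenfunctions as test functions -/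

theorem inL2_ofReal {u : ℝ → ℝ} (hu : Continuous u) : InL2 fun x => (u x : ℂ) :=
  (memLp_top_of_continuous hu 2).ofReal

theorem isWeakDeriv_ofReal {u u' : ℝ → ℝ} (hu : ∀ x, HasDerivAt u (u' x) x)
    (cu' : Continuous u') : IsWeakDeriv (fun x => (u x : ℂ)) fun x => (u' x : ℂ) := by
  intro η hη _ hsupp
  have hz : ∀ x, x ∉ Ioo (-1 : ℝ) 1 → η x = 0 := fun x hx =>
    image_eq_zero_of_notMem_tsupport fun h => hx (hsupp h)
  have hd : Continuous (deriv η) := hη.continuous_deriv (by simp)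
  have cu : Continuous u := continuous_iff_continuousAt.2 fun x => (hu x).continuousAt
  have h1 := intervalIntegral.integral_deriv_mul_eq_sub (a := (-1 : ℝ)) (b := 1)
    (u := η) (u' := deriv η)
    (fun x _ => (hη.differentiable (by simp)).differentiableAt.hasDerivAt) (fun x _ => hu x)
    (hd.intervalIntegrable _ _) (cu'.intervalIntegrable _ _)
  have i1 : IntervalIntegrable (fun x => deriv η x * u x) volume (-1) 1 :=
    (hd.mul cu).intervalIntegrable _ _
  have i2 : IntervalIntegrable (fun x => η x * u' x) volume (-1) 1 :=
    (hη.continuous.mul cu').intervalIntegrable _ _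
  rw [hz 1 (by simp), hz (-1) (by simp), intervalIntegral.integral_add i1 i2] at h1
  simp only [Complex.real_smul, ← Complex.ofReal_mul, intervalIntegral.integral_ofReal]
  rw [← Complex.ofReal_neg, Complex.ofReal_inj]
  linarith

theorem IsEigenfunction.inDomain {V : ℝ → ℝ} {lam : ℝ} {e e' e'' : ℝ → ℝ}
    (h : IsEigenfunction V lam e e' e'') :
    InDomain (fun x => (e x : ℂ)) (fun x => (e' x : ℂ)) (fun x => (e'' x : ℂ)) where
  continuousOn := (Complex.continuous_ofReal.comp h.continuous).continuousOn
  left := by simp [h.left]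
  right := by simp [h.right]
  inL2_deriv := inL2_ofReal h.continuous_one
  inL2_deriv_two := inL2_ofReal h.continuous_two
  weakDeriv := isWeakDeriv_ofReal h.deriv h.continuous_one
  weakDeriv_two := isWeakDeriv_ofReal h.deriv_two h.continuous_two

theorem IsSolution.hasDerivAt_coeff {T p lam : ℝ} {n : ℤ} {g₀ : L2} {h : ℝ → ℝ → ℂ}
    {g : ℝ → L2} (hg : IsSolution T p n g₀ h g) {e e' e'' : ℝ → ℝ}
    (he : IsEigenfunction (fun x => (p * x + n) ^ 2) lam e e' e'') :
    ∀ᵐ t ∂(volume.restrict (Ioo (0 : ℝ) T)),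
      HasDerivAt (fun s => ∫ x in (-1 : ℝ)..1, g s x * (e x : ℂ))
        ((∫ x in (-1 : ℝ)..1, h t x * (e x : ℂ))
          - (lam : ℂ) * ∫ x in (-1 : ℝ)..1, g t x * (e x : ℂ)) t := by
  filter_upwards [hg.equation _ _ _ he.inDomain] with t ht
  refine ht.congr_deriv ?_
  rw [← intervalIntegral.integral_const_mul]
  congr 1
  refine intervalIntegral.integral_congr fun x hx => ?_
  rw [uIcc_of_le (by norm_num)] at hx
  simp only [he.eqn x hx]
  push_cast
  ring

/-! ### Coefficients of real and imaginary parts -/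

/-- The eigenfunctions are real, so a real-linear functional on `ℂ` commutes with taking
coefficients. Real and imaginary parts of a solution can thus be treated in the real `L²` space. -/
theorem inner_toLp_eq {e : ℝ → ℝ} {b : RealL2} (hb : b =ᵐ[volume.restrict (Ioo (-1 : ℝ) 1)] e)
    (he : Continuous e) (L : ℂ →L[ℝ] ℝ) {f : ℝ → ℂ} (hf : InL2 f) {k : RealL2}
    (hk : k =ᵐ[volume.restrict (Ioo (-1 : ℝ) 1)] fun x => L (f x)) :
    inner ℝ b k = L (∫ x in (-1 : ℝ)..1, f x * (e x : ℂ)) := by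
  have hi : Integrable (fun x => f x * (e x : ℂ)) (volume.restrict (Ioo (-1 : ℝ) 1)) :=
    hf.integrable_mul (inL2_ofReal he)
  rw [intervalIntegral.integral_of_le (by norm_num), integral_Ioc_eq_integral_Ioo,
    ← L.integral_comp_comm hi, L2.inner_def]
  refine integral_congr_ae ?_
  filter_upwards [hb, hk] with x h1 h2
  rw [h1, h2, mul_comm, ← Complex.real_smul, map_smul]
  simp [inner, mul_comm]

theorem norm_sq_toLp_eq {k : RealL2} {u : ℝ → ℝ}
    (hk : k =ᵐ[volume.restrict (Ioo (-1 : ℝ) 1)] u) :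
    ‖k‖ ^ 2 = ∫ x in (-1 : ℝ)..1, u x ^ 2 := by
  rw [← real_inner_self_eq_norm_sq, L2.inner_def, intervalIntegral.integral_of_le (by norm_num),
    integral_Ioc_eq_integral_Ioo]
  refine integral_congr_ae ?_
  filter_upwards [hk] with x h1
  rw [h1]
  simp [inner, sq]

theorem sum_sq_coeff_le {ι : Type*} (b : HilbertBasis ι ℝ RealL2) {e : ι → ℝ → ℝ}
    (hb : ∀ i, b i =ᵐ[volume.restrict (Ioo (-1 : ℝ) 1)] e i) (he : ∀ i, Continuous (e i))
    {L : ℂ →L[ℝ] ℝ} (hL : ∀ z, |L z| ≤ ‖z‖) {f : ℝ → ℂ} (hf : InL2 f) (F : Finset ι) :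
    ∑ i ∈ F, L (∫ x in (-1 : ℝ)..1, f x * (e i x : ℂ)) ^ 2 ≤ ∫ x in (-1 : ℝ)..1, ‖f x‖ ^ 2 := by
  have hm : MemLp (fun x => L (f x)) 2 (volume.restrict (Ioo (-1 : ℝ) 1)) := L.comp_memLp' hf
  have h1 := sum_le_hasSum F (fun i _ => sq_nonneg _) (hasSum_inner_sq b (hm.toLp _))
  simp_rw [fun i => inner_toLp_eq (hb i) (he i) L hf hm.coeFn_toLp] at h1
  refine h1.trans ?_
  rw [norm_sq_toLp_eq hm.coeFn_toLp]
  have i1 := hm.integrable_sq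
  have i2 := hf.integrable_norm_pow (by norm_num)
  rw [intervalIntegral.integral_of_le (by norm_num), intervalIntegral.integral_of_le (by norm_num),
    integral_Ioc_eq_integral_Ioo, integral_Ioc_eq_integral_Ioo]
  refine integral_mono i1 (by simpa using i2) fun x => ?_
  simpa only [sq_abs] using pow_le_pow_left₀ (abs_nonneg _) (hL (f x)) 2

/-! ### Slices of the source term -/

theorem intervalIntegral_eq_integral_Icc {E : Type*} [NormedAddCommGroup E] [NormedSpace ℝ E]
    {a b : ℝ} (hab : a ≤ b) (f : ℝ → E) :
    ∫ x in a..b, f x = ∫ x, f x ∂(volume.restrict (Icc a b)) := by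
  rw [intervalIntegral.integral_of_le hab, integral_Icc_eq_integral_Ioc]

theorem intervalIntegrable_of_integrable_Icc {E : Type*} [NormedAddCommGroup E]
    {a b : ℝ} (hab : a ≤ b) {f : ℝ → E} (hf : Integrable f (volume.restrict (Icc a b))) :
    IntervalIntegrable f volume a b :=
  (intervalIntegrable_iff_integrableOn_Icc_of_le hab).2 hf

theorem IsSource.integrable_sq {T : ℝ} {h : ℝ → ℝ → ℂ} (hh : IsSource T h) :
    Integrable (fun z : ℝ × ℝ => ‖h z.1 z.2‖ ^ 2)
      ((volume.restrict (Icc (0 : ℝ) T)).prod (volume.restrict (Icc (-1 : ℝ) 1))) := by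
  simpa [Function.uncurry_def] using MemLp.integrable_norm_pow hh (by norm_num)

theorem IsSource.ae_inL2 {T : ℝ} {h : ℝ → ℝ → ℂ} (hh : IsSource T h) :
    ∀ᵐ t ∂(volume.restrict (Icc (0 : ℝ) T)), InL2 (h t) := by
  filter_upwards [hh.integrable_sq.prod_right_ae, hh.aestronglyMeasurable.prodMk_left] with t h1 h2
  have h3 : MemLp (h t) 2 (volume.restrict (Icc (-1 : ℝ) 1)) :=
    (memLp_two_iff_integrable_sq_norm h2).2 h1
  exact h3.mono_measure (Measure.restrict_mono Ioo_subset_Icc_self le_rfl)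

theorem IsSource.intervalIntegrable_sq {T : ℝ} (hT : 0 ≤ T) {h : ℝ → ℝ → ℂ} (hh : IsSource T h) :
    IntervalIntegrable (fun t => ∫ x in (-1 : ℝ)..1, ‖h t x‖ ^ 2) volume 0 T := by
  simp_rw [intervalIntegral_eq_integral_Icc (show (-1 : ℝ) ≤ 1 by norm_num)]
  exact intervalIntegrable_of_integrable_Icc hT hh.integrable_sq.integral_prod_left

theorem IsSource.intervalIntegrable_coeff {T : ℝ} (hT : 0 ≤ T) {h : ℝ → ℝ → ℂ}
    (hh : IsSource T h) {e : ℝ → ℝ} (he : Continuous e) :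
    IntervalIntegrable (fun t => ∫ x in (-1 : ℝ)..1, h t x * (e x : ℂ)) volume 0 T := by
  simp_rw [intervalIntegral_eq_integral_Icc (show (-1 : ℝ) ≤ 1 by norm_num)]
  refine intervalIntegrable_of_integrable_Icc hT (Integrable.integral_prod_left
    (f := fun z : ℝ × ℝ => h z.1 z.2 * (e z.2 : ℂ)) ?_)
  have h1 : Integrable (Function.uncurry h)
      ((volume.restrict (Icc (0 : ℝ) T)).prod (volume.restrict (Icc (-1 : ℝ) 1))) :=
    MemLp.integrable (by norm_num) hh
  obtain ⟨C, hC⟩ := isCompact_Icc.exists_bound_of_continuousOn (s := Icc (-1 : ℝ) 1) he.continuousOn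
  refine h1.mul_bdd (c := C) ?_ ?_
  · exact Continuous.aestronglyMeasurable (by fun_prop)
  · have h2 : ∀ᵐ x ∂(volume.restrict (Icc (-1 : ℝ) 1)), ‖(e x : ℂ)‖ ≤ C := by
      filter_upwards [ae_restrict_mem measurableSet_Icc] with x hx
      simpa using hC x hx
    exact (Measure.quasiMeasurePreserving_snd (μ := volume.restrict (Icc (0 : ℝ) T))).ae h2

/-- Bessel's inequality for the single index `i` dominates the squared coefficient by the integrable
function `t ↦ ∫ ‖h t x‖² dx`. -/
theorem IsSource.intervalIntegrable_coeff_sq {ι : Type*} (b : HilbertBasis ι ℝ RealL2)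
    {e : ι → ℝ → ℝ} (hb : ∀ i, b i =ᵐ[volume.restrict (Ioo (-1 : ℝ) 1)] e i)
    (he : ∀ i, Continuous (e i)) {L : ℂ →L[ℝ] ℝ} (hL : ∀ z, |L z| ≤ ‖z‖) {T : ℝ} (hT : 0 ≤ T)
    {h : ℝ → ℝ → ℂ} (hh : IsSource T h) (i : ι) :
    IntervalIntegrable (fun t => L (∫ x in (-1 : ℝ)..1, h t x * (e i x : ℂ)) ^ 2) volume 0 T := by
  have h1 := hh.intervalIntegrable_coeff hT (he i)
  rw [intervalIntegrable_iff_integrableOn_Icc_of_le hT] at h1 ⊢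
  have h2 := hh.intervalIntegrable_sq hT
  rw [intervalIntegrable_iff_integrableOn_Icc_of_le hT] at h2
  refine Integrable.mono' h2 ((L.continuous.comp_aestronglyMeasurable
    h1.aestronglyMeasurable).pow 2) ?_
  filter_upwards [hh.ae_inL2] with t ht
  rw [Real.norm_of_nonneg (sq_nonneg _)]
  simpa using sum_sq_coeff_le b hb he hL ht {i}

/-! ### Perturbation estimate for the coefficients of a solution -/

/-- The Duhamel bound holds mode by mode with the common constant `1 / (2Λ)`; summing under the time
integral and applying Bessel's inequality at almost every time recovers the norm of the source. -/
theorem IsSolution.sum_sq_sub_exp_le {ι : Type*} {T p Λ : ℝ} {n : ℤ} {g₀ : L2} {h : ℝ → ℝ → ℂ}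
    {g : ℝ → L2} (hT : 0 < T) (hh : IsSource T h) (hg : IsSolution T p n g₀ h g)
    (b : HilbertBasis ι ℝ RealL2) {lam : ι → ℝ} {e e' e'' : ι → ℝ → ℝ}
    (he : ∀ i, IsEigenfunction (fun x => (p * x + n) ^ 2) (lam i) (e i) (e' i) (e'' i))
    (hb : ∀ i, b i =ᵐ[volume.restrict (Ioo (-1 : ℝ) 1)] e i) (hΛ : 0 < Λ)
    (hlam : ∀ i, Λ ≤ lam i) {L : ℂ →L[ℝ] ℝ} (hL : ∀ z, |L z| ≤ ‖z‖) {t : ℝ} (ht : t ∈ Icc 0 T)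
    (F : Finset ι) :
    ∑ i ∈ F, (inner ℝ (b i) (L.compLpL 2 _ (g t))
        - Real.exp (-lam i * t) * inner ℝ (b i) (L.compLpL 2 _ (g 0))) ^ 2
      ≤ (∫ t in (0 : ℝ)..T, ∫ x in (-1 : ℝ)..1, ‖h t x‖ ^ 2) / (2 * Λ) := by
  have ce := fun i => (he i).continuous
  set H : ι → ℝ → ℝ := fun i t => L (∫ x in (-1 : ℝ)..1, h t x * (e i x : ℂ)) with hH
  have hH2 : ∀ i, IntervalIntegrable (fun t => H i t ^ 2) volume 0 T :=
    hh.intervalIntegrable_coeff_sq b hb ce hL hT.le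
  have h1 : ∀ i ∈ F, (inner ℝ (b i) (L.compLpL 2 _ (g t))
        - Real.exp (-lam i * t) * inner ℝ (b i) (L.compLpL 2 _ (g 0))) ^ 2
      ≤ 1 / (2 * Λ) * ∫ t in (0 : ℝ)..T, H i t ^ 2 := by
    intro i _
    have hc : ∀ t, inner ℝ (b i) (L.compLpL 2 _ (g t))
        = L (∫ x in (-1 : ℝ)..1, g t x * (e i x : ℂ)) := fun t =>
      inner_toLp_eq (hb i) (ce i) L (Lp.memLp (g t)) (L.coeFn_compLpL (g t))
    have hl := hΛ.trans_le (hlam i)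
    rw [hc, hc]
    have key := sq_sub_exp_mul_le (c := fun t => L (∫ x in (-1 : ℝ)..1, g t x * (e i x : ℂ)))
      (h := H i) hl hT
      (absolutelyContinuousOnInterval_clm_comp L (hg.absolutelyContinuous _ _ _ (he i).inDomain))
      (by
        have h1 := hh.intervalIntegrable_coeff hT.le (ce i)
        rw [intervalIntegrable_iff] at h1 ⊢
        exact L.integrable_comp h1)
      (hH2 i) (by
        filter_upwards [hg.hasDerivAt_coeff (he i)] with t ht
        refine (L.hasFDerivAt.comp_hasDerivAt t ht).congr_deriv ?_
        rw [map_sub, ← Complex.real_smul, map_smul]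
        rfl) ht
    refine key.trans (mul_le_mul_of_nonneg_right ?_
      (intervalIntegral.integral_nonneg hT.le fun _ _ => sq_nonneg _))
    exact one_div_le_one_div_of_le (by positivity) (by linarith [hlam i])
  refine (Finset.sum_le_sum h1).trans ?_
  rw [← Finset.mul_sum, ← intervalIntegral.integral_finsetSum fun i _ => hH2 i,
    one_div, inv_mul_eq_div]
  refine div_le_div_of_nonneg_right ?_ (by positivity)
  refine intervalIntegral.integral_mono_ae_restrict hT.le
    (by simpa only [Finset.sum_fn] using IntervalIntegrable.sum F fun i _ => hH2 i) (hh.intervalIntegrable_sq hT.le) ?_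
  filter_upwards [hh.ae_inL2] with t ht
  exact sum_sq_coeff_le b hb ce hL ht F

/-! ### Restriction to the observation interval -/

/-- Restriction of functions on `(-1,1)` to `(a,b)`. -/
noncomputable def restrictTo (a b : ℝ) :
    RealL2 →L[ℝ] Lp ℝ 2 ((volume.restrict (Ioo (-1 : ℝ) 1)).restrict (Ioo a b)) :=
  LpToLpRestrictCLM ℝ ℝ ℝ (volume.restrict (Ioo (-1 : ℝ) 1)) 2 (Ioo a b)

theorem norm_restrictTo_le (a b : ℝ) : ‖restrictTo a b‖ ≤ 1 :=
  ContinuousLinearMap.opNorm_le_bound _ zero_le_one fun f => by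
    rw [one_mul]; exact norm_Lp_toLp_restrict_le _ f

theorem norm_sq_restrictTo {a b : ℝ} (ha : -1 ≤ a) (hab : a ≤ b) (hb : b ≤ 1) {k : RealL2}
    {u : ℝ → ℝ} (hk : k =ᵐ[volume.restrict (Ioo (-1 : ℝ) 1)] u) :
    ‖restrictTo a b k‖ ^ 2 = ∫ x in a..b, u x ^ 2 := by
  have hm : (volume.restrict (Ioo (-1 : ℝ) 1)).restrict (Ioo a b) = volume.restrict (Ioo a b) := by
    rw [Measure.restrict_restrict measurableSet_Ioo, inter_eq_left.2 (Ioo_subset_Ioo ha hb)]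
  rw [← real_inner_self_eq_norm_sq, L2.inner_def, intervalIntegral.integral_of_le hab,
    integral_Ioc_eq_integral_Ioo, ← hm]
  refine integral_congr_ae ?_
  filter_upwards [LpToLpRestrictCLM_coeFn ℝ (Ioo a b) k, ae_restrict_of_ae hk] with x h1 h2
  have h3 : restrictTo a b k x = u x := h1.trans h2
  rw [h3]
  simp [inner, sq]

theorem sum_smul_coeFn {ι : Type*} {b : ι → RealL2} {e : ι → ℝ → ℝ}
    (hb : ∀ i, b i =ᵐ[volume.restrict (Ioo (-1 : ℝ) 1)] e i) (F : Finset ι) (c : ι → ℝ) :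
    (∑ i ∈ F, c i • b i : RealL2) =ᵐ[volume.restrict (Ioo (-1 : ℝ) 1)]
      fun x => ∑ i ∈ F, c i * e i x := by
  have h : ∀ᵐ x ∂(volume.restrict (Ioo (-1 : ℝ) 1)), ∀ i ∈ F, (c i • b i : RealL2) x = c i * e i x :=
    (ae_ball_iff F.countable_toSet).2 fun i _ => by
      filter_upwards [Lp.coeFn_smul (c i) (b i), hb i] with x h1 h2
      rw [h1, Pi.smul_apply, h2, smul_eq_mul]
  filter_upwards [Lp.coeFn_finsetSum F fun i => c i • b i, h] with x h1 h2
  rw [h1, Finset.sum_apply]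
  exact Finset.sum_congr rfl h2

/-! ### Observability estimate for solutions -/

/-- A lower bound for the Dirichlet eigenvalues of `-∂ₓ² + (p x + n)²` on `(-1,1)`. -/
noncomputable def spectralBound (p : ℝ) (n : ℤ) : ℝ :=
  max (max (1 / 4) |p|) (if 2 * |p| < |(n : ℝ)| then (n : ℝ) ^ 2 / 4 else 0)

theorem quarter_le_spectralBound (p : ℝ) (n : ℤ) : 1 / 4 ≤ spectralBound p n :=
  (le_max_left _ _).trans (le_max_left _ _)

theorem abs_le_spectralBound (p : ℝ) (n : ℤ) : |p| ≤ spectralBound p n :=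
  (le_max_right _ _).trans (le_max_left _ _)

theorem sq_div_four_le_spectralBound {p : ℝ} {n : ℤ} (h : 2 * |p| < |(n : ℝ)|) :
    (n : ℝ) ^ 2 / 4 ≤ spectralBound p n := by
  have := le_max_right (max (1 / 4) |p|) (if 2 * |p| < |(n : ℝ)| then (n : ℝ) ^ 2 / 4 else 0)
  rw [if_pos h] at this
  unfold spectralBound
  rwa [if_pos h]

theorem IsEigenfunction.spectralBound_le {p lam : ℝ} {n : ℤ} {e e' e'' : ℝ → ℝ}
    (h : IsEigenfunction (fun x => (p * x + n) ^ 2) lam e e' e'')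
    (hn : ∫ x in (-1 : ℝ)..1, e x ^ 2 = 1) : spectralBound p n ≤ lam := by
  have h1 := h.quarter_le hn fun x => sq_nonneg _
  refine max_le (max_le h1 (h.abs_slope_le hn)) ?_
  split_ifs with hq
  · exact h.sq_div_four_le hn hq
  · linarith

theorem sq_le_sq_one_add {p x : ℝ} {n : ℤ} (hx : x ∈ Icc (-1 : ℝ) 1) :
    (p * x + n) ^ 2 ≤ (1 + |p| + |(n : ℝ)|) ^ 2 := by
  rw [← sq_abs (p * x + n)]
  refine pow_le_pow_left₀ (abs_nonneg _) ((abs_add_le _ _).trans ?_) 2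
  rw [abs_mul]
  have : |p| * |x| ≤ |p| := mul_le_of_le_one_right (abs_nonneg p) (abs_le.2 hx)
  linarith

/-- The cost of observing the free evolution during time `min T 1 / 2`, weighted by the decay. -/
noncomputable def observationCost (C T p : ℝ) (n : ℤ) : ℝ :=
  C * Real.exp (4609 / (min T 1 / 2) + 6 * (1 + |p| + |(n : ℝ)|))
    * Real.exp (-(spectralBound p n * T))

theorem exists_partial_bound {a b : ℝ} (ha : -1 ≤ a) (hab : a < b) (hb : b ≤ 1) :
    ∃ C, 0 < C ∧ ∀ {T : ℝ}, 0 < T → ∀ {p : ℝ} {n : ℤ} {g₀ : L2} {h : ℝ → ℝ → ℂ} {g : ℝ → L2},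
      IsSource T h → IsSolution T p n g₀ h g → ∀ L : ℂ →L[ℝ] ℝ, (∀ z, |L z| ≤ ‖z‖) →
      ‖L.compLpL 2 _ (g T)‖ ^ 2 ≤ 6 * observationCost C T p n
          * (∫ t in (0 : ℝ)..T, ‖restrictTo a b (L.compLpL 2 _ (g t))‖ ^ 2)
        + (1 + 2 * observationCost C T p n) / spectralBound p n
          * ∫ t in (0 : ℝ)..T, ∫ x in (-1 : ℝ)..1, ‖h t x‖ ^ 2 := by
  obtain ⟨C, hC, hobs⟩ := heat_observability_finite ha hab hb
  refine ⟨C, hC, fun {T} hT {p n g₀ h g} hh hg L hL => ?_⟩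
  have hv : Continuous fun x : ℝ => (p * x + n) ^ 2 := by fun_prop
  obtain ⟨ι, B, lam, e, e', e'', hB⟩ := exists_dirichlet_eigenbasis hv fun x => sq_nonneg _
  have he := fun i => (hB i).1
  have hBe := fun i => (hB i).2
  have ho : ∀ i j, ∫ x in (-1 : ℝ)..1, e i x * e j x = inner ℝ (B i) (B j) := fun i j => by
    rw [L2.inner_def, intervalIntegral.integral_of_le (by norm_num), integral_Ioc_eq_integral_Ioo]
    refine integral_congr_ae ?_
    filter_upwards [hBe i, hBe j] with x h1 h2
    rw [h1, h2]
    simp [inner, mul_comm]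
  have hn : ∀ i, ∫ x in (-1 : ℝ)..1, e i x ^ 2 = 1 := fun i => by
    simp_rw [sq]
    rw [ho, real_inner_self_eq_norm_sq, B.orthonormal.1 i, one_pow]
  have hlam : ∀ i, spectralBound p n ≤ lam i := fun i => (he i).spectralBound_le (hn i)
  have hq := quarter_le_spectralBound p n
  -- Observing for time `min T 1 / 2` leaves half of `[0,T]` for decay, and `τ ≤ 1/2` keeps the
  -- source term free of a factor `τ`.
  have hτ : 0 < min T 1 / 2 := by positivity
  have hτ1 : min T 1 / 2 ≤ 1 / 2 := by linarith [min_le_right T 1]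
  have hτT : 2 * (min T 1 / 2) ≤ T := by linarith [min_le_left T 1]
  refine norm_sq_le_of_observability B (norm_restrictTo_le a b) (by linarith) hlam hτ hτ1 hτT
    (by positivity) (intervalIntegral.integral_nonneg hT.le fun t _ =>
      intervalIntegral.integral_nonneg (by norm_num) fun x _ => by positivity)
    (fun F c => ?_) (G := fun t => L.compLpL 2 _ (g t))
    ((L.compLpL 2 _).continuous.comp_continuousOn hg.continuousOn)
    (fun t ht F => hg.sum_sq_sub_exp_le hT hh B he hBe (by linarith) hlam hL ht F)
  have h1 : ∀ t, ‖restrictTo a b (∑ i ∈ F, (Real.exp (-lam i * t) * c i) • B i)‖ ^ 2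
      = ∫ x in a..b, (∑ i ∈ F, Real.exp (-lam i * t) * c i * e i x) ^ 2 := fun t =>
    norm_sq_restrictTo ha hab.le hb (sum_smul_coeFn hBe F _)
  simp_rw [h1]
  refine hobs (V := fun x => (p * x + n) ^ 2) (fun _ _ => sq_nonneg _)
    (fun x hx => sq_le_sq_one_add hx)
    (by linarith [abs_nonneg p, abs_nonneg (n : ℝ)]) he (fun i => hq.trans (hlam i))
    (fun i j => ?_) hτ F c
  rw [ho]
  classical
  have h2 := orthonormal_iff_ite.1 B.orthonormal i j
  convert h2

/-! ### Recombination of real and imaginary parts -/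

theorem abs_reCLM_le (z : ℂ) : |Complex.reCLM z| ≤ ‖z‖ := Complex.abs_re_le_norm z

theorem abs_imCLM_le (z : ℂ) : |Complex.imCLM z| ≤ ‖z‖ := Complex.abs_im_le_norm z

theorem norm_sq_eq_reCLM_add_imCLM (z : ℂ) :
    Complex.reCLM z ^ 2 + Complex.imCLM z ^ 2 = ‖z‖ ^ 2 := by
  rw [← Complex.normSq_eq_norm_sq, Complex.normSq_apply]
  simp [sq]

theorem norm_sq_restrictTo_re_add_im {a b : ℝ} (ha : -1 ≤ a) (hab : a ≤ b) (hb : b ≤ 1) (f : L2) :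
    ‖restrictTo a b (Complex.reCLM.compLpL 2 _ f)‖ ^ 2
      + ‖restrictTo a b (Complex.imCLM.compLpL 2 _ f)‖ ^ 2 = ∫ x in a..b, ‖f x‖ ^ 2 := by
  have hi : ∀ L : ℂ →L[ℝ] ℝ, IntervalIntegrable (fun x => L (f x) ^ 2) volume a b := fun L => by
    rw [intervalIntegrable_iff_integrableOn_Ioo_of_le hab]
    exact (MemLp.integrable_sq (L.comp_memLp' (Lp.memLp f))).mono_measure
      (Measure.restrict_mono (Ioo_subset_Ioo ha hb) le_rfl)
  rw [norm_sq_restrictTo ha hab hb (Complex.reCLM.coeFn_compLpL f),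
    norm_sq_restrictTo ha hab hb (Complex.imCLM.coeFn_compLpL f),
    ← intervalIntegral.integral_add (hi _) (hi _)]
  simp_rw [norm_sq_eq_reCLM_add_imCLM]

theorem norm_sq_re_add_im (f : L2) :
    ‖Complex.reCLM.compLpL 2 _ f‖ ^ 2 + ‖Complex.imCLM.compLpL 2 _ f‖ ^ 2
      = ∫ x in (-1 : ℝ)..1, ‖f x‖ ^ 2 := by
  have h : ∀ k : RealL2, ‖k‖ ^ 2 = ‖restrictTo (-1) 1 k‖ ^ 2 := fun k => by
    rw [norm_sq_toLp_eq (Filter.EventuallyEq.refl _ k),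
      norm_sq_restrictTo le_rfl (by norm_num) le_rfl (Filter.EventuallyEq.refl _ k)]
  rw [h, h, norm_sq_restrictTo_re_add_im le_rfl (by norm_num) le_rfl]

/-- The observed energies of the two parts add up exactly. The source term doubles because each part
was bounded using the whole of `‖h‖²`. -/
theorem exists_solution_bound {a b : ℝ} (ha : -1 ≤ a) (hab : a < b) (hb : b ≤ 1) :
    ∃ C, 0 < C ∧ ∀ {T : ℝ}, 0 < T → ∀ {p : ℝ} {n : ℤ} {g₀ : L2} {h : ℝ → ℝ → ℂ} {g : ℝ → L2},
      IsSource T h → IsSolution T p n g₀ h g →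
      ∫ x in (-1 : ℝ)..1, ‖g T x‖ ^ 2 ≤ 6 * observationCost C T p n
          * (∫ t in (0 : ℝ)..T, ∫ x in a..b, ‖g t x‖ ^ 2)
        + 2 * ((1 + 2 * observationCost C T p n) / spectralBound p n)
          * ∫ t in (0 : ℝ)..T, ∫ x in (-1 : ℝ)..1, ‖h t x‖ ^ 2 := by
  obtain ⟨C, hC, hbd⟩ := exists_partial_bound ha hab hb
  refine ⟨C, hC, fun {T} hT {p n g₀ h g} hh hg => ?_⟩
  have h1 := hbd hT hh hg _ abs_reCLM_le
  have h2 := hbd hT hh hg _ abs_imCLM_le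
  have hi : ∀ L : ℂ →L[ℝ] ℝ, IntervalIntegrable
      (fun t => ‖restrictTo a b (L.compLpL 2 _ (g t))‖ ^ 2) volume 0 T := fun L => by
    refine ContinuousOn.intervalIntegrable ?_
    rw [uIcc_of_le hT.le]
    exact (((restrictTo a b).continuous.comp (L.compLpL 2 _).continuous).comp_continuousOn
      hg.continuousOn).norm.pow 2
  rw [← norm_sq_re_add_im]
  simp_rw [← norm_sq_restrictTo_re_add_im ha hab.le hb]
  rw [intervalIntegral.integral_add (hi _) (hi _)]
  linarith

/-! ### Constants -/

theorem one_div_min_le {T : ℝ} (hT : 0 < T) : 1 / (min T 1 / 2) ≤ 2 * (1 + 1 / T) := by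
  have h0 : 0 < 1 / T := by positivity
  rcases min_cases T 1 with ⟨h, _⟩ | ⟨h, _⟩ <;> rw [h]
  · rw [one_div_div, div_eq_mul_one_div]; linarith
  · linarith

/-- The prefactor is absorbed by `C ≤ exp C`, and `9224 = 2 · 4609 + 6`. -/
theorem observationCost_le {C T p : ℝ} {n : ℤ} (hC : 0 < C) (hT : 0 < T) :
    observationCost C T p n ≤
      Real.exp ((C + 9224) * (1 + 1 / T + |p| + |(n : ℝ)|) - spectralBound p n * T) := by
  have h1 : C ≤ Real.exp C := (le_add_of_nonneg_right zero_le_one).trans (Real.add_one_le_exp C)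
  have h2 : 4609 / (min T 1 / 2) ≤ 4609 * (2 * (1 + 1 / T)) := by
    rw [div_eq_mul_one_div]; linarith [one_div_min_le hT]
  have h0 : 0 < 1 / T := by positivity
  have hp := abs_nonneg p
  have hn := abs_nonneg (n : ℝ)
  calc observationCost C T p n
      ≤ Real.exp C * Real.exp (4609 / (min T 1 / 2) + 6 * (1 + |p| + |(n : ℝ)|))
          * Real.exp (-(spectralBound p n * T)) := by unfold observationCost; gcongr
    _ ≤ _ := by
      rw [← Real.exp_add, ← Real.exp_add]
      refine Real.exp_le_exp.2 ?_
      nlinarith [mul_pos hC h0, mul_nonneg hC.le hp, mul_nonneg hC.le hn]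

theorem mul_le_sq_mul_add {A N T : ℝ} (hT : 0 < T) :
    A * N ≤ N ^ 2 * T / 8 + 2 * A ^ 2 * (1 / T) := by
  have h : N ^ 2 * T / 8 + 2 * A ^ 2 * (1 / T) - A * N = (N * T - 4 * A) ^ 2 / (8 * T) := by
    field_simp; ring
  have : 0 ≤ (N * T - 4 * A) ^ 2 / (8 * T) := by positivity
  linarith

/-- Here `|p| ≤ |n|/2`, so the linear terms are at most `(3/2) A |n|`. Young's inequality bounds
this by half of the available decay `n² T / 4` plus `(9/2) A² / T`. -/
theorem exponent_le_of_lt {A T p : ℝ} {n : ℤ} (hA : 1 ≤ A) (hT : 0 < T)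
    (h : 2 * |p| < |(n : ℝ)|) :
    A * (1 + 1 / T + |p| + |(n : ℝ)|) - spectralBound p n * T
      ≤ 6 * A ^ 2 * (1 + 1 / T) - (n : ℝ) ^ 2 * T / 8 := by
  have h0 : 0 < 1 / T := by positivity
  have h1 := mul_le_mul_of_nonneg_right (sq_div_four_le_spectralBound h) hT.le
  have h2 := mul_le_sq_mul_add (A := 3 / 2 * A) (N := |(n : ℝ)|) hT
  rw [sq_abs] at h2
  have h3 : A * |p| ≤ A * (|(n : ℝ)| / 2) := mul_le_mul_of_nonneg_left (by linarith) (by linarith)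
  have h4 : A ≤ A ^ 2 := by nlinarith
  have h5 := mul_le_mul_of_nonneg_right h4 h0.le
  nlinarith

/-- For large `|n|` the previous bound suffices because `p² ≤ n²`; otherwise `|n| ≤ 2|p|` and the
decay rate `|p|` is used. This is the source of `min |p| p²`. -/
theorem exponent_le {A T p : ℝ} {n : ℤ} (hA : 1 ≤ A) (hT : 0 < T) :
    A * (1 + 1 / T + |p| + |(n : ℝ)|) - spectralBound p n * T
      ≤ 6 * A ^ 2 * (1 + 1 / T + |p|) - min |p| (p ^ 2) * T / 8 := by
  have h0 : 0 < 1 / T := by positivity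
  have hp := abs_nonneg p
  have h4 : A ≤ A ^ 2 := by nlinarith
  by_cases h : 2 * |p| < |(n : ℝ)|
  · refine (exponent_le_of_lt hA hT h).trans ?_
    have h1 : p ^ 2 ≤ (n : ℝ) ^ 2 := sq_le_sq.2 (by linarith)
    have h2 := mul_le_mul_of_nonneg_right ((min_le_right |p| (p ^ 2)).trans h1) hT.le
    nlinarith [mul_nonneg (sq_nonneg A) hp]
  · have h1 := mul_le_mul_of_nonneg_right (abs_le_spectralBound p n) hT.le
    have h2 := mul_le_mul_of_nonneg_right (min_le_left |p| (p ^ 2)) hT.le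
    have h3 : A * |(n : ℝ)| ≤ A * (2 * |p|) :=
      mul_le_mul_of_nonneg_left (not_lt.1 h) (by linarith)
    have h5 := mul_le_mul_of_nonneg_right h4 h0.le
    have h6 := mul_le_mul_of_nonneg_right h4 hp
    have h7 : 0 ≤ |p| * T := by positivity
    nlinarith [mul_nonneg (sq_nonneg A) hp, mul_nonneg (sq_nonneg A) h0.le]

theorem two_div_spectralBound_le (p : ℝ) (n : ℤ) : 2 / spectralBound p n ≤ 10 / (|p| + 1) := by
  have h1 := quarter_le_spectralBound p n
  have h2 := abs_le_spectralBound p n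
  rw [div_le_div_iff₀ (by linarith) (by positivity)]
  linarith

theorem two_div_spectralBound_le_of_lt {p : ℝ} {n : ℤ} (h : 2 * |p| < |(n : ℝ)|) :
    2 / spectralBound p n ≤ 10 / (n : ℝ) ^ 2 := by
  have h1 := sq_div_four_le_spectralBound h
  have h2 := quarter_le_spectralBound p n
  have h3 : (0 : ℝ) < (n : ℝ) ^ 2 :=
    sq_pos_of_ne_zero (abs_pos.1 ((by positivity : (0 : ℝ) ≤ 2 * |p|).trans_lt h))
  rw [div_le_div_iff₀ (by linarith) h3]
  linarith

theorem sixteen_le_exp_three : (16 : ℝ) ≤ Real.exp 3 := by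
  have h := Real.exp_one_gt_d9
  have h1 : Real.exp 3 = Real.exp 1 ^ 3 := by rw [← Real.exp_nat_mul]; norm_num
  rw [h1]
  have h2 : (2.7 : ℝ) ^ 3 ≤ Real.exp 1 ^ 3 := pow_le_pow_left₀ (by norm_num) (by linarith) 3
  norm_num at h2 ⊢
  linarith

end HeisenbergMode

theorem mainTheorem7 (a b : ℝ) (ha : -1 ≤ a) (hab : a < b) (hb : b ≤ 1) :
    ∃ C₃ C₄ : ℝ, 0 < C₃ ∧ 0 < C₄ ∧
      ∀ (T : ℝ), 0 < T → ∀ (p : ℝ) (n : ℤ), ∃ ε : ℝ,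
        |ε| ≤ C₃ / (|p| + 1) + Real.exp (C₃ * (1 + 1 / T + |p| - C₄ * min |p| (p ^ 2) * T)) ∧
        (2 * |p| < |(n : ℝ)| →
          |ε| ≤ C₃ / (n : ℝ) ^ 2 + Real.exp (C₃ * (1 + 1 / T - C₄ * (n : ℝ) ^ 2 * T))) ∧
        ∀ (g₀ : HeisenbergMode.L2) (h : ℝ → ℝ → ℂ) (g : ℝ → HeisenbergMode.L2),
          HeisenbergMode.IsSource T h → HeisenbergMode.IsSolution T p n g₀ h g →
          (∫ x in (-1 : ℝ)..1, ‖g T x‖ ^ 2) ≤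
            Real.exp (C₃ * (1 + 1 / T + |p| - C₄ * min |p| (p ^ 2) * T))
                * (∫ t in (0 : ℝ)..T, ∫ x in a..b, ‖g t x‖ ^ 2)
              + ε * ∫ t in (0 : ℝ)..T, ∫ x in (-1 : ℝ)..1, ‖h t x‖ ^ 2 := by
  obtain ⟨C, hC, hbd⟩ := HeisenbergMode.exists_solution_bound ha hab hb
  set A : ℝ := C + 9224 with hA
  have hA1 : 1 ≤ A := by linarith
  -- The `10` covers both the bounds on `2/Λ` and the exponent `3` that absorbs the factor `16`. The
  -- choice of `C₄` makes `C₃ C₄ = 1/8`, the rate left in the exponent lemmas.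
  set C₃ : ℝ := 6 * A ^ 2 + 10 with hC₃
  have hC₃0 : 0 < C₃ := by positivity
  refine ⟨C₃, 1 / (8 * C₃), hC₃0, by positivity, fun T hT p n => ?_⟩
  have h0 : 0 < 1 / T := by positivity
  have hp := abs_nonneg p
  set K := HeisenbergMode.observationCost C T p n with hK
  set Λ := HeisenbergMode.spectralBound p n with hΛ
  have hΛ1 : 1 / 4 ≤ Λ := HeisenbergMode.quarter_le_spectralBound p n
  have hΛ0 : 0 < Λ := by linarith
  have hK0 : 0 < K := by rw [hK]; unfold HeisenbergMode.observationCost; positivity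
  have hK1 : K ≤ Real.exp (A * (1 + 1 / T + |p| + |(n : ℝ)|) - Λ * T) :=
    HeisenbergMode.observationCost_le hC hT
  have hscale : ∀ s : ℝ, C₃ * (1 / (8 * C₃) * s * T) = s * T / 8 := fun s => by field_simp
  have hKp : 16 * K ≤ Real.exp (C₃ * (1 + 1 / T + |p| - 1 / (8 * C₃) * min |p| (p ^ 2) * T)) := by
    calc 16 * K ≤ Real.exp 3 * Real.exp (6 * A ^ 2 * (1 + 1 / T + |p|)
          - min |p| (p ^ 2) * T / 8) :=
        mul_le_mul HeisenbergMode.sixteen_le_exp_three (hK1.trans (Real.exp_le_exp.2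
          (HeisenbergMode.exponent_le hA1 hT))) hK0.le (Real.exp_pos _).le
      _ ≤ _ := by
        rw [← Real.exp_add, mul_sub, hscale]
        refine Real.exp_le_exp.2 ?_
        rw [hC₃]; linarith
  have hKn : 2 * |p| < |(n : ℝ)| →
      16 * K ≤ Real.exp (C₃ * (1 + 1 / T - 1 / (8 * C₃) * (n : ℝ) ^ 2 * T)) := fun h => by
    calc 16 * K ≤ Real.exp 3 * Real.exp (6 * A ^ 2 * (1 + 1 / T) - (n : ℝ) ^ 2 * T / 8) :=
        mul_le_mul HeisenbergMode.sixteen_le_exp_three (hK1.trans (Real.exp_le_exp.2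
          (HeisenbergMode.exponent_le_of_lt hA1 hT h))) hK0.le (Real.exp_pos _).le
      _ ≤ _ := by
        rw [← Real.exp_add, mul_sub, hscale]
        refine Real.exp_le_exp.2 ?_
        rw [hC₃]; linarith
  -- The part without `K` gives the polynomial decay in `p` or `n`; the rest is exponential, with
  -- `4/Λ ≤ 16`.
  have hε : |2 * ((1 + 2 * K) / Λ)| ≤ 2 / Λ + 16 * K := by
    rw [abs_of_pos (by positivity)]
    have h1 : 2 * ((1 + 2 * K) / Λ) = 2 / Λ + 4 * K / Λ := by ring
    have h2 : 4 * K / Λ ≤ 16 * K := by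
      rw [div_le_iff₀ hΛ0]; nlinarith
    linarith
  have h10 : (10 : ℝ) ≤ C₃ := by rw [hC₃]; linarith [sq_nonneg A]
  refine ⟨2 * ((1 + 2 * K) / Λ), hε.trans (add_le_add ?_ hKp),
    fun h => hε.trans (add_le_add ?_ (hKn h)), fun g₀ h g hh hg => ?_⟩
  · exact (HeisenbergMode.two_div_spectralBound_le p n).trans (by gcongr)
  · exact (HeisenbergMode.two_div_spectralBound_le_of_lt h).trans (by gcongr)
  · refine (hbd hT hh hg).trans (add_le_add (mul_le_mul_of_nonneg_right ?_ ?_) le_rfl)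
    · linarith
    · exact intervalIntegral.integral_nonneg hT.le fun t _ =>
        intervalIntegral.integral_nonneg hab.le fun x _ => by positivity
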